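/- **Setting.** Let $P=\{(x^1,x^2)\in\mathbb R^2 : 0\le x^1\le 4-x^2,\ 0\le x^2\le 2\}$ be the moment trapezoid of the Hirzebruch surface $\mathbb F_1=\{([s_0:s_1],[t_0:t_1:t_2]) : s_0t_0=s_1t_1\}$, $B=\operatorname{Int}P$, and let $\check M\subset\mathbb F_1$ be the open torus, with coordinates $u=s_0/s_1=e^{z_1}$, $v=t_2/t_0=e^{z_2}$, $z_k=x_k+\mathbf i y_k$, and moment map $$\mu=\Big(\tfrac{2s}{1+s}+\tfrac{2s}{1+s+t},\ \tfrac{2t}{1+s+t}\Big):\check M\to B,\qquad s=|u|^2,\ t=|v|^2 .$$ Let $g$ be the Hessian metric on $B$ with $g^{ij}=\partial x^i/\partial x_j$, and let $M=TB/\mathbb Z^2$, with fibre coordinates $(y^1,y^2)$ of period $1$ and symplectic form $\omega=\sum g_{ij}\,dx^i\wedge dy^j$. For $a,b\in\mathbb Z$ let $\mathcal O(a,b)=\mathcal O(a\{s_0=t_1=0\}+b\{t_2=0\})$, and let $L(a,b)$ be the Lagrangian section $$y_{(a,b)}(x)=\Big(\tfrac{(2a+(2-x^2)b)\,x^1}{2(4-x^2)},\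 \tfrac{b\,x^2}{2}\Big),$$ which is the graph of $df$ for $f=\frac a2\log(1+s)+\frac b2\log(1+s+t)$; it extends smoothly to $\widetilde B=\{x^2<4\}\supset P$. **The category $\mathit{Mo}(P)$.** For $L=L(a_1,b_1)$, $L'=L(a_2,b_2)$ let $\pi(L\cap L')=\{x\in P : y_{L'}(x)-y_L(x)\in\mathbb Z^2\}$. For $v\in\pi(L\cap L')$ let $S_v\subset\widetilde B$ be the stable manifold of $v$ for the vector field $-\operatorname{grad}(f_L-f_{L'})$, i.e. $x\mapsto (y_{L'}-y_L)(x)-(y_{L'}-y_L)(v)$. Then $\mathit{Mo}(P)(L,L')$ is the graded complex vector space generated by the connected components $V$ of $\pi(L\cap L')$ that contain a point $v$ interior to $S_v\cap P$ relative to $S_v$; the degree of $V$ is $|V|=\dim S_v$, $v\in V$. The composition is $$\mathfrak m_2(V_{12},V_{23})=\sum_{|V_{13}|=|V_{12}|+|V_{23}|}\ \sum_{[\gamma]}e^{-A(\gamma)}\,V_{13},$$ where $[\gamma]$ runs over the smooth homotopy classes of trivalent gradient trees $\gamma$ in $P$ that start at points $v_{12}\in V_{12}$, $v_{23}\in V_{23}$,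 end at a point $v_{13}\in V_{13}$, and satisfy $(y_{L_3}-y_{L_1})(v_{13})=(y_{L_2}-y_{L_1})(v_{12})+(y_{L_3}-y_{L_2})(v_{23})$ (so that they lift to the covering of $M$), and where $A(\gamma)$ is the $\omega$-area of the disk in $M$ obtained by lifting $\gamma$. The identity of $L$ is the generator $P\in\mathit{Mo}(P)(L,L)$, and $\mathfrak m_k=0$ for $k\neq2$. **The DG category $\mathcal V'$.** Its objects are the line bundles $\mathcal O(a,b)$, trivialized over $\check M$ by the factor $\Psi_{(a,b)}=(1+s)^{a/2}(1+s+t)^{b/2}$, so that the connection becomes $d-\mathbf i\sum_k y^k_{(a,b)}dy_k$. The morphisms from $\mathcal O(a_1,b_1)$ to $\mathcal O(a_2,b_2)$ are the restrictions to $\check M$, written in these trivializations, of the smooth $(0,*)$-forms on $\mathbb F_1$ with values in $\mathcal O(a_2-a_1,b_2-b_1)$, with differential $2\bar\partial+\sum_k(y_{(a_2,b_2)}-y_{(a_1,b_1)})^k\,d\bar z_k$ and composition $(\psi,\varphi)\mapsto\psi\wedge\varphi$. **Theorem.** Let $c\in\{0,1,2,\dots\}$, and let $\mathit{Mo}_{\mathcal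 E}(P)$ and $\mathcal V'_{\mathcal E}$ be the full subcategories of $\mathit{Mo}(P)$ and $\mathcal V'$ on $L(0,0),L(1,0),L(c,1),L(1+c,1)$ and on $\mathcal O,\mathcal O(1,0),\mathcal O(c,1),\mathcal O(1+c,1)$. Then $\mathit{Mo}_{\mathcal E}(P)$ is a well-defined strictly unital $A_\infty$-category (the sums defining $\mathfrak m_2$ are finite, areas are finite and homotopy invariant, and the $\mathfrak m_k$ above are the only operations of degrees $2-k$ with the given $\mathfrak m_2$ that make it a strictly unital $A_\infty$-category with these identities), $\mathcal V'_{\mathcal E}$ is a DG category, and there is a linear $A_\infty$-equivalence $$\iota:\mathit{Mo}_{\mathcal E}(P)\to\mathcal V'_{\mathcal E},\qquad L(a,b)\mapsto\mathcal O(a,b),$$ that is, a family of degree-$0$ linear maps on the spaces of morphisms that commute strictly with all $\mathfrak m_k$, preserve identities, and induce isomorphisms on the cohomology of all spaces of morphisms, such that for every generator $V\in\mathit{Mo}_{\mathcal E}(P)(L,L')$: * $\iota(V)$ has degree $0$ and is of the form $h(x)\,e^{\mathbf i(i_1y_1+i_2y_2)}$ with $i_1,i_2\in\mathbb Z$ and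 a function $h$ on $B$ that extends to a continuous function on $P$; * $\max_{x\in P}|h(x)|=1$ and $\{x\in P : |h(x)|=1\}=V$. -/

import Mathlib

open Set Filter Topology MeasureTheory
open scoped ContDiff ENNReal

noncomputable section

namespace HMS

/-! ## Strict `A∞`-language over `ℂ` -/

/-- Composable words `X → ⋯ → Y` of morphisms. -/
inductive Word {Ob : Type} (H : Ob → Ob → Type) : Ob → Ob → Type
  | nil (X : Ob) : Word H X X
  | cons {X Y Z : Ob} (f : H X Y) (w : Word H Y Z) : Word H X Z

namespace Word

variable {Ob : Type} {H H' : Ob → Ob → Type}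

def length : ∀ {X Y : Ob}, Word H X Y → ℕ
  | _, _, nil _ => 0
  | _, _, cons _ w => w.length + 1

def append : ∀ {X Y Z : Ob}, Word H X Y → Word H Y Z → Word H X Z
  | _, _, _, nil _, w => w
  | _, _, _, cons f v, w => cons f (v.append w)

def map (φ : ∀ X Y, H X Y → H' X Y) : ∀ {X Y : Ob}, Word H X Y → Word H' X Y
  | _, _, nil X => nil X
  | _, _, cons f w => cons (φ _ _ f) (w.map φ)

/-- All ways to write a word as a concatenation `p ++ q`. -/
def splits : ∀ {X Y : Ob}, Word H X Y → List (Σ Z : Ob, Word H X Z × Word H Z Y)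
  | _, _, nil X => [⟨X, nil X, nil X⟩]
  | X, _, cons f w =>
      ⟨X, nil X, cons f w⟩ :: w.splits.map fun s => ⟨s.1, cons f s.2.1, s.2.2⟩

/-- The operations on words given by a unary operation `d`, a binary operation `mul`, and zero in
all other arities. -/
def ops [∀ X Y, Zero (H X Y)] (d : ∀ X Y, H X Y → H X Y)
    (mul : ∀ X Y Z, H X Y → H Y Z → H X Z) : ∀ {X Y : Ob}, Word H X Y → H X Y
  | _, _, nil _ => 0
  | _, _, cons f (nil _) => d _ _ f
  | _, _, cons f (cons g (nil _)) => mul _ _ _ f g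
  | _, _, cons _ (cons _ (cons _ _)) => 0

end Word

/-- The data of a (strictly unital) `A∞`-category: graded complex vector spaces of morphisms, the
operations `m_k` (the value of `m` on words of length `k`), and the units. -/
structure AInfData (Ob : Type) where
  Hom : Ob → Ob → Type
  [acg : ∀ X Y, AddCommGroup (Hom X Y)]
  [mod : ∀ X Y, Module ℂ (Hom X Y)]
  gr : ∀ X Y, ℤ → Submodule ℂ (Hom X Y)
  m : ∀ {X Y : Ob}, Word Hom X Y → Hom X Y
  one : ∀ X, Hom X X

attribute [instance] AInfData.acg AInfData.mod

namespace AInfData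

variable {Ob : Type}

/-- Words of homogeneous morphisms, with their degrees. -/
abbrev HWord (A : AInfData Ob) (X Y : Ob) : Type :=
  Word (fun X Y => Σ d : ℤ, A.gr X Y d) X Y

def deg (A : AInfData Ob) : ∀ {X Y : Ob}, A.HWord X Y → ℤ
  | _, _, .nil _ => 0
  | _, _, .cons f w => f.1 + A.deg w

def forget (A : AInfData Ob) {X Y : Ob} (w : A.HWord X Y) : Word A.Hom X Y :=
  w.map fun _ _ f => (f.2 : A.Hom _ _)

/-- The differential `m₁`. -/
def m1 (A : AInfData Ob) {X Y : Ob} (f : A.Hom X Y) : A.Hom X Y := A.m (.cons f (.nil Y))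

/-- The binary composition `m₂`, in the order `Hom(X,Y) ⊗ Hom(Y,Z) → Hom(X,Z)`. -/
def m2 (A : AInfData Ob) {X Y Z : Ob} (f : A.Hom X Y) (g : A.Hom Y Z) : A.Hom X Z :=
  A.m (.cons f (.cons g (.nil Z)))

/-- The same morphisms, grading and units with other operations. -/
def withOps (A : AInfData Ob) (m : ∀ X Y : Ob, Word A.Hom X Y → A.Hom X Y) : AInfData Ob where
  Hom := A.Hom
  gr := A.gr
  m := m _ _
  one := A.one

/-- The laws of a strictly unital `A∞`-category. The `A∞`-relations are
`∑_{r+s+t=n} (-1)^{r+st} m_{r+1+t} (id^r ⊗ m_s ⊗ id^t) = 0`, evaluated on homogeneous elements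
with the Koszul sign `(-1)^{s(|x₁|+⋯+|x_r|)}`. -/
structure IsAInf (A : AInfData Ob) : Prop where
  internal : ∀ X Y, DirectSum.IsInternal (A.gr X Y)
  m_nil : ∀ X, A.m (.nil X) = 0
  linear : ∀ {X Y Z W : Ob} (p : Word A.Hom X Y) (q : Word A.Hom Z W),
    IsLinearMap ℂ fun f : A.Hom Y Z => A.m (p.append (.cons f q))
  degree : ∀ {X Y : Ob} (w : A.HWord X Y),
    A.m (A.forget w) ∈ A.gr X Y (A.deg w + 2 - w.length)
  relation : ∀ {X Y : Ob} (w : A.HWord X Y),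
    (w.splits.flatMap fun s => s.2.2.splits.map fun s' =>
      ((Int.negOnePow (s.2.1.length + s'.2.1.length * s'.2.2.length
          + s'.2.1.length * A.deg s.2.1) : ℤˣ) : ℤ) •
        A.m ((A.forget s.2.1).append
          (.cons (A.m (A.forget s'.2.1)) (A.forget s'.2.2)))).sum = 0
  one_mem : ∀ X, A.one X ∈ A.gr X X 0
  one_m2 : ∀ {X Y : Ob} (f : A.Hom X Y), A.m2 (A.one X) f = f
  m2_one : ∀ {X Y : Ob} (f : A.Hom X Y), A.m2 f (A.one Y) = f
  m_one : ∀ {X Y Z : Ob} (p : Word A.Hom X Y) (q : Word A.Hom Y Z),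
    p.length + q.length ≠ 1 → A.m (p.append (.cons (A.one Y) q)) = 0

/-- No other operations of degrees `2 - k` with the same `m₂` make `A` an `A∞`-category. -/
def DeterminedByM2 (A : AInfData Ob) : Prop :=
  ∀ m' : ∀ X Y : Ob, Word A.Hom X Y → A.Hom X Y, (A.withOps m').IsAInf →
    (∀ (X Y Z : Ob) (f : A.Hom X Y) (g : A.Hom Y Z),
      m' X Z (.cons f (.cons g (.nil Z))) = A.m2 f g) →
    ∀ (X Y : Ob) (w : Word A.Hom X Y), m' X Y w = A.m w

/-- A family of linear maps is a linear `A∞`-equivalence that is the identity on (labels of)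
objects: it has degree zero, commutes strictly with all the `m_k` (so that it is an `A∞`-functor
with vanishing higher components), preserves units, and induces an isomorphism between the
`m₁`-cohomologies of all the spaces of morphisms. -/
structure IsLinearEquivalence (A B : AInfData Ob)
    (F : ∀ X Y, A.Hom X Y →ₗ[ℂ] B.Hom X Y) : Prop where
  degree : ∀ X Y d f, f ∈ A.gr X Y d → F X Y f ∈ B.gr X Y d
  map_m : ∀ {X Y : Ob} (w : Word A.Hom X Y),
    F X Y (A.m w) = B.m (w.map fun X Y f => F X Y f)
  map_one : ∀ X, F X X (A.one X) = B.one X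
  coh_injective : ∀ X Y f, A.m1 f = 0 → (∃ g, F X Y f = B.m1 g) → ∃ f', f = A.m1 f'
  coh_surjective : ∀ X Y g, B.m1 g = 0 → ∃ f, A.m1 f = 0 ∧ ∃ g', g = F X Y f + B.m1 g'

end AInfData

/-! ## The moment polytope and the Lagrangian sections -/

/-- The moment trapezoid of `𝔽₁` (with `C₁ = C₂ = 1`), in the affine coordinates `(x¹, x²)`. -/
def P : Set (ℝ × ℝ) := {x | 0 ≤ x.1 ∧ x.1 ≤ 4 - x.2 ∧ 0 ≤ x.2 ∧ x.2 ≤ 2}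

/-- An open neighbourhood of `P` to which all the sections extend. -/
def Btilde : Set (ℝ × ℝ) := {x | x.2 < 4}

/-- The Lagrangian section `L(a,b)` of `M → B`, in fibre coordinates `(y¹, y²)` scaled so that the
period lattice is `ℤ²`. It is a section of `TB`, hence also a vector field: the gradient of its
potential `f` with respect to the Hessian metric. -/
def lagr (L : ℤ × ℤ) (x : ℝ × ℝ) : ℝ × ℝ :=
  ((2 * L.1 + (2 - x.2) * L.2) * x.1 / (2 * (4 - x.2)), L.2 * x.2 / 2)

/-- The difference of two of the sections. -/
def disp (L L' : ℤ × ℤ) (x : ℝ × ℝ) : ℝ × ℝ := lagr L' x - lagr L x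

/-! ## The Morse homotopy category -/

/-- `π(L ∩ L')` in `P`. -/
def inter (L L' : ℤ × ℤ) : Set (ℝ × ℝ) :=
  {x | x ∈ P ∧ ∃ i : ℤ × ℤ, disp L L' x = ((i.1 : ℝ), (i.2 : ℝ))}

/-- The vector field `-grad (f_L - f_{L'})`, for the local potentials whose graphs meet over `v`. -/
def gradField (L L' : ℤ × ℤ) (v x : ℝ × ℝ) : ℝ × ℝ := disp L L' x - disp L L' v

/-- The stable manifold `S_v` of `-grad (f_L - f_{L'})`. -/
def stable (L L' : ℤ × ℤ) (v : ℝ × ℝ) : Set (ℝ × ℝ) :=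
  {x | ∃ γ : ℝ → ℝ × ℝ, γ 0 = x ∧
    (∀ t, 0 ≤ t → γ t ∈ Btilde ∧
      HasDerivWithinAt γ (gradField L L' v (γ t)) (Ici 0) t) ∧
    Tendsto γ atTop (𝓝 v)}

/-- `V` is a connected component of `π(L ∩ L')` containing a point `v` that is an interior point of
`S_v ∩ P` relative to `S_v`. -/
def IsGen (L L' : ℤ × ℤ) (V : Set (ℝ × ℝ)) : Prop :=
  (∃ x ∈ inter L L', V = connectedComponentIn (inter L L') x) ∧
    ∃ v ∈ V, ∀ᶠ z in 𝓝[stable L L' v] v, z ∈ P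

/-- The generators of `Mo(P)(L, L')`. -/
def Gen (L L' : ℤ × ℤ) : Type := {V : Set (ℝ × ℝ) // IsGen L L' V}

/-- `|V| = n`: the stable manifolds of the points of `V` have dimension `n`. -/
def Gen.HasDeg {L L' : ℤ × ℤ} (V : Gen L L') (n : ℕ) : Prop :=
  ∀ v ∈ V.1, dimH (stable L L' v) = n

/-- Trivalent gradient trees in `P`. The two incoming edges are trajectories on `(-∞, 0]` starting
(at `t = -∞`) at `v12 ∈ V12` and `v23 ∈ V23`, the root edge is a trajectory on `[0, ∞)` ending at
`v13 ∈ V13`, and the three edges meet at time `0` in the trivalent vertex. The condition `index`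
says that the tree lifts to the cover of `M`: the local potentials used along the three edges
satisfy `f₁₃ = f₁₂ + f₂₃` up to constants. The paths are continued constantly beyond the vertex. -/
structure GTree {L1 L2 L3 : ℤ × ℤ} (V12 : Gen L1 L2) (V23 : Gen L2 L3) (V13 : Gen L1 L3) where
  v12 : ℝ × ℝ
  v23 : ℝ × ℝ
  v13 : ℝ × ℝ
  e12 : ℝ → ℝ × ℝ
  e23 : ℝ → ℝ × ℝ
  e13 : ℝ → ℝ × ℝ
  mem12 : v12 ∈ V12.1
  mem23 : v23 ∈ V23.1
  mem13 : v13 ∈ V13.1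
  index : disp L1 L3 v13 = disp L1 L2 v12 + disp L2 L3 v23
  flow12 : ∀ t ≤ 0, e12 t ∈ P ∧
    HasDerivWithinAt e12 (gradField L1 L2 v12 (e12 t)) (Iic 0) t
  flow23 : ∀ t ≤ 0, e23 t ∈ P ∧
    HasDerivWithinAt e23 (gradField L2 L3 v23 (e23 t)) (Iic 0) t
  flow13 : ∀ t, 0 ≤ t → e13 t ∈ P ∧
    HasDerivWithinAt e13 (gradField L1 L3 v13 (e13 t)) (Ici 0) t
  start12 : Tendsto e12 atBot (𝓝 v12)
  start23 : Tendsto e23 atBot (𝓝 v23)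
  end13 : Tendsto e13 atTop (𝓝 v13)
  vertex12 : e12 0 = e13 0
  vertex23 : e23 0 = e13 0
  ext12 : ∀ t, 0 ≤ t → e12 t = e12 0
  ext23 : ∀ t, 0 ≤ t → e23 t = e23 0
  ext13 : ∀ t ≤ 0, e13 t = e13 0

/-- The inverse `(g^{ij})` of the Hessian metric, as a quadratic form on covectors. With
`r = s/(1+s)`, `σ = s/(1+s+t)` and `τ = t/(1+s+t)` it is
`4 (r(1-r) + σ(1-σ)) ξ₁² - 8 σ τ ξ₁ ξ₂ + 4 τ (1-τ) ξ₂²`; it is smooth up to the boundary of `P`. -/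
def cometric (x ξ : ℝ × ℝ) : ℝ :=
  let r := x.1 / (4 - x.2)
  let σ := x.1 * (2 - x.2) / (2 * (4 - x.2))
  let τ := x.2 / 2
  4 * (r * (1 - r) + σ * (1 - σ)) * ξ.1 ^ 2 - 8 * (σ * τ) * (ξ.1 * ξ.2)
    + 4 * (τ * (1 - τ)) * ξ.2 ^ 2

/-- `g(w, w)` for the Hessian metric `g`, written as the Legendre dual of the cometric, which makes
sense up to the boundary of `P`, where the cometric degenerates. -/
def metricSq (x w : ℝ × ℝ) : ℝ≥0∞ :=
  ⨆ ξ : ℝ × ℝ, ENNReal.ofReal (2 * (ξ.1 * w.1 + ξ.2 * w.2) - cometric x ξ)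

namespace GTree

variable {L1 L2 L3 : ℤ × ℤ} {V12 : Gen L1 L2} {V23 : Gen L2 L3} {V13 : Gen L1 L3}

/-- The symplectic area of the disk in `M` obtained by lifting the tree. Over an edge `γ` labelled
by `(L, L')` the disk is the strip `y = y_L(γ(t)) + θ (y_{L'} - y_L)(γ(t))`, `0 ≤ θ ≤ 1`, of lifts,
and `ω = ∑ g_{ij} dxⁱ ∧ dyʲ` restricts to it as
`g(γ', y_{L'} - y_L) dt ∧ dθ = g(γ', γ') dt ∧ dθ`. -/
def area (T : GTree V12 V23 V13) : ℝ≥0∞ :=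
  (∫⁻ t in Iic (0 : ℝ), metricSq (T.e12 t) (gradField L1 L2 T.v12 (T.e12 t)))
    + (∫⁻ t in Iic (0 : ℝ), metricSq (T.e23 t) (gradField L2 L3 T.v23 (T.e23 t)))
    + ∫⁻ t in Ici (0 : ℝ), metricSq (T.e13 t) (gradField L1 L3 T.v13 (T.e13 t))

/-- Smooth homotopy through gradient trees. -/
def Homotopic (T T' : GTree V12 V23 V13) : Prop :=
  ∃ H : ℝ → GTree V12 V23 V13, H 0 = T ∧ H 1 = T' ∧
    ContDiffOn ℝ ∞ (fun q => (H q).v12) (Icc 0 1) ∧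
    ContDiffOn ℝ ∞ (fun q => (H q).v23) (Icc 0 1) ∧
    ContDiffOn ℝ ∞ (fun q => (H q).v13) (Icc 0 1) ∧
    ContDiffOn ℝ ∞ (fun q : ℝ × ℝ => (H q.1).e12 q.2) (Icc 0 1 ×ˢ Iic 0) ∧
    ContDiffOn ℝ ∞ (fun q : ℝ × ℝ => (H q.1).e23 q.2) (Icc 0 1 ×ˢ Iic 0) ∧
    ContDiffOn ℝ ∞ (fun q : ℝ × ℝ => (H q.1).e13 q.2) (Icc 0 1 ×ˢ Ici 0)

end GTree

/-- Gradient trees up to (the equivalence relation generated by) smooth homotopy. -/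
def HGT {L1 L2 L3 : ℤ × ℤ} (V12 : Gen L1 L2) (V23 : Gen L2 L3) (V13 : Gen L1 L3) : Type :=
  Quot (GTree.Homotopic (V12 := V12) (V23 := V23) (V13 := V13))

/-- The coefficient of `V13` in `m₂(V12, V23)`: the sum of `e^{-A(γ)}` over `[γ] ∈ HGT`, for
`|V13| = |V12| + |V23|`. -/
def treeCoeff {L1 L2 L3 : ℤ × ℤ} (V12 : Gen L1 L2) (V23 : Gen L2 L3) (V13 : Gen L1 L3) : ℝ :=
  open Classical in
  if ∃ n k : ℕ, V12.HasDeg n ∧ V23.HasDeg k ∧ V13.HasDeg (n + k) then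
    ∑ᶠ T : HGT V12 V23 V13, Real.exp (-(Quot.out T).area.toReal)
  else 0

abbrev MoHom (L L' : ℤ × ℤ) : Type := Gen L L' →₀ ℂ

/-- `m₂` on two generators. -/
def moMulGen {L1 L2 L3 : ℤ × ℤ} (V12 : Gen L1 L2) (V23 : Gen L2 L3) : MoHom L1 L3 :=
  ∑ᶠ V13 : Gen L1 L3, Finsupp.single V13 (treeCoeff V12 V23 V13 : ℂ)

def moMul (L1 L2 L3 : ℤ × ℤ) (f : MoHom L1 L2) (g : MoHom L2 L3) : MoHom L1 L3 :=
  f.sum fun V z => g.sum fun W z' => (z * z') • moMulGen V W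

def moGr (L L' : ℤ × ℤ) (d : ℤ) : Submodule ℂ (MoHom L L') :=
  Finsupp.supported ℂ ℂ {V | ∃ n : ℕ, (n : ℤ) = d ∧ V.HasDeg n}

/-- The finite sums and the quantities used in the definition of `m₂` for the given objects make
sense: there are finitely many generators and finitely many homotopy classes of trees, all trees
have finite area, and the area only depends on the homotopy class. -/
def MoWellDefined {Ob : Type} (E : Ob → ℤ × ℤ) : Prop :=
  (∀ i j, Finite (Gen (E i) (E j))) ∧
  ∀ (i j k : Ob) (V12 : Gen (E i) (E j)) (V23 : Gen (E j) (E k)) (V13 : Gen (E i) (E k)),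
    Finite (HGT V12 V23 V13) ∧ (∀ T : GTree V12 V23 V13, T.area ≠ ⊤) ∧
      ∀ T T' : GTree V12 V23 V13, T.Homotopic T' → T.area = T'.area

theorem inter_self (L : ℤ × ℤ) : inter L L = P := by
  ext x
  simp only [inter, mem_ofPred_eq, and_iff_left_iff_imp]
  intro _
  exact ⟨0, by ext <;> simp [disp]⟩

theorem convex_P : Convex ℝ P := by
  intro x hx y hy a b ha hb hab
  obtain ⟨h1, h2, h3, h4⟩ := hx
  obtain ⟨k1, k2, k3, k4⟩ := hy
  simp only [P, mem_ofPred_eq, Prod.fst_add, Prod.snd_add, Prod.smul_fst, Prod.smul_snd,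
    smul_eq_mul]
  refine ⟨by positivity, ?_, by positivity, ?_⟩ <;> nlinarith

theorem stable_self (L : ℤ × ℤ) (v : ℝ × ℝ) : stable L L v ⊆ {v} := by
  rintro x ⟨γ, h0, hγ, hv⟩
  have hc : ∀ t ∈ Ici (0 : ℝ), γ t = γ 0 := by
    intro t ht
    refine (convex_Ici (0 : ℝ)).is_const_of_fderivWithin_eq_zero (𝕜 := ℝ) (f := γ) ?_ ?_ ht
      self_mem_Ici
    · intro s hs
      exact (hγ s hs).2.differentiableWithinAt
    · intro s hs
      have h := (hγ s hs).2
      have hz : gradField L L v (γ s) = 0 := by simp [gradField, disp]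
      rw [hz] at h
      have h2 := h.hasFDerivWithinAt.fderivWithin (uniqueDiffOn_Ici (0 : ℝ) s hs)
      rw [h2]
      ext <;> simp
  have h1 : Tendsto γ atTop (𝓝 x) := by
    refine tendsto_const_nhds.congr' ?_
    filter_upwards [eventually_ge_atTop 0] with t ht
    rw [hc t ht, h0]
  exact tendsto_nhds_unique h1 hv

theorem isGen_P (L : ℤ × ℤ) : IsGen L L P := by
  have h0 : (0 : ℝ × ℝ) ∈ P := by simp [P]
  refine ⟨⟨0, by rwa [inter_self], ?_⟩, 0, h0, ?_⟩
  · rw [inter_self]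
    exact (convex_P.isPreconnected.connectedComponentIn h0).symm
  · refine eventually_nhdsWithin_of_forall fun z hz => ?_
    rw [stable_self L 0 hz]
    exact h0

/-- The full subcategory of the Morse homotopy category `Mo(P)` on the given sections. It is minimal
(`m₁ = 0`), `m₂` counts gradient trees, and the units are the generators `P ∈ Mo(P)(L, L)`. The
higher operations are set to zero, which is forced by the degrees `2 - k` of the `m_k` as soon as
all generators have degree zero; see `AInfData.DeterminedByM2`. -/
def moCat {Ob : Type} (E : Ob → ℤ × ℤ) : AInfData Ob where
  Hom i j := MoHom (E i) (E j)
  gr i j := moGr (E i) (E j)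
  m := Word.ops (fun _ _ _ => 0) fun i j k => moMul (E i) (E j) (E k)
  one i := Finsupp.single ⟨P, isGen_P (E i)⟩ 1

/-! ## The DG category of line bundles restricted to the open torus

The torus `M̌ ⊂ 𝔽₁` has the complex coordinates `z_k = x_k + i y_k` (`y_k` modulo `2π`), with
`(u, v) = (e^{z₁}, e^{z₂})` the coordinates of the chart `U₂`. Functions on `M̌` are functions of
`z ∈ ℂ²` with period `2πi` in both variables, and `dz̄₁, dz̄₂` is a frame of the `(0,1)`-forms. -/

/-- The moment map `μ : M̌ → B`, which expresses `(x¹, x²)` through `s = |u|²` and `t = |v|²`. -/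
def moment (z : ℂ × ℂ) : ℝ × ℝ :=
  let s := Real.exp (2 * z.1.re)
  let t := Real.exp (2 * z.2.re)
  (2 * s / (1 + s) + 2 * s / (1 + s + t), 2 * t / (1 + s + t))

/-- The potential `f = (a/2) log (1 + s) + (b/2) log (1 + s + t)` of `L(a,b)`. -/
def potential (D : ℤ × ℤ) (z : ℂ × ℂ) : ℝ :=
  D.1 / 2 * Real.log (1 + Real.exp (2 * z.1.re))
    + D.2 / 2 * Real.log (1 + Real.exp (2 * z.1.re) + Real.exp (2 * z.2.re))

/-- The coordinates of the charts `U₁, U₂, U₃, U₄` of `𝔽₁` are the monomials in `(u, v)` with these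
exponents (rows): `(1/u, v/u)`, `(u, v)`, `(1/u, u/v)`, `(u, 1/v)`. -/
def chartMat : Fin 4 → Matrix (Fin 2) (Fin 2) ℤ :=
  ![!![-1, 0; -1, 1], !![1, 0; 0, 1], !![-1, 0; 1, -1], !![1, 0; 0, -1]]

/-- The coordinates in the `j`-th chart of the point `z` of the torus. -/
def chart (j : Fin 4) (z : ℂ × ℂ) : ℂ × ℂ :=
  (Complex.exp (chartMat j 0 0 * z.1 + chartMat j 0 1 * z.2),
    Complex.exp (chartMat j 1 0 * z.1 + chartMat j 1 1 * z.2))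

/-- Logarithms of the transition functions `φ_{2j}` of `𝒪(a,b) = 𝒪(a D₂₄ + b D₁₂)`, namely
`u^{-a-b}`, `1`, `u^{-a} v^{-b}`, `v^{-b}`. -/
def transLog (D : ℤ × ℤ) (z : ℂ × ℂ) : Fin 4 → ℂ :=
  ![-(D.1 + D.2) * z.1, 0, -D.1 * z.1 - D.2 * z.2, -D.2 * z.2]

/-- `φ_{2j} Ψ` with `Ψ = (1 + s)^{a/2} (1 + s + t)^{b/2} = e^f`: the factor that turns a section
written in the frame in which the connection is `d - (i/2π) ∑ yᵏ dy_k` into the same section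
written in the holomorphic frame of `𝒪(a,b)` over the chart `U_j`. -/
def frame (D : ℤ × ℤ) (j : Fin 4) (z : ℂ × ℂ) : ℂ :=
  Complex.exp (potential D z + transLog D z j)

/-- Forms `F₀ + F₁ dz̄₁ + F₂ dz̄₂ + F₁₂ dz̄₁ ∧ dz̄₂`, as `(F₀, F₁, F₂, F₁₂)`. -/
abbrev Form : Type := (ℂ × ℂ → ℂ) × (ℂ × ℂ → ℂ) × (ℂ × ℂ → ℂ) × (ℂ × ℂ → ℂ)

/-- In the chart `U_j` with coordinates `(w₁, w₂)`, and in the holomorphic frame there, the form `F`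
with values in `𝒪(a,b)` is `G + p dw̄₁ + q dw̄₂ + h dw̄₁ ∧ dw̄₂` with `G, p, q, h` smooth on all of
`U_j = ℂ²`. (Recall `dw̄_k = w̄_k ∑ₗ A_{kl} dz̄ₗ` for the exponent matrix `A` of the chart.) -/
def ExtendsTo (D : ℤ × ℤ) (j : Fin 4) (F : Form) : Prop :=
  ∃ G p q h : ℂ × ℂ → ℂ, ContDiff ℝ ∞ G ∧ ContDiff ℝ ∞ p ∧ ContDiff ℝ ∞ q ∧ ContDiff ℝ ∞ h ∧
    ∀ z : ℂ × ℂ,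
      frame D j z * F.1 z = G (chart j z) ∧
      frame D j z * F.2.1 z =
        chartMat j 0 0 * (star (chart j z).1 * p (chart j z))
          + chartMat j 1 0 * (star (chart j z).2 * q (chart j z)) ∧
      frame D j z * F.2.2.1 z =
        chartMat j 0 1 * (star (chart j z).1 * p (chart j z))
          + chartMat j 1 1 * (star (chart j z).2 * q (chart j z)) ∧
      frame D j z * F.2.2.2 z =
        (chartMat j 0 0 * chartMat j 1 1 - chartMat j 0 1 * chartMat j 1 0)
          * (star (chart j z).1 * star (chart j z).2 * h (chart j z))

/-- `2 ∂/∂z̄` in the direction `e`. -/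
def dbar (e : ℂ × ℂ) (F : ℂ × ℂ → ℂ) (z : ℂ × ℂ) : ℂ :=
  fderiv ℝ F z e + Complex.I * fderiv ℝ F z (Complex.I • e)

/-- Restrictions to the torus of the smooth `(0,*)`-forms on `𝔽₁` with values in `𝒪(a,b)`. -/
def formsOn (D : ℤ × ℤ) : Submodule ℂ Form where
  carrier := {F | ∀ j, ExtendsTo D j F}
  zero_mem' := fun j => ⟨0, 0, 0, 0, contDiff_const, contDiff_const, contDiff_const,
    contDiff_const, by simp⟩
  add_mem' := by
    intro F F' hF hF' j
    obtain ⟨G, p, q, h, hG, hp, hq, hh, H⟩ := hF j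
    obtain ⟨G', p', q', h', hG', hp', hq', hh', H'⟩ := hF' j
    refine ⟨G + G', p + p', q + q', h + h', hG.add hG', hp.add hp', hq.add hq', hh.add hh',
      fun z => ?_⟩
    obtain ⟨a1, a2, a3, a4⟩ := H z
    obtain ⟨b1, b2, b3, b4⟩ := H' z
    simp only [Prod.fst_add, Prod.snd_add, Pi.add_apply]
    refine ⟨?_, ?_, ?_, ?_⟩
    · linear_combination a1 + b1
    · linear_combination a2 + b2
    · linear_combination a3 + b3
    · linear_combination a4 + b4
  smul_mem' := by
    intro k F hF j
    obtain ⟨G, p, q, h, hG, hp, hq, hh, H⟩ := hF j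
    refine ⟨k • G, k • p, k • q, k • h, contDiff_const.smul hG, contDiff_const.smul hp,
      contDiff_const.smul hq, contDiff_const.smul hh, fun z => ?_⟩
    obtain ⟨a1, a2, a3, a4⟩ := H z
    simp only [Prod.smul_fst, Prod.smul_snd, Pi.smul_apply, smul_eq_mul]
    refine ⟨?_, ?_, ?_, ?_⟩
    · linear_combination k * a1
    · linear_combination k * a2
    · linear_combination k * a3
    · linear_combination k * a4

/-- The differential `d_{LL'} = 2 D^{0,1}` on forms with values in the bundle of homomorphisms from
the bundle of `L` to that of `L'`. As `dy_k` has `(0,1)`-part `(i/2) dz̄_k`, the connection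
`d - i ∑ (y_{L'} - y_L)ᵏ dy_k` has `2 D^{0,1} = 2 ∂̄ + ∑ (y_{L'} - y_L)ᵏ dz̄_k`. -/
def formD (L L' : ℤ × ℤ) (F : Form) : Form :=
  (0,
    fun z => dbar (1, 0) F.1 z + (disp L L' (moment z)).1 * F.1 z,
    fun z => dbar (0, 1) F.1 z + (disp L L' (moment z)).2 * F.1 z,
    fun z => dbar (1, 0) F.2.2.1 z + (disp L L' (moment z)).1 * F.2.2.1 z
      - (dbar (0, 1) F.2.1 z + (disp L L' (moment z)).2 * F.2.1 z))

/-- The composition `m(ψ, φ) = (-1)^{|ψ||φ|} φ ∧ ψ = ψ ∧ φ`. -/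
def formMul (F K : Form) : Form :=
  (F.1 * K.1, F.1 * K.2.1 + F.2.1 * K.1, F.1 * K.2.2.1 + F.2.2.1 * K.1,
    F.1 * K.2.2.2 + F.2.2.2 * K.1 + F.2.1 * K.2.2.1 - F.2.2.1 * K.2.1)

theorem frame_add (D D' : ℤ × ℤ) (j : Fin 4) (z : ℂ × ℂ) :
    frame (D + D') j z = frame D j z * frame D' j z := by
  unfold frame
  rw [← Complex.exp_add]
  congr 1
  have h : transLog (D + D') z j = transLog D z j + transLog D' z j := by
    fin_cases j <;> simp [transLog] <;> ring
  rw [h]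
  simp only [potential, Prod.fst_add, Prod.snd_add]
  push_cast
  ring

theorem formMul_mem {D D' : ℤ × ℤ} {F K : Form} (hF : F ∈ formsOn D) (hK : K ∈ formsOn D') :
    formMul F K ∈ formsOn (D + D') := by
  intro j
  obtain ⟨G, p, q, h, hG, hp, hq, hh, H⟩ := hF j
  obtain ⟨G', p', q', h', hG', hp', hq', hh', H'⟩ := hK j
  refine ⟨G * G', G * p' + p * G', G * q' + q * G', G * h' + h * G' + p * q' - q * p',
    hG.mul hG', (hG.mul hp').add (hp.mul hG'), (hG.mul hq').add (hq.mul hG'),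
    (((hG.mul hh').add (hh.mul hG')).add (hp.mul hq')).sub (hq.mul hp'), fun z => ?_⟩
  obtain ⟨a1, a2, a3, a4⟩ := H z
  obtain ⟨b1, b2, b3, b4⟩ := H' z
  simp only [formMul, Pi.mul_apply, Pi.add_apply, Pi.sub_apply, frame_add]
  refine ⟨?_, ?_, ?_, ?_⟩
  · rw [← a1, ← b1]; ring
  · calc _ = (frame D j z * F.1 z) * (frame D' j z * K.2.1 z)
          + (frame D j z * F.2.1 z) * (frame D' j z * K.1 z) := by ring
      _ = _ := by rw [a1, a2, b1, b2]; ring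
  · calc _ = (frame D j z * F.1 z) * (frame D' j z * K.2.2.1 z)
          + (frame D j z * F.2.2.1 z) * (frame D' j z * K.1 z) := by ring
      _ = _ := by rw [a1, a3, b1, b3]; ring
  · calc _ = (frame D j z * F.1 z) * (frame D' j z * K.2.2.2 z)
          + (frame D j z * F.2.2.2 z) * (frame D' j z * K.1 z)
          + (frame D j z * F.2.1 z) * (frame D' j z * K.2.2.1 z)
          - (frame D j z * F.2.2.1 z) * (frame D' j z * K.2.1 z) := by ring
      _ = _ := by rw [a1, a2, a3, a4, b1, b2, b3, b4]; ring

theorem formOne_mem : ((1, 0, 0, 0) : Form) ∈ formsOn 0 := by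
  intro j
  refine ⟨1, 0, 0, 0, contDiff_const, contDiff_const, contDiff_const, contDiff_const,
    fun z => ?_⟩
  have h : transLog 0 z j = 0 := by fin_cases j <;> simp [transLog]
  simp [frame, potential, h]

theorem disp_eq (L L' : ℤ × ℤ) (x : ℝ × ℝ) : disp L L' x = lagr (L' - L) x := by
  ext
  · simp only [disp, lagr, Prod.fst_sub, Prod.snd_sub]
    push_cast
    ring
  · simp only [disp, lagr, Prod.fst_sub, Prod.snd_sub]
    push_cast
    ring

theorem moment_snd_lt (z : ℂ × ℂ) : (moment z).2 < 2 := by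
  have h1 := Real.exp_pos (2 * z.1.re)
  have h2 := Real.exp_pos (2 * z.2.re)
  simp only [moment]
  rw [div_lt_iff₀ (by positivity)]
  linarith

/-- The section `L(a,b)` in terms of `s` and `t`. -/
theorem lagr_moment (D : ℤ × ℤ) (z : ℂ × ℂ) : lagr D (moment z) =
    (D.1 * (Real.exp (2 * z.1.re) / (1 + Real.exp (2 * z.1.re)))
      + D.2 * (Real.exp (2 * z.1.re)
        / (1 + Real.exp (2 * z.1.re) + Real.exp (2 * z.2.re))),
      D.2 * (Real.exp (2 * z.2.re)
        / (1 + Real.exp (2 * z.1.re) + Real.exp (2 * z.2.re)))) := by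
  have h1 := Real.exp_pos (2 * z.1.re)
  have h2 := Real.exp_pos (2 * z.2.re)
  have h3 := moment_snd_lt z
  simp only [moment, lagr] at h3 ⊢
  generalize Real.exp (2 * z.1.re) = s at *
  generalize Real.exp (2 * z.2.re) = t at *
  have h4 : (4 : ℝ) - 2 * t / (1 + s + t) = (4 + 4 * s + 2 * t) / (1 + s + t) := by
    field_simp; ring
  have h5 : (2 : ℝ) - 2 * t / (1 + s + t) = (2 + 2 * s) / (1 + s + t) := by
    field_simp; ring
  ext
  · simp only [h4, h5]
    field_simp
    ring
  · simp only
    field_simp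

/-- `L(a,b)` is the graph of the differential of the potential. -/
theorem hasFDerivAt_potential (D : ℤ × ℤ) (z : ℂ × ℂ) :
    ∃ f' : ℂ × ℂ →L[ℝ] ℝ, HasFDerivAt (potential D) f' z ∧
      ∀ e, f' e = (lagr D (moment z)).1 * e.1.re + (lagr D (moment z)).2 * e.2.re := by
  have e1 : HasFDerivAt (fun z : ℂ × ℂ => 2 * z.1.re)
      ((2 : ℝ) • (Complex.reCLM.comp (ContinuousLinearMap.fst ℝ ℂ ℂ))) z :=
    (Complex.reCLM.comp (ContinuousLinearMap.fst ℝ ℂ ℂ)).hasFDerivAt.const_mul 2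
  have e2 : HasFDerivAt (fun z : ℂ × ℂ => 2 * z.2.re)
      ((2 : ℝ) • (Complex.reCLM.comp (ContinuousLinearMap.snd ℝ ℂ ℂ))) z :=
    (Complex.reCLM.comp (ContinuousLinearMap.snd ℝ ℂ ℂ)).hasFDerivAt.const_mul 2
  have h1 := Real.exp_pos (2 * z.1.re)
  have h2 := Real.exp_pos (2 * z.2.re)
  have s1 := (e1.exp.const_add 1).log (by positivity)
  have s2 := ((e1.exp.const_add 1).add e2.exp).log
    (show 1 + Real.exp (2 * z.1.re) + Real.exp (2 * z.2.re) ≠ 0 by positivity)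
  refine ⟨_, (s1.const_mul ((D.1 : ℝ) / 2)).add (s2.const_mul ((D.2 : ℝ) / 2)), fun e => ?_⟩
  rw [lagr_moment]
  simp
  ring

theorem contDiff_potential (D : ℤ × ℤ) : ContDiff ℝ ∞ (potential D) := by
  have e1 : ContDiff ℝ ∞ (fun z : ℂ × ℂ => Real.exp (2 * z.1.re)) :=
    (contDiff_const.mul (Complex.reCLM.contDiff.comp contDiff_fst)).exp
  have e2 : ContDiff ℝ ∞ (fun z : ℂ × ℂ => Real.exp (2 * z.2.re)) :=
    (contDiff_const.mul (Complex.reCLM.contDiff.comp contDiff_snd)).exp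
  unfold potential
  refine (contDiff_const.mul ((contDiff_const.add e1).log fun z => ?_)).add
    (contDiff_const.mul (((contDiff_const.add e1).add e2).log fun z => ?_))
  · positivity
  · positivity

theorem contDiff_transLog (D : ℤ × ℤ) (j : Fin 4) : ContDiff ℂ ∞ (fun z => transLog D z j) := by
  fin_cases j <;> simp [transLog] <;> fun_prop

theorem contDiff_frame (D : ℤ × ℤ) (j : Fin 4) : ContDiff ℝ ∞ (frame D j) := by
  unfold frame
  exact ((Complex.ofRealCLM.contDiff.comp (contDiff_potential D)).add
    ((contDiff_transLog D j).restrict_scalars ℝ)).cexp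

theorem frame_ne (D : ℤ × ℤ) (j : Fin 4) (z : ℂ × ℂ) : frame D j z ≠ 0 := Complex.exp_ne_zero _

theorem contDiff_chart (j : Fin 4) : ContDiff ℝ ∞ (chart j) := by
  have h : ContDiff ℂ ∞ (chart j) := by unfold chart; fun_prop
  exact h.restrict_scalars ℝ

/-- `2 ∂̄ (φ Ψ) = φ Ψ ∑ yᵏ dz̄_k`. -/
theorem dbar_frame (D : ℤ × ℤ) (j : Fin 4) (z e : ℂ × ℂ) (he : e.1.im = 0) (he' : e.2.im = 0) :
    dbar e (frame D j) z =
      ((lagr D (moment z)).1 * e.1.re + (lagr D (moment z)).2 * e.2.re) * frame D j z := by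
  obtain ⟨f', hf, hf'⟩ := hasFDerivAt_potential D z
  have ht := (((contDiff_transLog D j).differentiable (by simp)) z).hasFDerivAt
  have ht' := ht.restrictScalars ℝ
  have h1 : HasFDerivAt (fun z => (potential D z : ℂ)) (Complex.ofRealCLM.comp f') z :=
    Complex.ofRealCLM.hasFDerivAt.comp z hf
  have h2 := (h1.add ht').cexp
  have h3 : HasFDerivAt (frame D j) _ z := h2
  unfold dbar
  rw [h3.fderiv]
  simp [hf', he, he', frame]
  ring_nf
  simp [Complex.I_sq]

theorem dbar_mul {F K : ℂ × ℂ → ℂ} {z : ℂ × ℂ} (hF : DifferentiableAt ℝ F z)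
    (hK : DifferentiableAt ℝ K z) (e : ℂ × ℂ) :
    dbar e (fun z => F z * K z) z = F z * dbar e K z + dbar e F z * K z := by
  unfold dbar
  rw [fderiv_fun_mul hF hK]
  simp
  ring

theorem dbar_add {F K : ℂ × ℂ → ℂ} {z : ℂ × ℂ} (hF : DifferentiableAt ℝ F z)
    (hK : DifferentiableAt ℝ K z) (e : ℂ × ℂ) :
    dbar e (fun z => F z + K z) z = dbar e F z + dbar e K z := by
  unfold dbar
  rw [fderiv_fun_add hF hK]
  simp
  ring

theorem dbar_const_mul {F : ℂ × ℂ → ℂ} {z : ℂ × ℂ} (hF : DifferentiableAt ℝ F z)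
    (k : ℂ) (e : ℂ × ℂ) : dbar e (fun z => k * F z) z = k * dbar e F z := by
  unfold dbar
  rw [fderiv_const_mul hF]
  simp
  ring

theorem dbar_star_fst (e z : ℂ × ℂ) : dbar e (fun w => star w.1) z = 2 * star e.1 := by
  have h : HasFDerivAt (fun w : ℂ × ℂ => star w.1)
      ((Complex.conjCLE : ℂ →L[ℝ] ℂ).comp (ContinuousLinearMap.fst ℝ ℂ ℂ)) z :=
    ((Complex.conjCLE : ℂ →L[ℝ] ℂ).comp (ContinuousLinearMap.fst ℝ ℂ ℂ)).hasFDerivAt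
  unfold dbar
  rw [h.fderiv]
  simp
  ring_nf
  simp [Complex.I_sq]
  ring

theorem dbar_star_snd (e z : ℂ × ℂ) : dbar e (fun w => star w.2) z = 2 * star e.2 := by
  have h : HasFDerivAt (fun w : ℂ × ℂ => star w.2)
      ((Complex.conjCLE : ℂ →L[ℝ] ℂ).comp (ContinuousLinearMap.snd ℝ ℂ ℂ)) z :=
    ((Complex.conjCLE : ℂ →L[ℝ] ℂ).comp (ContinuousLinearMap.snd ℝ ℂ ℂ)).hasFDerivAt
  unfold dbar
  rw [h.fderiv]
  simp
  ring_nf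
  simp [Complex.I_sq]
  ring

theorem dbar_eq (F : ℂ × ℂ → ℂ) (z e : ℂ × ℂ) :
    dbar e F z = star e.1 * dbar (1, 0) F z + star e.2 * dbar (0, 1) F z := by
  have he : e = e.1.re • ((1, 0) : ℂ × ℂ) + e.1.im • (Complex.I • ((1, 0) : ℂ × ℂ))
      + e.2.re • ((0, 1) : ℂ × ℂ) + e.2.im • (Complex.I • ((0, 1) : ℂ × ℂ)) := by
    ext <;> simp
  have hi : Complex.I • e = e.1.re • (Complex.I • ((1, 0) : ℂ × ℂ)) - e.1.im • ((1, 0) : ℂ × ℂ)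
      + e.2.re • (Complex.I • ((0, 1) : ℂ × ℂ)) - e.2.im • ((0, 1) : ℂ × ℂ) := by
    ext <;> simp <;> apply Complex.ext <;> simp
  have s1 : star e.1 = e.1.re - e.1.im * Complex.I := by
    apply Complex.ext <;> simp
  have s2 : star e.2 = e.2.re - e.2.im * Complex.I := by
    apply Complex.ext <;> simp
  rw [s1, s2]
  unfold dbar
  rw [hi]
  nth_rewrite 1 [he]
  simp only [map_add, map_sub, map_smul, Complex.real_smul]
  ring_nf
  simp only [Complex.I_sq]
  ring

/-- The chain rule for the holomorphic maps to the charts. -/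
theorem dbar_comp_chart {K : ℂ × ℂ → ℂ} (hK : Differentiable ℝ K) (j : Fin 4) (z e : ℂ × ℂ) :
    dbar e (fun z => K (chart j z)) z =
      star ((chartMat j 0 0 * e.1 + chartMat j 0 1 * e.2) * (chart j z).1)
          * dbar (1, 0) K (chart j z)
        + star ((chartMat j 1 0 * e.1 + chartMat j 1 1 * e.2) * (chart j z).2)
          * dbar (0, 1) K (chart j z) := by
  have l (k : Fin 2) : HasFDerivAt
      (fun z : ℂ × ℂ => (chartMat j k 0 : ℂ) * z.1 + (chartMat j k 1 : ℂ) * z.2)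
      ((chartMat j k 0 : ℂ) • ContinuousLinearMap.fst ℂ ℂ ℂ
        + (chartMat j k 1 : ℂ) • ContinuousLinearMap.snd ℂ ℂ ℂ) z :=
    (hasFDerivAt_fst.const_mul _).add (hasFDerivAt_snd.const_mul _)
  have hc : HasFDerivAt (chart j) _ z := ((l 0).cexp.prodMk (l 1).cexp)
  have h := (hK (chart j z)).hasFDerivAt.comp z (hc.restrictScalars ℝ)
  have h' : HasFDerivAt (fun z => K (chart j z)) _ z := h
  have key : dbar e (fun z => K (chart j z)) z =
      dbar ((chartMat j 0 0 * e.1 + chartMat j 0 1 * e.2) * (chart j z).1,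
        (chartMat j 1 0 * e.1 + chartMat j 1 1 * e.2) * (chart j z).2) K (chart j z) := by
    unfold dbar
    rw [h'.fderiv]
    simp only [ContinuousLinearMap.comp_apply]
    congr 2
    · ext <;> simp [chart] <;> ring
    · congr 1
      ext <;> simp [chart] <;> ring
  rw [key, dbar_eq]

theorem contDiff_dbar {K : ℂ × ℂ → ℂ} (hK : ContDiff ℝ ∞ K) (e : ℂ × ℂ) :
    ContDiff ℝ ∞ (dbar e K) := by
  have h : ContDiff ℝ ∞ (fderiv ℝ K) := hK.fderiv_right (by simp)
  exact (h.clm_apply contDiff_const).add (contDiff_const.mul (h.clm_apply contDiff_const))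

theorem differentiable_of_frame {D : ℤ × ℤ} {j : Fin 4} {F K : ℂ × ℂ → ℂ} (hK : ContDiff ℝ ∞ K)
    (h : ∀ z, frame D j z * F z = K (chart j z)) : Differentiable ℝ F := by
  have e : F = fun z => (frame D j z)⁻¹ * K (chart j z) := by
    funext z
    rw [← h z, inv_mul_cancel_left₀ (frame_ne D j z)]
  rw [e]
  exact (((contDiff_frame D j).inv (frame_ne D j)).mul
    (hK.comp (contDiff_chart j))).differentiable (by simp)

theorem frame_mul_dbar {D : ℤ × ℤ} {j : Fin 4} {F K : ℂ × ℂ → ℂ} (hK : ContDiff ℝ ∞ K)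
    (h : ∀ z, frame D j z * F z = K (chart j z)) (z e : ℂ × ℂ) (he : e.1.im = 0)
    (he' : e.2.im = 0) :
    frame D j z * (dbar e F z
        + ((lagr D (moment z)).1 * e.1.re + (lagr D (moment z)).2 * e.2.re) * F z) =
      star ((chartMat j 0 0 * e.1 + chartMat j 0 1 * e.2) * (chart j z).1)
          * dbar (1, 0) K (chart j z)
        + star ((chartMat j 1 0 * e.1 + chartMat j 1 1 * e.2) * (chart j z).2)
          * dbar (0, 1) K (chart j z) := by
  have hF := differentiable_of_frame hK h
  rw [← dbar_comp_chart (hK.differentiable (by simp)) j z e]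
  have : (fun z => K (chart j z)) = fun z => frame D j z * F z := by
    funext z; rw [h z]
  rw [this, dbar_mul ((contDiff_frame D j).differentiable (by simp) z) (hF z) e,
    dbar_frame D j z e he he']
  ring

theorem formD_mem {L L' : ℤ × ℤ} {F : Form} (hF : F ∈ formsOn (L' - L)) :
    formD L L' F ∈ formsOn (L' - L) := by
  intro j
  obtain ⟨G, p, q, h, hG, hp, hq, hh, H⟩ := hF j
  have hs1 : ContDiff ℝ ∞ (fun w : ℂ × ℂ => star w.1) :=
    Complex.conjCLE.contDiff.comp contDiff_fst
  have hs2 : ContDiff ℝ ∞ (fun w : ℂ × ℂ => star w.2) :=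
    Complex.conjCLE.contDiff.comp contDiff_snd
  let K (l : Fin 2) : ℂ × ℂ → ℂ := fun w =>
    chartMat j 0 l * (star w.1 * p w) + chartMat j 1 l * (star w.2 * q w)
  have hK (l : Fin 2) : ContDiff ℝ ∞ (K l) :=
    (contDiff_const.mul (hs1.mul hp)).add (contDiff_const.mul (hs2.mul hq))
  have dK (l : Fin 2) (e w : ℂ × ℂ) : dbar e (K l) w =
      chartMat j 0 l * (star w.1 * dbar e p w + 2 * star e.1 * p w)
        + chartMat j 1 l * (star w.2 * dbar e q w + 2 * star e.2 * q w) := by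
    have d1 := hs1.differentiable (by simp) w
    have d2 := hs2.differentiable (by simp) w
    have d3 := hp.differentiable (by simp) w
    have d4 := hq.differentiable (by simp) w
    have d5 : DifferentiableAt ℝ (fun w : ℂ × ℂ => star w.1 * p w) w := d1.mul d3
    have d6 : DifferentiableAt ℝ (fun w : ℂ × ℂ => star w.2 * q w) w := d2.mul d4
    rw [show K l = fun w => (chartMat j 0 l : ℂ) * (star w.1 * p w)
        + (chartMat j 1 l : ℂ) * (star w.2 * q w) from rfl,
      dbar_add (d5.const_mul _) (d6.const_mul _),
      dbar_const_mul d5, dbar_const_mul d6, dbar_mul d1 d3, dbar_mul d2 d4,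
      dbar_star_fst, dbar_star_snd]
  refine ⟨0, dbar (1, 0) G, dbar (0, 1) G, fun w => dbar (1, 0) q w - dbar (0, 1) p w,
    contDiff_const, contDiff_dbar hG _, contDiff_dbar hG _,
    (contDiff_dbar hq _).sub (contDiff_dbar hp _), fun z => ?_⟩
  have g1 := frame_mul_dbar hG (fun z => (H z).1) z (1, 0) (by simp) (by simp)
  have g2 := frame_mul_dbar hG (fun z => (H z).1) z (0, 1) (by simp) (by simp)
  have k1 := frame_mul_dbar (hK 1) (fun z => (H z).2.2.1) z (1, 0) (by simp) (by simp)
  have k2 := frame_mul_dbar (hK 0) (fun z => (H z).2.1) z (0, 1) (by simp) (by simp)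
  simp only [dK] at k1 k2
  simp only [formD, disp_eq]
  simp only [star_mul', star_one, star_zero, mul_one, mul_zero, add_zero, zero_add,
    Complex.one_re, Complex.zero_re, Complex.ofReal_one, Complex.ofReal_zero, star_intCast]
    at g1 g2 k1 k2
  refine ⟨by simp, ?_, ?_, ?_⟩
  · linear_combination g1
  · linear_combination g2
  · linear_combination k1 - k2

/-- Morphisms in `𝒱'` from the line bundle of `L` to that of `L'`. -/
abbrev VHom (L L' : ℤ × ℤ) : Type := formsOn (L' - L)

/-- The forms of degree `d`. -/
def vGr (L L' : ℤ × ℤ) (d : ℤ) : Submodule ℂ (VHom L L') where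
  carrier := {F | (d ≠ 0 → F.1.1 = 0) ∧ (d ≠ 1 → F.1.2.1 = 0 ∧ F.1.2.2.1 = 0) ∧
    (d ≠ 2 → F.1.2.2.2 = 0)}
  zero_mem' := by simp
  add_mem' := by
    rintro F K ⟨a1, a2, a3⟩ ⟨b1, b2, b3⟩
    exact ⟨fun h => by simp [a1 h, b1 h], fun h => by simp [a2 h, b2 h],
      fun h => by simp [a3 h, b3 h]⟩
  smul_mem' := by
    rintro k F ⟨a1, a2, a3⟩
    exact ⟨fun h => by simp [a1 h], fun h => by simp [a2 h], fun h => by simp [a3 h]⟩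

def vD (L L' : ℤ × ℤ) (F : VHom L L') : VHom L L' := ⟨formD L L' F.1, formD_mem F.2⟩

def vMul (L L' L'' : ℤ × ℤ) (F : VHom L L') (K : VHom L' L'') : VHom L L'' :=
  ⟨formMul F.1 K.1, by
    have h := formMul_mem F.2 K.2
    rwa [sub_add_sub_comm, add_comm L' L'', add_sub_add_right_eq_sub] at h⟩

def vOne (L : ℤ × ℤ) : VHom L L := ⟨(1, 0, 0, 0), by
  rw [sub_self]
  exact formOne_mem⟩

/-- The full subcategory of `𝒱'` on the line bundles with the given indices, as an `A∞`-category
with `m_k = 0` for `k ≥ 3`. -/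
def vCat {Ob : Type} (E : Ob → ℤ × ℤ) : AInfData Ob where
  Hom i j := VHom (E i) (E j)
  gr i j := vGr (E i) (E j)
  m := Word.ops (fun i j => vD (E i) (E j)) fun i j k => vMul (E i) (E j) (E k)
  one i := vOne (E i)

/-- The indices of the collection `(𝒪, 𝒪(1,0), 𝒪(c,1), 𝒪(1+c,1))`. -/
def coll (c : ℕ) : Fin 4 → ℤ × ℤ := ![(0, 0), (1, 0), (c, 1), (1 + c, 1)]

/-- The morphism `F` has degree zero and is, up to the fibrewise character `e^{i(i₁y₁+i₂y₂)}`, a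
function on `B` that extends to a continuous function `h` on `P`, where `|h|` has maximum `1`,
attained exactly on `V`. -/
def PeaksOn {L L' : ℤ × ℤ} (F : VHom L L') (V : Set (ℝ × ℝ)) : Prop :=
  F ∈ vGr L L' 0 ∧ ∃ (i : ℤ × ℤ) (h : ℝ × ℝ → ℂ), ContinuousOn h P ∧
    (∀ z : ℂ × ℂ, F.1.1 z =
      h (moment z) * Complex.exp (Complex.I * (i.1 * z.1.im + i.2 * z.2.im))) ∧
    IsGreatest ((fun x => ‖h x‖) '' P) 1 ∧ {x | x ∈ P ∧ ‖h x‖ = 1} = V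

end HMS

end

noncomputable section

namespace HMS

/-! The difference of two objects of the collection is a class D = (a, b) with b = -1, or with b ∈
{0, 1} and a ≥ -1 (`Acyclic`). For such D the bundle 𝒪(D) has no higher cohomology, and its
holomorphic sections have as a basis the monomials of degree D in the four homogeneous coordinates,
with exponents `Cox`. The functor sends each generator to a normalized monomial.

In the unitary frame the modulus of a monomial is the square root of the product of Bernstein
polynomials r^k₁ (1-r)^l₁ τ^k₂ (1-τ)^l₂, where r = x¹/(4-x²) and τ = x²/2 (`Cox.exp_sub_potential`).
Its logarithmic differential is k minus the displacement of the two Lagrangian sections, so its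
maximum set `Cox.cell` is the convex set where the displacement equals (k₁, k₂)
(`Cox.mem_cell_iff`). The gradient field has no contracting direction at a cell, so stable manifolds
of its points are points and the degree is 0. At every other component of π(L ∩ L') some contracting
curve leaves P, so it is no generator (`exists_cox_of_isGen`).

No nonconstant trajectory ends in a cell, so the root edge of a gradient tree is constant, and the
lifting condition says that exponents add. As b ≤ 1 also for products, the incoming edges are
horizontal. A tree is then determined by its root in the convex cell of the product, and all trees
are homotopic (`GTree.eq_treeAt`, `GTree.homotopic`). The area of an incoming edge is minus the
logarithm of the normalized modulus at the root (`Cox.lintegral_edge`). Hence e^{-A} is the product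
of two moduli at a peak of the product monomial, which is the structure constant of the normalized
monomials (`Cox.const_mul_const`, `treeCoeff_eq`). So `iota` is multiplicative. It is injective by
independence of characters, and the laws on the Morse side are inherited from the wedge product.
Since all generators have degree 0, degrees exclude operations other than m₂.

For the cohomology, the ∂̄-equation on ℙ¹ is solved by the Cauchy transform, smoothly in a parameter
and in all degrees ≥ -1 (`exists_dbar_snd`). Along the fibres of 𝔽₁ → ℙ¹ this kills (0,2)-forms and
the vertical part of (0,1)-forms. What remains of a closed (0,1)-form is polynomial along the
fibres, and its coefficients are treated on the base (`exists_primitive_horizontal`). Closed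
functions are identified by Liouville's theorem (`exists_eq_sum_monomials`). -/

/-! ### The Cauchy kernel. -/

theorem locallyIntegrable_inv : LocallyIntegrable (fun ζ : ℂ => ζ⁻¹) volume := by
  refine locallyIntegrable_of_norm_le_rpow (C := 1) (α := 1) (by simp)
    (by rw [Complex.finrank_real_complex]; norm_num)
    (ae_of_all _ fun ζ => ?_) (by fun_prop)
  rw [norm_inv, Real.rpow_neg_one, one_mul]

/-- The integral of `∂̄φ / ζ`, in polar coordinates. -/
theorem integral_inv_mul_dbar {φ : ℂ → ℂ} (hφ : ContDiff ℝ 1 φ) (hc : HasCompactSupport φ) :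
    ∫ ζ : ℂ, ζ⁻¹ * (fderiv ℝ φ ζ 1 + Complex.I * fderiv ℝ φ ζ Complex.I)
      = -(2 * Real.pi) * φ 0 := by
  have hD : Continuous (fderiv ℝ φ) := hφ.continuous_fderiv (by simp)
  obtain ⟨R, hR0, hR⟩ : ∃ R > 0, ∀ ζ : ℂ, R ≤ ‖ζ‖ → φ ζ = 0 := hc.exists_pos_le_norm
  have hDR : ∀ ζ : ℂ, R < ‖ζ‖ → fderiv ℝ φ ζ = 0 := by
    intro ζ hζ
    apply (hasFDerivAt_zero_of_eventually_const (0 : ℂ) _).fderiv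
    filter_upwards [(isOpen_lt continuous_const continuous_norm).mem_nhds hζ] with y hy
    exact hR y (le_of_lt hy)
  let E : ℝ → ℂ := fun θ => Real.cos θ + Real.sin θ * Complex.I
  have hE : Continuous E := by fun_prop
  have hEn (θ : ℝ) : ‖E θ‖ = 1 := by
    have : E θ = Complex.exp (θ * Complex.I) := by
      rw [Complex.exp_mul_I]; simp [E]
    rw [this, Complex.norm_exp_ofReal_mul_I]
  -- `A` is the radial derivative and `B` the angular derivative divided by r. The Jacobian r
  -- cancels |ζ⁻¹|, and the integrand becomes A + iB: on each ray `A` integrates to -φ(0), on each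
  -- circle `B` integrates to 0 by periodicity.
  let A : ℝ × ℝ → ℂ := fun p => fderiv ℝ φ (p.1 * E p.2) (E p.2)
  let B : ℝ × ℝ → ℂ := fun p => fderiv ℝ φ (p.1 * E p.2) (Complex.I * E p.2)
  have hpc : Continuous fun p : ℝ × ℝ => (p.1 : ℂ) * E p.2 := by fun_prop
  have hA : Continuous A := (hD.comp hpc).clm_apply (by fun_prop)
  have hB : Continuous B := (hD.comp hpc).clm_apply (by fun_prop)
  have hAR : ∀ p : ℝ × ℝ, R < p.1 → fderiv ℝ φ (p.1 * E p.2) = 0 := by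
    intro p hp
    apply hDR
    rw [norm_mul, hEn, mul_one, Complex.norm_real, Real.norm_eq_abs]
    exact hp.trans_le (le_abs_self _)
  have hint (F : ℝ × ℝ → ℂ) (hF : Continuous F) (h0 : ∀ p : ℝ × ℝ, R < p.1 → F p = 0) :
      IntegrableOn F (Ioi 0 ×ˢ Ioo (-Real.pi) Real.pi) := by
    have h1 : IntegrableOn F (Icc 0 R ×ˢ Icc (-Real.pi) Real.pi) :=
      hF.continuousOn.integrableOn_compact (isCompact_Icc.prod isCompact_Icc)
    refine h1.of_forall_sdiff_eq_zero (measurableSet_Ioi.prod measurableSet_Ioo) ?_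
    rintro p ⟨⟨hp1, hp2⟩, hp3⟩
    apply h0
    by_contra hcon
    exact hp3 ⟨⟨le_of_lt hp1, not_lt.1 hcon⟩, Ioo_subset_Icc_self hp2⟩
  have iA := hint A hA fun p hp => by simp [A, hAR p hp]
  have iB := hint B hB fun p hp => by simp [B, hAR p hp]
  have eA : ∫ p in Ioi (0 : ℝ) ×ˢ Ioo (-Real.pi) Real.pi, A p = -(2 * Real.pi) * φ 0 := by
    have iA' : IntegrableOn (fun p : ℝ × ℝ => A p.swap)
        (Ioo (-Real.pi) Real.pi ×ˢ Ioi (0 : ℝ)) (volume.prod volume) := by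
      have := iA
      rw [Measure.volume_eq_prod] at this
      exact this.swap
    rw [Measure.volume_eq_prod, ← setIntegral_prod_swap, setIntegral_prod _ iA']
    have inner (θ : ℝ) : ∫ r in Ioi (0 : ℝ), A (Prod.swap (θ, r)) = -φ 0 := by
      have hd (r : ℝ) : HasDerivAt (fun r : ℝ => φ (r * E θ)) (A (r, θ)) r := by
        have h2 := ((hφ.differentiable (by simp) (r * E θ)).hasFDerivAt).comp_hasDerivAt r
          (((hasDerivAt_id r).ofReal_comp).mul_const (E θ))
        refine h2.congr_deriv ?_
        simp [A]
      have h0 (r : ℝ) (hr : R < r) : φ (r * E θ) = 0 := by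
        apply hR
        rw [norm_mul, hEn, mul_one, Complex.norm_real, Real.norm_eq_abs]
        exact hr.le.trans (le_abs_self _)
      have h3 := integral_Ioi_of_hasDerivAt_of_tendsto' (a := 0) (m := 0) (fun r _ => hd r) ?_ ?_
      · simpa using h3
      · have h4 : IntegrableOn (fun r => A (r, θ)) (Icc 0 R) :=
          (Continuous.continuousOn (by fun_prop)).integrableOn_compact isCompact_Icc
        refine h4.of_forall_sdiff_eq_zero measurableSet_Ioi ?_
        rintro r ⟨hr1, hr2⟩
        have : R < r := by
          by_contra hcon
          exact hr2 ⟨le_of_lt hr1, not_lt.1 hcon⟩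
        simp [A, hAR (r, θ) this]
      · refine tendsto_const_nhds.congr' ?_
        filter_upwards [eventually_gt_atTop R] with r hr
        rw [h0 r hr]
    simp only [inner, integral_const, MeasurableSet.univ, measureReal_restrict_apply, univ_inter,
      Real.volume_real_Ioo_of_le (show -Real.pi ≤ Real.pi by linarith [Real.pi_pos])]
    rw [Complex.real_smul]
    push_cast
    ring
  have eB : ∫ p in Ioi (0 : ℝ) ×ˢ Ioo (-Real.pi) Real.pi, B p = 0 := by
    rw [Measure.volume_eq_prod, setIntegral_prod _ iB]
    rw [setIntegral_congr_fun (g := fun _ => (0 : ℂ)) measurableSet_Ioi, integral_zero]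
    intro r hr
    have hr' : (r : ℂ) ≠ 0 := by exact_mod_cast (ne_of_gt hr)
    have hd (θ : ℝ) : HasDerivAt (fun θ : ℝ => φ (r * E θ)) (r * B (r, θ)) θ := by
      have h1 : HasDerivAt E (Complex.I * E θ) θ := by
        refine HasDerivAt.congr_deriv (((Real.hasDerivAt_cos θ).ofReal_comp).add
          (((Real.hasDerivAt_sin θ).ofReal_comp).mul_const Complex.I)) ?_
        simp only [E]
        push_cast
        linear_combination (-Complex.sin θ) * Complex.I_sq
      have h2 := ((hφ.differentiable (by simp) (r * E θ)).hasFDerivAt).comp_hasDerivAt θ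
        (h1.const_mul (r : ℂ))
      refine h2.congr_deriv ?_
      simp only [B]
      rw [← Complex.real_smul (x := r) (z := Complex.I * E θ), map_smul, Complex.real_smul]
    show ∫ θ in Ioo (-Real.pi) Real.pi, B (r, θ) = 0
    rw [← integral_Ioc_eq_integral_Ioo,
      ← intervalIntegral.integral_of_le (by linarith [Real.pi_pos])]
    have h3 := intervalIntegral.integral_eq_sub_of_hasDerivAt (a := -Real.pi) (b := Real.pi)
      (fun θ _ => hd θ) (Continuous.intervalIntegrable (by fun_prop) _ _)
    rw [intervalIntegral.integral_const_mul] at h3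
    have h4 : E Real.pi = E (-Real.pi) := by simp [E]
    rw [h4, sub_self] at h3
    exact (mul_eq_zero.1 h3).resolve_left hr'
  rw [← Complex.integral_comp_polarCoord_symm]
  have : ∀ p ∈ polarCoord.target, p.1 • ((Complex.polarCoord.symm p)⁻¹ *
      (fderiv ℝ φ (Complex.polarCoord.symm p) 1
        + Complex.I * fderiv ℝ φ (Complex.polarCoord.symm p) Complex.I))
      = A p + Complex.I * B p := by
    rintro ⟨r, θ⟩ ⟨hr, -⟩
    have hr' : (r : ℂ) ≠ 0 := by exact_mod_cast (ne_of_gt hr)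
    simp only [Complex.polarCoord_symm_apply, A, B, Complex.real_smul]
    change (r : ℂ) * ((r * E θ)⁻¹ * (_ + _)) = _
    generalize hL : fderiv ℝ φ (r * E θ) = ℓ
    have hE0 : E θ ≠ 0 := by intro h; simpa [h] using hEn θ
    have e1 : ℓ (E θ) = Real.cos θ * ℓ 1 + Real.sin θ * ℓ Complex.I := by
      have : E θ = Real.cos θ • (1 : ℂ) + Real.sin θ • Complex.I := by simp [E]
      rw [this, map_add, map_smul, map_smul]; simp
    have e2 : ℓ (Complex.I * E θ) = Real.cos θ * ℓ Complex.I - Real.sin θ * ℓ 1 := by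
      have : Complex.I * E θ = Real.cos θ • Complex.I - Real.sin θ • (1 : ℂ) := by
        simp [E]; linear_combination (Complex.sin θ) * Complex.I_sq
      rw [this, map_sub, map_smul, map_smul]; simp
    have e3 : E θ * (Real.cos θ - Real.sin θ * Complex.I) = 1 := by
      simp only [E]
      push_cast
      linear_combination Complex.sin_sq_add_cos_sq θ - Complex.sin θ ^ 2 * Complex.I_sq
    rw [e1, e2, mul_inv, inv_eq_of_mul_eq_one_right e3]
    field_simp
    ring_nf
    simp [Complex.I_sq]
  rw [setIntegral_congr_fun polarCoord.open_target.measurableSet this]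
  rw [show polarCoord.target = Ioi (0 : ℝ) ×ˢ Ioo (-Real.pi) Real.pi from rfl]
  rw [integral_add iA (iB.const_mul _), integral_const_mul, eA, eB]
  simp

/-- The chain rule for `2∂̄` and a holomorphic map. -/
theorem dbar_comp_holomorphic {K : ℂ × ℂ → ℂ} {φ : ℂ × ℂ → ℂ × ℂ} {φ' : ℂ × ℂ →L[ℂ] ℂ × ℂ}
    {z : ℂ × ℂ} (hK : DifferentiableAt ℝ K (φ z)) (hφ : HasFDerivAt φ φ' z) (e : ℂ × ℂ) :
    dbar e (fun z => K (φ z)) z = dbar (φ' e) K (φ z) := by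
  have h : HasFDerivAt (fun z => K (φ z)) _ z :=
    hK.hasFDerivAt.comp z (hφ.restrictScalars ℝ)
  unfold dbar
  rw [h.fderiv]
  simp

/-- For a ℂ-linear derivative the two terms of `dbar` are ℓ(e) and I·I·ℓ(e), which cancel. -/
theorem dbar_holomorphic {F : ℂ × ℂ → ℂ} {z : ℂ × ℂ} (hF : DifferentiableAt ℂ F z) (e : ℂ × ℂ) :
    dbar e F z = 0 := by
  unfold dbar
  rw [(hF.hasFDerivAt.restrictScalars ℝ).fderiv]
  simp only [ContinuousLinearMap.coe_restrictScalars', map_smul, smul_eq_mul]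
  linear_combination (fderiv ℂ F z) e * Complex.I_sq

/-! ### The ∂̄-equation and holomorphic sections along ℙ¹. -/

/-- A smooth partition of unity on `ℙ¹` subordinate to the two standard charts. -/
theorem exists_cutoffs : ∃ ρ : Bool → ℂ → ℂ, (∀ ε, ContDiff ℝ ∞ (ρ ε)) ∧
    (∀ ε w, 2 < ‖w‖ → ρ ε w = 0) ∧ ∀ ε w, w ≠ 0 → ρ ε w + ρ (!ε) w⁻¹ = 1 := by
  let β : ContDiffBump (0 : ℂ) := ⟨1, 2, one_pos, one_lt_two⟩
  have hβ : ContDiff ℝ ∞ (fun w => (β w : ℂ)) := Complex.ofRealCLM.contDiff.comp β.contDiff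
  -- `σ` is the complement of the bump, seen in the coordinate w⁻¹. Since the bump vanishes far out,
  -- `σ` is 1 near w = 0, in agreement with the value assigned there.
  let σ : ℂ → ℂ := fun w => if w = 0 then 1 else 1 - β w⁻¹
  have hσ : ContDiff ℝ ∞ σ := by
    rw [contDiff_iff_contDiffAt]
    intro w
    by_cases hw : w = 0
    · subst hw
      refine (contDiffAt_const (c := (1 : ℂ))).congr_of_eventuallyEq ?_
      filter_upwards [Metric.ball_mem_nhds (0 : ℂ) (show (0 : ℝ) < 1 / 2 by norm_num)] with w hw
      by_cases h0 : w = 0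
      · simp [σ, h0]
      · have : β w⁻¹ = 0 := by
          apply β.zero_of_le_dist
          rw [mem_ball_zero_iff] at hw
          have : 0 < ‖w‖ := norm_pos_iff.2 h0
          rw [dist_zero_right, norm_inv, le_inv_comm₀ (by norm_num [β]) this]
          simpa [β] using hw.le
        simp [σ, h0, this]
    · have h1 : ContDiffAt ℝ ∞ (fun w : ℂ => 1 - (β w⁻¹ : ℂ)) w :=
        contDiffAt_const.sub (hβ.contDiffAt.comp w ((contDiffAt_inv ℂ hw).restrict_scalars ℝ))
      refine h1.congr_of_eventuallyEq ?_
      filter_upwards [isOpen_ne.mem_nhds hw] with y hy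
      simp [σ, show y ≠ 0 from hy]
  refine ⟨fun ε => if ε then σ else fun w => β w, fun ε => ?_, fun ε w hw => ?_,
    fun ε w hw => ?_⟩
  · cases ε <;> simpa
  · cases ε
    · simp only [Bool.false_eq_true, if_false, Complex.ofReal_eq_zero]
      exact β.zero_of_le_dist (by simpa [β] using hw.le)
    · have h0 : w ≠ 0 := norm_pos_iff.1 (by linarith)
      have : β w⁻¹ = 1 := by
        apply β.one_of_mem_closedBall
        rw [mem_closedBall_zero_iff, norm_inv]
        exact inv_le_one_of_one_le₀ (by linarith)
      simp [σ, h0, this]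
  · cases ε <;> simp [σ, hw]

/-- Solution of `2∂̄U = g` along the second variable, for `g` with compact support along the second
variable, by the Cauchy transform. It is `O(1/w)` at infinity: `V(x, 1/w) = w U(x, w)` extends
smoothly. -/
theorem exists_dbar_snd_of_support {g : ℂ × ℂ → ℂ} (hg : ContDiff ℝ ∞ g) {R : ℝ}
    (h0 : ∀ x w, R < ‖w‖ → g (x, w) = 0) :
    ∃ U V : ℂ × ℂ → ℂ, ContDiff ℝ ∞ U ∧ ContDiff ℝ ∞ V ∧ (∀ p, dbar (0, 1) U p = g p) ∧
      (∀ x w, w ≠ 0 → w * U (x, w) = V (x, w⁻¹)) ∧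
      ∀ x w, w ≠ 0 → w * star w ^ 2 * dbar (0, 1) V (x, w) = -g (x, w⁻¹) := by
  -- The fundamental solution of 2∂/∂w̄.
  let κ : ℂ → ℂ := fun ζ => (2 * Real.pi : ℂ)⁻¹ * ζ⁻¹
  have hκ : LocallyIntegrable κ volume := by
    have := locallyIntegrable_inv.smul (2 * Real.pi : ℂ)⁻¹
    exact this
  let gc : ℂ → ℂ → ℂ := fun x w => g (x, w)
  have hgc : ContDiff ℝ ∞ (↿gc) := hg
  have hk : IsCompact (Metric.closedBall (0 : ℂ) R) := isCompact_closedBall _ _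
  have hgk : ∀ p x, p ∈ (univ : Set ℂ) → x ∉ Metric.closedBall (0 : ℂ) R → gc p x = 0 := by
    intro p x _ hx
    exact h0 p x (by simpa using hx)
  let L := ContinuousLinearMap.mul ℝ ℂ
  let U : ℂ × ℂ → ℂ := fun q => (convolution κ (gc q.1) L volume) q.2
  have hU : ContDiff ℝ ∞ U := by
    rw [← contDiffOn_univ, ← univ_prod_univ]
    exact contDiffOn_convolution_right_with_param L isOpen_univ hk hgk hκ hgc.contDiffOn
  have hgd (p : ℂ × ℂ) : DifferentiableAt ℝ g p := hg.differentiable (by simp) p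
  have dU (p : ℂ × ℂ) : dbar (0, 1) U p = g p := by
    obtain ⟨x, w⟩ := p
    have hd := hasFDerivAt_convolution_right_with_param L isOpen_univ hk hgk hκ
      (hgc.of_le (by simp)).contDiffOn (x, w) (mem_univ _)
    have hcont : Continuous fun y : ℂ => fderiv ℝ (↿gc) (x, y) :=
      (hg.continuous_fderiv (by simp)).comp (by fun_prop)
    have hsupp : HasCompactSupport fun y : ℂ => fderiv ℝ (↿gc) (x, y) := by
      refine HasCompactSupport.intro hk fun y hy => ?_
      apply (hasFDerivAt_zero_of_eventually_const (0 : ℂ) _).fderiv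
      have : IsOpen {q : ℂ × ℂ | R < ‖q.2‖} := isOpen_lt continuous_const (by fun_prop)
      filter_upwards [this.mem_nhds (show R < ‖((x, y) : ℂ × ℂ).2‖ by simpa using hy)] with q hq
      exact h0 q.1 q.2 hq
    have happ (e : ℂ × ℂ) : fderiv ℝ U (x, w) e
        = ∫ t : ℂ, κ t * fderiv ℝ g (x, w - t) e := by
      rw [show fderiv ℝ U (x, w) = _ from hd.fderiv]
      rw [convolution_precompR_apply L hκ hsupp hcont]
      rfl
    let φ : ℂ → ℂ := fun t => g (x, w - t)
    have hφ : ContDiff ℝ 1 φ := (hg.of_le (by simp)).comp (by fun_prop)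
    have hφc : HasCompactSupport φ := by
      refine HasCompactSupport.intro (isCompact_closedBall w R) fun t ht => h0 _ _ ?_
      simpa [dist_eq_norm, norm_sub_rev] using ht
    have hφd (t e : ℂ) : fderiv ℝ φ t e = - fderiv ℝ g (x, w - t) (0, e) := by
      have h1 : HasFDerivAt (fun t : ℂ => (x, w - t))
          ((0 : ℂ →L[ℝ] ℂ).prod (-ContinuousLinearMap.id ℝ ℂ)) t :=
        (hasFDerivAt_const x t).prodMk ((hasFDerivAt_id t).const_sub w)
      have h2 : HasFDerivAt φ _ t := (hgd (x, w - t)).hasFDerivAt.comp t h1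
      rw [h2.fderiv]
      simp only [ContinuousLinearMap.comp_apply, ContinuousLinearMap.prod_apply,
        zero_apply, neg_apply,
        ContinuousLinearMap.id_apply]
      rw [← map_neg]
      simp
    have key := integral_inv_mul_dbar hφ hφc
    have hint (e : ℂ × ℂ) : Integrable (fun t : ℂ => κ t * fderiv ℝ g (x, w - t) e) := by
      have hc : HasCompactSupport fun y : ℂ => fderiv ℝ (↿gc) (x, y) e :=
        hsupp.comp_left (g := fun ℓ : ℂ × ℂ →L[ℝ] ℂ => ℓ e) (by simp)
      have := hc.convolutionExists_right L hκ (by fun_prop) w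
      exact this
    have e1 : dbar (0, 1) U (x, w) = ∫ t : ℂ, (κ t * fderiv ℝ g (x, w - t) (0, 1)
        + Complex.I * (κ t * fderiv ℝ g (x, w - t) (0, Complex.I))) := by
      rw [integral_add (hint _) ((hint _).const_mul _), integral_const_mul, ← happ, ← happ]
      simp [dbar]
    have e2 : (fun t : ℂ => (κ t * fderiv ℝ g (x, w - t) (0, 1)
        + Complex.I * (κ t * fderiv ℝ g (x, w - t) (0, Complex.I)))) = fun t : ℂ =>
        (-(2 * Real.pi : ℂ)⁻¹) * (t⁻¹ * (fderiv ℝ φ t 1 + Complex.I * fderiv ℝ φ t Complex.I)) := by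
      funext t
      simp only [hφd, κ]
      ring
    rw [e1, e2, integral_const_mul, key]
    have hpi : (Real.pi : ℂ) ≠ 0 := by exact_mod_cast Real.pi_ne_zero
    simp only [φ, sub_zero]
    field_simp
  -- Taking w out of the kernel 1/(w - ζ) leaves 1/(1 - ηζ) with η = w⁻¹, which is regular at η = 0
  -- on the support of g.
  let V : ℂ × ℂ → ℂ := fun p => ∫ ζ : ℂ, (2 * Real.pi : ℂ)⁻¹ * (g (p.1, ζ) * (1 - p.2 * ζ)⁻¹)
  have hUV : ∀ x w, w ≠ 0 → w * U (x, w) = V (x, w⁻¹) := by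
    intro x w hw
    have : U (x, w) = ∫ ζ : ℂ, κ (w - ζ) * g (x, ζ) := by
      rw [← integral_sub_left_eq_self _ volume w]
      simp only [sub_sub_cancel]
      rfl
    rw [this, ← integral_const_mul]
    refine integral_congr_ae (ae_of_all _ fun ζ => ?_)
    simp only [κ]
    have : (w - ζ) = w * (1 - w⁻¹ * ζ) := by field_simp
    rw [this, mul_inv]
    field_simp
  have hV : ContDiff ℝ ∞ V := by
    rw [contDiff_iff_contDiffAt]
    rintro ⟨x, η⟩
    by_cases hη : η = 0
    · let s : Set (ℂ × ℂ) := {p | ‖p.2‖ * R < 1}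
      have hs : IsOpen s := isOpen_lt (by fun_prop) continuous_const
      -- With the sign of ζ reversed, `V` is the value at 0 of a convolution of the constant 1 with
      -- `G`, so smoothness in the parameters is that of convolutions.
      let G : ℂ × ℂ → ℂ → ℂ := fun p ζ => (2 * Real.pi : ℂ)⁻¹ * (g (p.1, -ζ) * (1 + p.2 * ζ)⁻¹)
      have hG0 : ∀ p ζ, p ∈ s → ζ ∉ Metric.closedBall (0 : ℂ) R → G p ζ = 0 := by
        intro p ζ _ hζ
        simp [G, h0 p.1 (-ζ) (by simpa using hζ)]
      have hG : ContDiffOn ℝ ∞ (↿G) (s ×ˢ univ) := by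
        rintro ⟨p, ζ⟩ ⟨hp, -⟩
        apply ContDiffAt.contDiffWithinAt
        by_cases hζ : R < ‖ζ‖
        · refine (contDiffAt_const (c := (0 : ℂ))).congr_of_eventuallyEq ?_
          have : IsOpen {q : (ℂ × ℂ) × ℂ | R < ‖q.2‖} := isOpen_lt continuous_const (by fun_prop)
          filter_upwards [this.mem_nhds hζ] with q hq
          show G q.1 q.2 = 0
          simp [G, h0 q.1.1 (-q.2) (by simpa using hq)]
        · have hne : 1 + p.2 * ζ ≠ 0 := by
            intro h
            have h1 : ‖p.2 * ζ‖ = 1 := by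
              rw [show p.2 * ζ = -1 by linear_combination h]; simp
            rw [norm_mul] at h1
            have h2 : ‖p.2‖ * R < 1 := hp
            nlinarith [norm_nonneg p.2, norm_nonneg ζ, not_lt.1 hζ]
          have e : (↿G) = fun q : (ℂ × ℂ) × ℂ =>
            (2 * Real.pi : ℂ)⁻¹ * (g (q.1.1, -q.2) * (1 + q.1.2 * q.2)⁻¹) := rfl
          rw [e]
          refine contDiffAt_const.mul (ContDiffAt.mul ?_ (ContDiffAt.inv ?_ hne))
          · exact (hg.comp (by fun_prop : ContDiff ℝ ∞ fun q : (ℂ × ℂ) × ℂ =>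
              (q.1.1, -q.2))).contDiffAt
          · fun_prop
      have h1 := contDiffOn_convolution_right_with_param_comp (μ := volume) L
        (contDiffOn_const (c := (0 : ℂ))) hs hk hG0
        (locallyIntegrable_const (1 : ℂ)) hG
      have h2 : (x, η) ∈ s := by simp [s, hη]
      refine (h1.contDiffAt (hs.mem_nhds h2)).congr_of_eventuallyEq (Eventually.of_forall ?_)
      intro p
      simp [V, convolution_def, L, G, sub_eq_add_neg]
    · have e : V =ᶠ[𝓝 (x, η)] fun p => p.2⁻¹ * U (p.1, p.2⁻¹) := by
        filter_upwards [(isOpen_ne.preimage continuous_snd).mem_nhds (show η ≠ 0 from hη)]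
          with p hp
        have := hUV p.1 p.2⁻¹ (inv_ne_zero hp)
        rw [inv_inv] at this
        exact this.symm
      refine ContDiffAt.congr_of_eventuallyEq ?_ e
      have hi : ContDiffAt ℝ ∞ (fun p : ℂ × ℂ => p.2⁻¹) (x, η) := contDiffAt_snd.inv hη
      exact hi.mul (hU.contDiffAt.comp _ (contDiffAt_fst.prodMk hi))
  refine ⟨U, V, hU, hV, dU, hUV, ?_⟩
  intro x w hw
  have e : V =ᶠ[𝓝 (x, w)] fun p => p.2⁻¹ * U (p.1, p.2⁻¹) := by
    filter_upwards [(isOpen_ne.preimage continuous_snd).mem_nhds (show w ≠ 0 from hw)]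
      with p hp
    have := hUV p.1 p.2⁻¹ (inv_ne_zero hp)
    rw [inv_inv] at this
    exact this.symm
  have hi : HasFDerivAt (fun p : ℂ × ℂ => p.2⁻¹)
      ((-(w ^ 2)⁻¹) • ContinuousLinearMap.snd ℂ ℂ ℂ) (x, w) :=
    (hasDerivAt_inv hw).comp_hasFDerivAt (x, w) hasFDerivAt_snd
  have hφ : HasFDerivAt (fun p : ℂ × ℂ => (p.1, p.2⁻¹)) _ (x, w) := hasFDerivAt_fst.prodMk hi
  have d1 : DifferentiableAt ℝ (fun p : ℂ × ℂ => p.2⁻¹) (x, w) :=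
    (hi.restrictScalars ℝ).differentiableAt
  have d2 : DifferentiableAt ℝ (fun p : ℂ × ℂ => U (p.1, p.2⁻¹)) (x, w) :=
    (hU.differentiable (by simp) _).comp (x, w) (hφ.restrictScalars ℝ).differentiableAt
  have e3 : dbar (0, 1) V (x, w) = dbar (0, 1) (fun p => p.2⁻¹ * U (p.1, p.2⁻¹)) (x, w) := by
    unfold dbar; rw [e.fderiv_eq]
  rw [e3, dbar_mul d1 d2, dbar_holomorphic hi.differentiableAt,
    dbar_comp_holomorphic (K := U) (hU.differentiable (by simp) _) hφ, dbar_eq, dU]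
  have hw' : (starRingEnd ℂ) w ≠ 0 := star_ne_zero.2 hw
  simp
  field_simp

/-- Identities found for w ≠ 0 by comparing two charts extend to w = 0 by continuity. -/
theorem dense_snd_ne_zero : Dense {p : ℂ × ℂ | p.2 ≠ 0} := by
  have h := (dense_univ (X := ℂ)).prod (dense_compl_singleton (0 : ℂ))
  refine h.mono ?_
  rintro p ⟨-, hp⟩
  exact hp

/-- The `∂̄`-equation on `ℂ × ℙ¹` along `ℙ¹`, for forms with values in `𝒪(n - 1)`. -/
theorem exists_dbar_snd (n : ℕ) {q : Bool → ℂ × ℂ → ℂ} (hq : ∀ δ, ContDiff ℝ ∞ (q δ))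
    (h : ∀ δ x w, w ≠ 0 → w * star w ^ 2 * q δ (x, w) = -(w ^ n * q (!δ) (x, w⁻¹))) :
    ∃ f : Bool → ℂ × ℂ → ℂ, (∀ δ, ContDiff ℝ ∞ (f δ)) ∧
      (∀ δ p, dbar (0, 1) (f δ) p = q δ p) ∧
      ∀ δ x w, w ≠ 0 → w * f δ (x, w) = w ^ n * f (!δ) (x, w⁻¹) := by
  obtain ⟨ρ, hρ, hρ0, hρ1⟩ := exists_cutoffs
  have hg (δ : Bool) : ContDiff ℝ ∞ fun p : ℂ × ℂ => ρ δ p.2 * q δ p :=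
    ((hρ δ).comp contDiff_snd).mul (hq δ)
  choose U V hU hV dU hUV dV using fun δ => exists_dbar_snd_of_support (hg δ) (R := 2)
    fun x w hw => by simp [hρ0 δ w hw]
  have hp : ContDiff ℝ ∞ fun p : ℂ × ℂ => p.2 ^ n := contDiff_snd.pow n
  -- The second summand solves for the datum cut off at the other pole: it is w^(n-1) U(1/w),
  -- rewritten as w^n V(w). The decay of U makes this regular even for n = 0, that is for 𝒪(-1).
  refine ⟨fun δ p => U δ p + p.2 ^ n * V (!δ) p, fun δ => (hU δ).add (hp.mul (hV _)),
    fun δ => ?_, fun δ x w hw => ?_⟩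
  · have hc : Continuous (dbar (0, 1) fun p => U δ p + p.2 ^ n * V (!δ) p) :=
      (contDiff_dbar ((hU δ).add (hp.mul (hV _))) _).continuous
    refine fun p => congrFun (hc.ext_on dense_snd_ne_zero (hq δ).continuous ?_) p
    rintro ⟨x, w⟩ hw
    replace hw : w ≠ 0 := hw
    have d1 : DifferentiableAt ℂ (fun p : ℂ × ℂ => p.2 ^ n) (x, w) := by fun_prop
    have d2 := (hV (!δ)).differentiable (by simp) (x, w)
    have d3 := (hU δ).differentiable (by simp) (x, w)
    rw [dbar_add d3 ((d1.restrictScalars ℝ).fun_mul d2), dbar_mul (d1.restrictScalars ℝ) d2,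
      dbar_holomorphic d1, dU]
    have e1 := dV (!δ) x w hw
    have e2 := h δ x w hw
    have e3 := hρ1 δ w hw
    have hw' : star w ≠ 0 := star_ne_zero.2 hw
    have e4 : w * star w ^ 2 ≠ 0 := mul_ne_zero hw (pow_ne_zero 2 hw')
    apply mul_left_cancel₀ e4
    simp only at e1 ⊢
    linear_combination w ^ n * e1 - (1 - ρ δ w) * e2 - w ^ n * q (!δ) (x, w⁻¹) * e3
  · have e1 := hUV δ x w hw
    have e2 := hUV (!δ) x w⁻¹ (inv_ne_zero hw)
    rw [inv_inv] at e2
    simp only [Bool.not_not, inv_pow]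
    have hn : w ^ n ≠ 0 := pow_ne_zero n hw
    have e3 : U (!δ) (x, w⁻¹) = w * V (!δ) (x, w) := by
      rw [← e2, mul_inv_cancel_left₀ hw]
    rw [e3, mul_add, e1, mul_add, mul_inv_cancel_left₀ hn]
    ring

/-- Sections of `𝒪(n - 1)` on `ℙ¹` are polynomials of degree less than `n`. -/
theorem exists_eq_sum_pow (n : ℕ) {f g : ℂ → ℂ} (hf : Differentiable ℂ f) (hg : ContinuousAt g 0)
    (h : ∀ w, w ≠ 0 → w * f w = w ^ n * g w⁻¹) :
    ∃ a : ℕ → ℂ, ∀ w, f w = ∑ i ∈ Finset.range n, a i * w ^ i := by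
  induction n generalizing f g with
  | zero =>
    refine ⟨0, fun w => ?_⟩
    simp only [Finset.range_zero, Finset.sum_empty]
    -- For n = 0 the relation says f(w) = w⁻¹ g(w⁻¹), so f tends to 0 at infinity and Liouville's
    -- theorem applies.
    refine hf.apply_eq_of_tendsto_cocompact (c := 0) w ?_
    have h1 : Tendsto (fun w : ℂ => w⁻¹ * g w⁻¹) (cocompact ℂ) (𝓝 (0 * g 0)) := by
      have h2 : Tendsto (fun w : ℂ => w⁻¹) (cocompact ℂ) (𝓝 0) := tendsto_inv₀_cobounded.mono_left
        (by rw [Metric.cobounded_eq_cocompact])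
      exact h2.mul (hg.tendsto.comp h2)
    rw [zero_mul] at h1
    refine h1.congr' ?_
    filter_upwards [(isCompact_singleton (x := (0 : ℂ))).compl_mem_cocompact] with w hw
    have hw0 : w ≠ 0 := by simpa using hw
    have := h w hw0
    rw [pow_zero, one_mul] at this
    rw [← this]
    field_simp
  | succ n ih =>
    have hd : Differentiable ℂ (dslope f 0) := by
      have := (Complex.differentiableOn_dslope (f := f) (univ_mem (f := 𝓝 (0 : ℂ)))).2
        hf.differentiableOn
      exact differentiableOn_univ.1 this
    have hs (w : ℂ) (hw : w ≠ 0) : w * dslope f 0 w = f w - f 0 := by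
      rw [dslope_of_ne _ hw, slope_def_field]
      rw [sub_zero, mul_div_cancel₀ _ hw]
    -- Dividing f - f(0) by w lowers the degree by one; at infinity this subtracts f(0) ηⁿ from g.
    obtain ⟨a, ha⟩ := ih hd (g := fun η => g η - f 0 * η ^ n)
      (hg.sub (by fun_prop)) fun w hw => by
        have e1 := h w hw
        have e2 := hs w hw
        have hn : w ^ n ≠ 0 := pow_ne_zero n hw
        rw [e2]
        apply mul_left_cancel₀ hw
        rw [mul_sub, e1]
        rw [inv_pow, mul_sub, mul_comm (f 0), mul_inv_cancel_left₀ hn]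
        ring
    refine ⟨fun i => if i = 0 then f 0 else a (i - 1), fun w => ?_⟩
    rw [Finset.sum_range_succ']
    simp only [Nat.succ_ne_zero, if_false, Nat.add_sub_cancel, if_true, pow_zero, mul_one]
    by_cases hw : w = 0
    · simp [hw]
    · have e2 := hs w hw
      rw [ha w, Finset.mul_sum] at e2
      rw [← sub_eq_iff_eq_add, ← e2]
      refine Finset.sum_congr rfl fun i _ => by ring

/-- Extension by zero across `{ℓ = 0}`. -/
theorem exists_extension_by_zero {ρ : ℂ → ℂ} (hρ : ContDiff ℝ ∞ ρ) {R : ℝ} (hR : 0 < R)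
    (h0 : ∀ w, R < ‖w‖ → ρ w = 0) {Φ : ℂ × ℂ → ℂ}
    (hΦ : ∀ p : ℂ × ℂ, p.1 ≠ 0 → ContDiffAt ℝ ∞ Φ p) :
    ∃ Ψ : ℂ × ℂ → ℂ, ContDiff ℝ ∞ Ψ ∧ ∀ p : ℂ × ℂ, p.1 ≠ 0 → Ψ p = ρ p.1⁻¹ * Φ p := by
  refine ⟨fun p => if p.1 = 0 then 0 else ρ p.1⁻¹ * Φ p, ?_, fun p hp => by simp [hp]⟩
  rw [contDiff_iff_contDiffAt]
  rintro ⟨w, x⟩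
  by_cases hw : w = 0
  · refine (contDiffAt_const (c := (0 : ℂ))).congr_of_eventuallyEq ?_
    have : IsOpen {p : ℂ × ℂ | ‖p.1‖ < R⁻¹} := isOpen_lt (by fun_prop) continuous_const
    filter_upwards [this.mem_nhds (show ‖((w, x) : ℂ × ℂ).1‖ < R⁻¹ by simp [hw, hR])] with p hp
    by_cases hp0 : p.1 = 0
    · simp [hp0]
    · have : R < ‖p.1⁻¹‖ := by
        rw [norm_inv]
        exact (lt_inv_comm₀ (norm_pos_iff.2 hp0) hR).1 hp
      simp [hp0, h0 _ this]
  · have hi : ContDiffAt ℝ ∞ (fun p : ℂ × ℂ => p.1⁻¹) (w, x) := contDiffAt_fst.inv hw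
    refine ((hρ.contDiffAt.comp _ hi).mul (hΦ (w, x) hw)).congr_of_eventuallyEq ?_
    filter_upwards [(isOpen_ne.preimage continuous_fst).mem_nhds (show w ≠ 0 from hw)] with p hp
    simp [show p.1 ≠ 0 from hp]

/-! ### `A∞`-categories with vanishing higher operations -/

namespace Word

variable {Ob : Type} {H : Ob → Ob → Type}

theorem length_append : ∀ {X Y Z : Ob} (v : Word H X Y) (w : Word H Y Z),
    (v.append w).length = v.length + w.length
  | _, _, _, nil _, w => by simp [append, length]
  | _, _, _, cons f v, w => by simp [append, length, length_append v w]; omega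

theorem length_map {H' : Ob → Ob → Type} (φ : ∀ X Y, H X Y → H' X Y) :
    ∀ {X Y : Ob} (w : Word H X Y), (w.map φ).length = w.length
  | _, _, nil _ => rfl
  | _, _, cons f w => by simp [map, length, length_map φ w]

theorem length_of_mem_splits : ∀ {X Y : Ob} (w : Word H X Y), ∀ s ∈ w.splits,
    s.2.1.length + s.2.2.length = w.length
  | _, _, nil X, s, hs => by
    simp only [splits, List.mem_singleton] at hs
    subst hs
    rfl
  | _, _, cons f w, s, hs => by
    simp only [splits, List.mem_cons, List.mem_map] at hs
    rcases hs with rfl | ⟨t, ht, rfl⟩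
    · simp [length]
    · have := length_of_mem_splits w t ht
      simp only [length]
      omega

theorem ops_eq_zero [∀ X Y, Zero (H X Y)] (d : ∀ X Y, H X Y → H X Y)
    (mul : ∀ X Y Z, H X Y → H Y Z → H X Z) : ∀ {X Y : Ob} (w : Word H X Y),
    w.length ≠ 1 → w.length ≠ 2 → w.ops d mul = 0
  | _, _, nil _, _, _ => rfl
  | _, _, cons _ (nil _), h, _ => by simp [length] at h
  | _, _, cons _ (cons _ (nil _)), _, h => by simp [length] at h
  | _, _, cons _ (cons _ (cons _ _)), _, _ => rfl

end Word

namespace AInfData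

variable {Ob : Type}

/-- A DG category, as an `A∞`-category. -/
theorem isAInf_of_dg (A : AInfData Ob) (d : ∀ X Y, A.Hom X Y → A.Hom X Y)
    (mul : ∀ X Y Z, A.Hom X Y → A.Hom Y Z → A.Hom X Z)
    (hm : ∀ {X Y : Ob} (w : Word A.Hom X Y), A.m w = w.ops d mul)
    (internal : ∀ X Y, DirectSum.IsInternal (A.gr X Y))
    (d_linear : ∀ X Y, IsLinearMap ℂ (d X Y))
    (mul_left : ∀ X Y Z g, IsLinearMap ℂ fun f => mul X Y Z f g)
    (mul_right : ∀ X Y Z f, IsLinearMap ℂ fun g => mul X Y Z f g)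
    (d_mem : ∀ X Y n f, f ∈ A.gr X Y n → d X Y f ∈ A.gr X Y (n + 1))
    (mul_mem : ∀ X Y Z n k f g, f ∈ A.gr X Y n → g ∈ A.gr Y Z k →
      mul X Y Z f g ∈ A.gr X Z (n + k))
    (d_d : ∀ X Y f, d X Y (d X Y f) = 0)
    (leibniz : ∀ X Y Z n f g, f ∈ A.gr X Y n → d X Z (mul X Y Z f g) =
      mul X Y Z (d X Y f) g + ((Int.negOnePow n : ℤˣ) : ℤ) • mul X Y Z f (d Y Z g))
    (assoc : ∀ X Y Z W f g h,
      mul X Z W (mul X Y Z f g) h = mul X Y W f (mul Y Z W g h))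
    (one_mem : ∀ X, A.one X ∈ A.gr X X 0)
    (one_mul : ∀ X Y f, mul X X Y (A.one X) f = f)
    (mul_one : ∀ X Y f, mul X Y Y f (A.one Y) = f)
    (d_one : ∀ X, d X X (A.one X) = 0) : A.IsAInf := by
  have linear : ∀ {X Y Z W : Ob} (p : Word A.Hom X Y) (q : Word A.Hom Z W),
      IsLinearMap ℂ fun f : A.Hom Y Z => A.m (p.append (.cons f q)) := by
    have hz : ∀ {X Y Z W : Ob}, IsLinearMap ℂ fun _ : A.Hom Y Z => (0 : A.Hom X W) :=
      ⟨fun _ _ => (add_zero 0).symm, fun _ _ => (smul_zero _).symm⟩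
    intro X Y Z W p q
    simp only [hm]
    match p, q with
    | .nil _, .nil _ => exact d_linear _ _
    | .nil _, .cons g (.nil _) => exact mul_left _ _ _ _
    | .nil _, .cons _ (.cons _ _) => exact hz
    | .cons f (.nil _), .nil _ => exact mul_right _ _ _ _
    | .cons _ (.nil _), .cons _ _ => exact hz
    | .cons _ (.cons _ (.nil _)), _ => exact hz
    | .cons _ (.cons _ (.cons _ _)), _ => exact hz
  have m_zero : ∀ {X Y Z W : Ob} (p : Word A.Hom X Y) (q : Word A.Hom Z W),
      A.m (p.append (.cons (0 : A.Hom Y Z) q)) = 0 := fun p q => (linear p q).map_zero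
  refine ⟨internal, fun X => ?_, linear, ?_, ?_, one_mem, ?_, ?_, ?_⟩
  · rw [hm]; rfl
  · intro X Y w
    rw [hm]
    match w with
    | .nil _ => exact zero_mem _
    | .cons f (.nil _) =>
      have := d_mem _ _ _ _ f.2.2
      convert! this using 1
      simp [AInfData.deg, Word.length]
      ring_nf
    | .cons f (.cons g (.nil _)) =>
      have := mul_mem _ _ _ _ _ _ _ f.2.2 g.2.2
      convert! this using 1
      simp [AInfData.deg, Word.length]
    | .cons _ (.cons _ (.cons _ _)) => exact zero_mem _
  · intro X Y w
    match w with
    | .nil _ => simp [Word.splits, AInfData.forget, Word.map, Word.append, hm, Word.ops,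
        (d_linear _ _).map_zero]
    | .cons f (.nil _) =>
      simp [Word.splits, AInfData.forget, Word.map, Word.append, hm, Word.ops, d_d,
        (mul_left _ _ _ _).map_zero, (mul_right _ _ _ _).map_zero]
    | .cons f (.cons g (.nil _)) =>
      have := leibniz _ _ _ _ f.2.1 g.2.1 f.2.2
      simp [Word.splits, AInfData.forget, Word.map, Word.append, hm, Word.ops,
        Word.length, AInfData.deg, this, Int.negOnePow_add]
    | .cons f (.cons g (.cons h (.nil _))) =>
      have := assoc _ _ _ _ f.2.1 g.2.1 h.2.1
      have h2 : Int.negOnePow 2 = 1 := Int.negOnePow_even 2 (by decide)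
      simp [Word.splits, AInfData.forget, Word.map, Word.append, hm, Word.ops,
        Word.length, AInfData.deg, this, Int.negOnePow_add, h2, (d_linear _ _).map_zero]
    -- For words of length at least 4, inner and outer arities add up to at least 5, so they cannot
    -- both be 1 or 2 and every term vanishes.
    | .cons f (.cons g (.cons h (.cons k v))) =>
      apply List.sum_eq_zero
      intro x hx
      obtain ⟨s, hs, hx⟩ := List.mem_flatMap.1 hx
      obtain ⟨s', hs', rfl⟩ := List.mem_map.1 hx
      have l1 := Word.length_of_mem_splits _ s hs
      have l2 := Word.length_of_mem_splits _ s' hs'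
      simp only [Word.length] at l1
      have : A.m ((A.forget s.2.1).append
          (.cons (A.m (A.forget s'.2.1)) (A.forget s'.2.2))) = 0 := by
        by_cases h1 : s'.2.1.length = 1 ∨ s'.2.1.length = 2
        · rw [hm]
          apply Word.ops_eq_zero <;>
          · simp only [Word.length_append, Word.length, AInfData.forget, Word.length_map]
            omega
        · push Not at h1
          have : A.m (A.forget s'.2.1) = 0 := by
            rw [hm]
            apply Word.ops_eq_zero <;> simp only [AInfData.forget, Word.length_map]
            exacts [h1.1, h1.2]
          rw [this, m_zero]
      rw [this, smul_zero]
  · intro X Y f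
    exact (hm _).trans (one_mul _ _ _)
  · intro X Y f
    exact (hm _).trans (mul_one _ _ _)
  · intro X Y Z p q hpq
    rw [hm]
    match p, q with
    | .nil _, .nil _ => exact d_one _
    | .nil _, .cons g (.nil _) => simp [Word.length] at hpq
    | .nil _, .cons _ (.cons _ _) => rfl
    | .cons f (.nil _), .nil _ => simp [Word.length] at hpq
    | .cons _ (.nil _), .cons _ _ => rfl
    | .cons _ (.cons _ (.nil _)), _ => rfl
    | .cons _ (.cons _ (.cons _ _)), _ => rfl

theorem isInternal_of_concentrated {M : Type*} [AddCommGroup M] [Module ℂ M]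
    {gr : ℤ → Submodule ℂ M} (h0 : gr 0 = ⊤) (h : ∀ d, d ≠ 0 → gr d = ⊥) :
    DirectSum.IsInternal gr := by
  rw [DirectSum.isInternal_submodule_iff_iSupIndep_and_iSup_eq_top]
  refine ⟨fun d => ?_, eq_top_iff.2 (h0 ▸ le_iSup gr 0)⟩
  by_cases hd : d = 0
  · have : (⨆ j, ⨆ (_ : j ≠ d), gr j) = ⊥ := by
      simp only [iSup_eq_bot]
      intro j hj
      exact h j (hd ▸ hj)
    rw [this]
    exact disjoint_bot_right
  · rw [h d hd]
    exact disjoint_bot_left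

/-- For morphisms concentrated in degree zero, the degrees of the operations leave only `m₂`. -/
theorem determinedByM2_of_concentrated (A : AInfData Ob) (h0 : ∀ X Y, A.gr X Y 0 = ⊤)
    (h : ∀ X Y d, d ≠ 0 → A.gr X Y d = ⊥)
    (hm : ∀ {X Y : Ob} (w : Word A.Hom X Y), w.length ≠ 2 → A.m w = 0) : A.DeterminedByM2 := by
  intro m' hm' h2 X Y w
  -- Every word is homogeneous with all letters of degree 0, so its value under `m'` has degree 2
  -- minus its length; that piece is zero unless the length is 2.
  have lift : ∀ {X Y : Ob} (w : Word A.Hom X Y), ∃ v : (A.withOps m').HWord X Y,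
      (A.withOps m').forget v = w ∧ (A.withOps m').deg v = 0 ∧ v.length = w.length := by
    intro X Y w
    induction w with
    | nil X => exact ⟨.nil X, rfl, rfl, rfl⟩
    | cons f w ih =>
      obtain ⟨v, h1, h2, h3⟩ := ih
      refine ⟨.cons ⟨0, f, ?_⟩ v, ?_, ?_, ?_⟩
      · show f ∈ A.gr _ _ 0
        rw [h0]
        trivial
      · show Word.cons f ((A.withOps m').forget v) = _
        rw [h1]
      · simpa [AInfData.deg] using h2
      · simpa [Word.length] using h3
  by_cases hw : w.length = 2
  · match w, hw with
    | .cons f (.cons g (.nil _)), _ => exact h2 _ _ _ f g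
    | .nil _, hw => simp [Word.length] at hw
    | .cons _ (.nil _), hw => simp [Word.length] at hw
    | .cons _ (.cons _ (.cons _ _)), hw => simp [Word.length] at hw
  · rw [hm w hw]
    obtain ⟨v, h1, h2, h3⟩ := lift w
    have := hm'.degree v
    rw [h1, h2, h3] at this
    have h4 := h X Y (0 + 2 - w.length) (by omega)
    have h5 : m' X Y w ∈ A.gr X Y (0 + 2 - w.length) := this
    rw [h4] at h5
    exact (Submodule.mem_bot ℂ).1 h5

end AInfData

/-! ### The DG category of line bundles -/

/-- Expanding both sides gives four second derivatives each; they match by symmetry of the second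
derivative. -/
theorem dbar_comm {F : ℂ × ℂ → ℂ} (hF : ContDiff ℝ ∞ F) (e e' z : ℂ × ℂ) :
    dbar e (dbar e' F) z = dbar e' (dbar e F) z := by
  have h1 : Differentiable ℝ (fderiv ℝ F) :=
    (hF.fderiv_right (m := ∞) (by simp)).differentiable (by simp)
  have h2 (a b : ℂ × ℂ) : fderiv ℝ (dbar a F) z b =
      fderiv ℝ (fderiv ℝ F) z b a + Complex.I * fderiv ℝ (fderiv ℝ F) z b (Complex.I • a) := by
    have h3 (a : ℂ × ℂ) : HasFDerivAt (fun z => fderiv ℝ F z a)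
        ((ContinuousLinearMap.apply ℝ ℂ a).comp (fderiv ℝ (fderiv ℝ F) z)) z :=
      (ContinuousLinearMap.apply ℝ ℂ a).hasFDerivAt.comp z (h1 z).hasFDerivAt
    have h4 : HasFDerivAt (dbar a F) _ z := (h3 a).add ((h3 (Complex.I • a)).const_mul Complex.I)
    rw [h4.fderiv]
    simp
  have hs (a b : ℂ × ℂ) : fderiv ℝ (fderiv ℝ F) z a b = fderiv ℝ (fderiv ℝ F) z b a :=
    (hF.contDiffAt.isSymmSndFDerivAt
      (by rw [minSmoothness_of_isRCLikeNormedField]; exact WithTop.coe_le_coe.2 (le_top (a := (2 : ℕ∞))))) a b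
  show fderiv ℝ (dbar e' F) z e + Complex.I * fderiv ℝ (dbar e' F) z (Complex.I • e)
    = fderiv ℝ (dbar e F) z e' + Complex.I * fderiv ℝ (dbar e F) z (Complex.I • e')
  rw [h2, h2, h2, h2, hs e e', hs e (Complex.I • e'), hs (Complex.I • e) e',
    hs (Complex.I • e) (Complex.I • e')]
  ring

theorem contDiff_of_frame {D : ℤ × ℤ} {j : Fin 4} {F K : ℂ × ℂ → ℂ} (hK : ContDiff ℝ ∞ K)
    (h : ∀ z, frame D j z * F z = K (chart j z)) : ContDiff ℝ ∞ F := by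
  have e : F = fun z => (frame D j z)⁻¹ * K (chart j z) := by
    funext z
    rw [← h z, inv_mul_cancel_left₀ (frame_ne D j z)]
  rw [e]
  exact ((contDiff_frame D j).inv (frame_ne D j)).mul (hK.comp (contDiff_chart j))

/-- On the torus the frame has no zeros and the chart is smooth, so a single chart suffices to read
off smoothness of the coefficients. -/
theorem contDiff_of_mem {D : ℤ × ℤ} {F : Form} (hF : F ∈ formsOn D) :
    ContDiff ℝ ∞ F.1 ∧ ContDiff ℝ ∞ F.2.1 ∧ ContDiff ℝ ∞ F.2.2.1 ∧ ContDiff ℝ ∞ F.2.2.2 := by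
  obtain ⟨G, p, q, h, hG, hp, hq, hh, H⟩ := hF 1
  have hs1 : ContDiff ℝ ∞ (fun w : ℂ × ℂ => star w.1) :=
    Complex.conjCLE.contDiff.comp contDiff_fst
  have hs2 : ContDiff ℝ ∞ (fun w : ℂ × ℂ => star w.2) :=
    Complex.conjCLE.contDiff.comp contDiff_snd
  refine ⟨contDiff_of_frame hG fun z => (H z).1,
    contDiff_of_frame (K := fun w => chartMat 1 0 0 * (star w.1 * p w)
      + chartMat 1 1 0 * (star w.2 * q w)) ?_ fun z => (H z).2.1,
    contDiff_of_frame (K := fun w => chartMat 1 0 1 * (star w.1 * p w)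
      + chartMat 1 1 1 * (star w.2 * q w)) ?_ fun z => (H z).2.2.1,
    contDiff_of_frame (K := fun w => (chartMat 1 0 0 * chartMat 1 1 1
      - chartMat 1 0 1 * chartMat 1 1 0) * (star w.1 * star w.2 * h w)) ?_ fun z => (H z).2.2.2⟩
  · exact (contDiff_const.mul (hs1.mul hp)).add (contDiff_const.mul (hs2.mul hq))
  · exact (contDiff_const.mul (hs1.mul hp)).add (contDiff_const.mul (hs2.mul hq))
  · exact contDiff_const.mul ((hs1.mul hs2).mul hh)

/-- The covariant derivative is conjugate to `2∂̄`. -/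
theorem frame_mul_covariant {D : ℤ × ℤ} {F : ℂ × ℂ → ℂ} (hF : Differentiable ℝ F) (j : Fin 4)
    (z e : ℂ × ℂ) (he : e.1.im = 0) (he' : e.2.im = 0) :
    frame D j z * (dbar e F z
        + ((lagr D (moment z)).1 * e.1.re + (lagr D (moment z)).2 * e.2.re) * F z) =
      dbar e (fun z => frame D j z * F z) z := by
  rw [dbar_mul ((contDiff_frame D j).differentiable (by simp) z) (hF z) e,
    dbar_frame D j z e he he']
  ring

/-- Multiplication by the frame turns both covariant derivatives into components of 2∂̄, and these
commute. -/
theorem formD_formD {L L' : ℤ × ℤ} {F : Form} (hF : F ∈ formsOn (L' - L)) :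
    formD L L' (formD L L' F) = 0 := by
  obtain ⟨h0, -, -, -⟩ := contDiff_of_mem hF
  obtain ⟨-, h1, h2, -⟩ := contDiff_of_mem (formD_mem hF)
  have hz (e z : ℂ × ℂ) : dbar e (0 : ℂ × ℂ → ℂ) z = 0 := dbar_holomorphic (by fun_prop) e
  have hΦ := contDiff_frame (L' - L) 1
  have hc := dbar_comm (hΦ.mul h0) (1, 0) (0, 1)
  refine Prod.ext rfl (Prod.ext ?_ (Prod.ext ?_ ?_))
  · funext z
    simp [formD, hz]
  · funext z
    simp [formD, hz]
  · funext z
    have k1 := frame_mul_covariant (D := L' - L) (h2.differentiable (by simp)) 1 z (1, 0)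
      (by simp) (by simp)
    have k2 := frame_mul_covariant (D := L' - L) (h1.differentiable (by simp)) 1 z (0, 1)
      (by simp) (by simp)
    have g1 (z : ℂ × ℂ) := frame_mul_covariant (D := L' - L) (h0.differentiable (by simp)) 1 z
      (1, 0) (by simp) (by simp)
    have g2 (z : ℂ × ℂ) := frame_mul_covariant (D := L' - L) (h0.differentiable (by simp)) 1 z
      (0, 1) (by simp) (by simp)
    have hne := frame_ne (L' - L) 1 z
    apply mul_left_cancel₀ hne
    simp only [formD, disp_eq] at k1 k2 ⊢
    simp only [Complex.one_re, Complex.zero_re, Complex.ofReal_one, Complex.ofReal_zero, mul_one,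
      mul_zero, add_zero, zero_add] at k1 k2 g1 g2
    simp only [g1, g2] at k1 k2
    rw [mul_sub, k1, k2]
    have := hc z
    simp only [Prod.snd_zero, Pi.zero_apply, mul_zero]
    rw [sub_eq_zero]
    exact this

/-- The Leibniz sign appears as the parity involution applied to the first factor, so that no
homogeneity is needed; `formMul_signed` turns it into a power of -1. -/
theorem formD_formMul {L L' L'' : ℤ × ℤ} {F K : Form} (hF : F ∈ formsOn (L' - L))
    (hK : K ∈ formsOn (L'' - L')) :
    formD L L'' (formMul F K) = formMul (formD L L' F) K
      + formMul (F.1, -F.2.1, -F.2.2.1, F.2.2.2) (formD L' L'' K) := by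
  obtain ⟨f0, f1, f2, f3⟩ := contDiff_of_mem hF
  obtain ⟨k0, k1, k2, k3⟩ := contDiff_of_mem hK
  have df0 (z) := f0.differentiable (by simp) z
  have df1 (z) := f1.differentiable (by simp) z
  have df2 (z) := f2.differentiable (by simp) z
  have dk0 (z) := k0.differentiable (by simp) z
  have dk1 (z) := k1.differentiable (by simp) z
  have dk2 (z) := k2.differentiable (by simp) z
  have hd (z) : disp L L'' (moment z) = disp L L' (moment z) + disp L' L'' (moment z) := by
    simp [disp]
  have hm {A B : ℂ × ℂ → ℂ} {z : ℂ × ℂ} (hA : DifferentiableAt ℝ A z)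
      (hB : DifferentiableAt ℝ B z) (e : ℂ × ℂ) :
      dbar e (A * B) z = A z * dbar e B z + dbar e A z * B z := dbar_mul hA hB e
  have ha {A B : ℂ × ℂ → ℂ} {z : ℂ × ℂ} (hA : DifferentiableAt ℝ A z)
      (hB : DifferentiableAt ℝ B z) (e : ℂ × ℂ) :
      dbar e (A + B) z = dbar e A z + dbar e B z := dbar_add hA hB e
  refine Prod.ext ?_ (Prod.ext ?_ (Prod.ext ?_ ?_))
  · simp [formD, formMul]
  · funext z
    simp only [formD, formMul, hd, Prod.snd_add, Prod.fst_add, Pi.add_apply, Pi.mul_apply,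
      hm (df0 z) (dk0 z), Pi.zero_apply, Pi.neg_apply]
    push_cast
    ring
  · funext z
    simp only [formD, formMul, hd, Prod.snd_add, Prod.fst_add, Pi.add_apply, Pi.mul_apply,
      hm (df0 z) (dk0 z), Pi.zero_apply, Pi.neg_apply]
    push_cast
    ring
  · funext z
    simp only [formD, formMul, hd, Prod.snd_add, Prod.fst_add, Pi.add_apply, Pi.mul_apply,
      Pi.sub_apply, Pi.zero_apply, Pi.neg_apply,
      ha ((df0 z).mul (dk2 z)) ((df2 z).mul (dk0 z)),
      ha ((df0 z).mul (dk1 z)) ((df1 z).mul (dk0 z)),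
      hm (df0 z) (dk2 z), hm (df2 z) (dk0 z), hm (df0 z) (dk1 z), hm (df1 z) (dk0 z)]
    push_cast
    ring

theorem formD_add {L L' : ℤ × ℤ} {F K : Form} (hF : F ∈ formsOn (L' - L))
    (hK : K ∈ formsOn (L' - L)) : formD L L' (F + K) = formD L L' F + formD L L' K := by
  obtain ⟨f0, f1, f2, f3⟩ := contDiff_of_mem hF
  obtain ⟨k0, k1, k2, k3⟩ := contDiff_of_mem hK
  have ha {A B : ℂ × ℂ → ℂ} (hA : ContDiff ℝ ∞ A)
      (hB : ContDiff ℝ ∞ B) (e z : ℂ × ℂ) :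
      dbar e (A + B) z = dbar e A z + dbar e B z :=
    dbar_add (hA.differentiable (by simp) z) (hB.differentiable (by simp) z) e
  refine Prod.ext (by simp [formD]) (Prod.ext ?_ (Prod.ext ?_ ?_)) <;> funext z <;>
    simp only [formD, Prod.fst_add, Prod.snd_add, ha f0 k0, ha f1 k1, ha f2 k2, Pi.add_apply] <;>
    ring

theorem formD_smul {L L' : ℤ × ℤ} {F : Form} (hF : F ∈ formsOn (L' - L)) (k : ℂ) :
    formD L L' (k • F) = k • formD L L' F := by
  obtain ⟨f0, f1, f2, f3⟩ := contDiff_of_mem hF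
  have ha {A : ℂ × ℂ → ℂ} (hA : ContDiff ℝ ∞ A) (e z : ℂ × ℂ) :
      dbar e (k • A) z = k * dbar e A z := dbar_const_mul (hA.differentiable (by simp) z) k e
  refine Prod.ext (by simp [formD]) (Prod.ext ?_ (Prod.ext ?_ ?_)) <;> funext z <;>
    simp only [formD, Prod.smul_fst, Prod.smul_snd, ha f0, ha f1, ha f2, Pi.smul_apply,
      smul_eq_mul] <;>
    ring

theorem deg_zero_mem {D : ℤ × ℤ} {F : Form} (hF : F ∈ formsOn D) :
    ((F.1, 0, 0, 0) : Form) ∈ formsOn D := by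
  intro j
  obtain ⟨G, p, q, h, hG, hp, hq, hh, H⟩ := hF j
  exact ⟨G, 0, 0, 0, hG, contDiff_const, contDiff_const, contDiff_const,
    fun z => ⟨(H z).1, by simp, by simp, by simp⟩⟩

theorem deg_one_mem {D : ℤ × ℤ} {F : Form} (hF : F ∈ formsOn D) :
    ((0, F.2.1, F.2.2.1, 0) : Form) ∈ formsOn D := by
  intro j
  obtain ⟨G, p, q, h, hG, hp, hq, hh, H⟩ := hF j
  exact ⟨0, p, q, 0, contDiff_const, hp, hq, contDiff_const,
    fun z => ⟨by simp, (H z).2.1, (H z).2.2.1, by simp⟩⟩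

theorem deg_two_mem {D : ℤ × ℤ} {F : Form} (hF : F ∈ formsOn D) :
    ((0, 0, 0, F.2.2.2) : Form) ∈ formsOn D := by
  intro j
  obtain ⟨G, p, q, h, hG, hp, hq, hh, H⟩ := hF j
  exact ⟨0, 0, 0, h, contDiff_const, contDiff_const, contDiff_const, hh,
    fun z => ⟨by simp, by simp, by simp, (H z).2.2.2⟩⟩

theorem isInternal_vGr (L L' : ℤ × ℤ) : DirectSum.IsInternal (vGr L L') := by
  rw [DirectSum.isInternal_submodule_iff_iSupIndep_and_iSup_eq_top]
  constructor
  · intro d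
    -- `N` consists of the forms without component in degree d. It contains all the other graded
    -- pieces and meets the piece of degree d only in 0.
    let N : Submodule ℂ (VHom L L') :=
      { carrier := {F | (d = 0 → F.1.1 = 0) ∧ (d = 1 → F.1.2.1 = 0 ∧ F.1.2.2.1 = 0) ∧
          (d = 2 → F.1.2.2.2 = 0)}
        zero_mem' := by simp
        add_mem' := by
          rintro F K ⟨a1, a2, a3⟩ ⟨b1, b2, b3⟩
          exact ⟨fun h => by simp [a1 h, b1 h], fun h => by simp [a2 h, b2 h],
            fun h => by simp [a3 h, b3 h]⟩
        smul_mem' := by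
          rintro k F ⟨a1, a2, a3⟩
          exact ⟨fun h => by simp [a1 h], fun h => by simp [a2 h], fun h => by simp [a3 h]⟩ }
    have hN : (⨆ j, ⨆ (_ : j ≠ d), vGr L L' j) ≤ N := by
      refine iSup₂_le fun j hj F hF => ?_
      obtain ⟨a1, a2, a3⟩ := hF
      exact ⟨fun h => a1 (h ▸ hj), fun h => a2 (h ▸ hj), fun h => a3 (h ▸ hj)⟩
    refine Disjoint.mono_right hN ?_
    rw [Submodule.disjoint_def]
    rintro F ⟨a1, a2, a3⟩ ⟨b1, b2, b3⟩
    apply Subtype.ext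
    have c1 : F.1.1 = 0 := by by_cases h : d = 0 <;> simp_all
    have c2 : F.1.2.1 = 0 ∧ F.1.2.2.1 = 0 := by by_cases h : d = 1 <;> simp_all
    have c3 : F.1.2.2.2 = 0 := by by_cases h : d = 2 <;> simp_all
    exact Prod.ext c1 (Prod.ext c2.1 (Prod.ext c2.2 c3))
  · rw [eq_top_iff]
    rintro F -
    have h0 : (⟨_, deg_zero_mem F.2⟩ : VHom L L') ∈ vGr L L' 0 := by simp [vGr]
    have h1 : (⟨_, deg_one_mem F.2⟩ : VHom L L') ∈ vGr L L' 1 := by simp [vGr]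
    have h2 : (⟨_, deg_two_mem F.2⟩ : VHom L L') ∈ vGr L L' 2 := by simp [vGr]
    have e : F = ⟨_, deg_zero_mem F.2⟩ + ⟨_, deg_one_mem F.2⟩ + ⟨_, deg_two_mem F.2⟩ := by
      apply Subtype.ext
      simp
    rw [e]
    exact add_mem (add_mem (Submodule.mem_iSup_of_mem 0 h0) (Submodule.mem_iSup_of_mem 1 h1))
      (Submodule.mem_iSup_of_mem 2 h2)

theorem formMul_signed {L L' : ℤ × ℤ} {n : ℤ} {F : VHom L L'} (hF : F ∈ vGr L L' n)
    (K : Form) : formMul (F.1.1, -F.1.2.1, -F.1.2.2.1, F.1.2.2.2) K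
      = ((Int.negOnePow n : ℤˣ) : ℤ) • formMul F.1 K := by
  obtain ⟨a1, a2, a3⟩ := hF
  have h2 : Int.negOnePow 2 = 1 := Int.negOnePow_even 2 (by decide)
  by_cases h0 : n = 0
  · subst h0
    simp [formMul, a2]
  by_cases h1 : n = 1
  · subst h1
    simp [formMul, a1, a3]
    ring
  by_cases h2' : n = 2
  · subst h2'
    simp [formMul, a1, a2, h2]
  · simp [formMul, a1 h0, a2 h1, a3 h2']

theorem vMul_isLinearMap_left {L1 L2 L3 : ℤ × ℤ} (K : VHom L2 L3) :
    IsLinearMap ℂ fun F => vMul L1 L2 L3 F K := by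
  refine ⟨fun F F' => Subtype.ext ?_, fun c F => Subtype.ext ?_⟩
  · show formMul (F.1 + F'.1) K.1 = formMul F.1 K.1 + formMul F'.1 K.1
    refine Prod.ext ?_ (Prod.ext ?_ (Prod.ext ?_ ?_)) <;> simp [formMul] <;> ring
  · show formMul (c • F.1) K.1 = c • formMul F.1 K.1
    refine Prod.ext ?_ (Prod.ext ?_ (Prod.ext ?_ ?_)) <;> simp [formMul, smul_sub]

theorem vMul_isLinearMap_right {L1 L2 L3 : ℤ × ℤ} (F : VHom L1 L2) :
    IsLinearMap ℂ fun K => vMul L1 L2 L3 F K := by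
  refine ⟨fun K K' => Subtype.ext ?_, fun c K => Subtype.ext ?_⟩
  · show formMul F.1 (K.1 + K'.1) = formMul F.1 K.1 + formMul F.1 K'.1
    refine Prod.ext ?_ (Prod.ext ?_ (Prod.ext ?_ ?_)) <;> simp [formMul] <;> ring
  · show formMul F.1 (c • K.1) = c • formMul F.1 K.1
    refine Prod.ext ?_ (Prod.ext ?_ (Prod.ext ?_ ?_)) <;> simp [formMul, smul_sub]

theorem isAInf_vCat {Ob : Type} (E : Ob → ℤ × ℤ) : (vCat E).IsAInf := by
  refine AInfData.isAInf_of_dg (vCat E) (fun i j => vD (E i) (E j))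
    (fun i j k => vMul (E i) (E j) (E k)) (fun _ => rfl) (fun i j => isInternal_vGr _ _)
    (fun i j => ⟨fun F K => Subtype.ext (formD_add F.2 K.2),
      fun k F => Subtype.ext (formD_smul F.2 k)⟩)
    (fun i j k K => vMul_isLinearMap_left K) (fun i j k F => vMul_isLinearMap_right F) ?_ ?_ ?_ ?_ ?_ ?_ ?_ ?_ ?_
  · rintro i j n F ⟨a1, a2, a3⟩
    have hz (e z : ℂ × ℂ) : dbar e (0 : ℂ × ℂ → ℂ) z = 0 := dbar_holomorphic (by fun_prop) e
    refine ⟨fun _ => rfl, fun h => ?_, fun h => ?_⟩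
    · have := a1 (by omega)
      constructor <;> funext z <;> simp [vD, formD, this, hz]
    · have := a2 (by omega)
      funext z
      simp [vD, formD, this, hz]
  · rintro i j k n l F K ⟨a1, a2, a3⟩ ⟨b1, b2, b3⟩
    refine ⟨fun h => ?_, fun h => ?_, fun h => ?_⟩
    · show F.1.1 * K.1.1 = 0
      by_cases h0 : n = 0
      · rw [b1 (by omega), mul_zero]
      · rw [a1 h0, zero_mul]
    · have e : F.1.1 = 0 ∨ (K.1.2.1 = 0 ∧ K.1.2.2.1 = 0) := by
        by_cases h0 : n = 0
        · exact Or.inr (b2 (by omega))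
        · exact Or.inl (a1 h0)
      have e' : (F.1.2.1 = 0 ∧ F.1.2.2.1 = 0) ∨ K.1.1 = 0 := by
        by_cases h0 : n = 1
        · exact Or.inr (b1 (by omega))
        · exact Or.inl (a2 h0)
      show F.1.1 * K.1.2.1 + F.1.2.1 * K.1.1 = 0 ∧ F.1.1 * K.1.2.2.1 + F.1.2.2.1 * K.1.1 = 0
      rcases e with e | e <;> rcases e' with e' | e' <;> simp [e, e']
    · have e : F.1.1 = 0 ∨ K.1.2.2.2 = 0 := by
        by_cases h0 : n = 0
        · exact Or.inr (b3 (by omega))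
        · exact Or.inl (a1 h0)
      have e' : F.1.2.2.2 = 0 ∨ K.1.1 = 0 := by
        by_cases h0 : n = 2
        · exact Or.inr (b1 (by omega))
        · exact Or.inl (a3 h0)
      have e'' : (F.1.2.1 = 0 ∧ F.1.2.2.1 = 0) ∨ (K.1.2.1 = 0 ∧ K.1.2.2.1 = 0) := by
        by_cases h0 : n = 1
        · exact Or.inr (b2 (by omega))
        · exact Or.inl (a2 h0)
      show F.1.1 * K.1.2.2.2 + F.1.2.2.2 * K.1.1 + F.1.2.1 * K.1.2.2.1 - F.1.2.2.1 * K.1.2.1 = 0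
      rcases e with e | e <;> rcases e' with e' | e' <;> rcases e'' with e'' | e'' <;>
        simp [e, e', e'']
  · intro i j F
    exact Subtype.ext (formD_formD F.2)
  · intro i j k n F K hF
    apply Subtype.ext
    have h := formD_formMul F.2 K.2
    rw [formMul_signed hF] at h
    exact h
  · intro i j k l F K H
    apply Subtype.ext
    show formMul (formMul F.1 K.1) H.1 = formMul F.1 (formMul K.1 H.1)
    refine Prod.ext ?_ (Prod.ext ?_ (Prod.ext ?_ ?_)) <;> simp only [formMul] <;> ring
  · intro i
    exact ⟨fun h => absurd rfl h, fun _ => ⟨rfl, rfl⟩, fun _ => rfl⟩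
  · intro i j F
    apply Subtype.ext
    show formMul (1, 0, 0, 0) F.1 = F.1
    simp [formMul]
  · intro i j F
    apply Subtype.ext
    show formMul F.1 (1, 0, 0, 0) = F.1
    simp [formMul]
  · intro i
    apply Subtype.ext
    have hz (e z : ℂ × ℂ) : dbar e (0 : ℂ × ℂ → ℂ) z = 0 := dbar_holomorphic (by fun_prop) e
    have hz' (e z : ℂ × ℂ) : dbar e (1 : ℂ × ℂ → ℂ) z = 0 :=
      dbar_holomorphic (differentiableAt_const (1 : ℂ)) e
    show formD (E i) (E i) (1, 0, 0, 0) = 0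
    refine Prod.ext rfl (Prod.ext ?_ (Prod.ext ?_ ?_)) <;> funext z <;>
      simp [formD, hz, hz', disp]

/-! ### Charts as a pair of a base chart and a fibre chart -/

/-- The chart over the base chart `ε` and with the fibre coordinate `δ` (or its inverse). -/
def ix : Bool → Bool → Fin 4
  | false, false => 1
  | false, true => 3
  | true, false => 0
  | true, true => 2

/-- The exponent of u in the base coordinate, and of v in the fibre coordinate. -/
def sgn : Bool → ℤ
  | false => 1
  | true => -1

theorem sgn_mul_self (ε : Bool) : (sgn ε : ℂ) * sgn ε = 1 := by cases ε <;> simp [sgn]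

theorem sgn_not (ε : Bool) : sgn (!ε) = -sgn ε := by cases ε <;> simp [sgn]

theorem sgn_ne (ε : Bool) : (sgn ε : ℂ) ≠ 0 := by cases ε <;> simp [sgn]

theorem ix_surjective (j : Fin 4) : ∃ ε δ, ix ε δ = j := by
  fin_cases j
  exacts [⟨true, false, rfl⟩, ⟨false, false, rfl⟩, ⟨true, true, rfl⟩, ⟨false, true, rfl⟩]

theorem chartMat_zero_zero (ε δ : Bool) : chartMat (ix ε δ) 0 0 = sgn ε := by
  cases ε <;> cases δ <;> rfl

theorem chartMat_zero_one (ε δ : Bool) : chartMat (ix ε δ) 0 1 = 0 := by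
  cases ε <;> cases δ <;> rfl

theorem chartMat_one_one (ε δ : Bool) : chartMat (ix ε δ) 1 1 = sgn δ := by
  cases ε <;> cases δ <;> rfl

theorem chart_fst_ne (j : Fin 4) (z : ℂ × ℂ) : (chart j z).1 ≠ 0 := Complex.exp_ne_zero _

theorem chart_snd_ne (j : Fin 4) (z : ℂ × ℂ) : (chart j z).2 ≠ 0 := Complex.exp_ne_zero _

/-- Since the exponential is onto ℂ \ {0} and the exponent matrices are invertible over ℤ, each
chart covers the whole torus. Identities between functions of z thus become identities between
functions of chart coordinates. -/
theorem exists_chart_eq (j : Fin 4) {w₁ w₂ : ℂ} (h₁ : w₁ ≠ 0) (h₂ : w₂ ≠ 0) :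
    ∃ z, chart j z = (w₁, w₂) := by
  have e1 := Complex.exp_log h₁
  have e2 := Complex.exp_log h₂
  fin_cases j
  · exact ⟨(-Complex.log w₁, Complex.log w₂ - Complex.log w₁), by simp [chart, chartMat, e1, e2]⟩
  · exact ⟨(Complex.log w₁, Complex.log w₂), by simp [chart, chartMat, e1, e2]⟩
  · exact ⟨(-Complex.log w₁, -Complex.log w₁ - Complex.log w₂),
      by simp [chart, chartMat, e1, e2]⟩
  · exact ⟨(Complex.log w₁, -Complex.log w₂), by simp [chart, chartMat, e1, e2]⟩

theorem chart_fibre (ε δ : Bool) (z : ℂ × ℂ) :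
    chart (ix ε (!δ)) z = ((chart (ix ε δ) z).1, (chart (ix ε δ) z).2⁻¹) := by
  cases ε <;> cases δ <;> simp [ix, chart, chartMat, ← Complex.exp_neg, add_comm]

/-- The exponent of the base coordinate in the change of the fibre coordinate. -/
def twist : Bool → ℤ
  | false => -1
  | true => 1

theorem chart_base (ε δ : Bool) (z : ℂ × ℂ) :
    chart (ix (!ε) δ) z =
      ((chart (ix ε δ) z).1⁻¹, (chart (ix ε δ) z).2 * (chart (ix ε δ) z).1 ^ twist δ) := by
  cases ε <;> cases δ <;>
    simp [ix, chart, chartMat, twist, ← Complex.exp_neg, ← Complex.exp_add, add_comm]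

theorem frame_fibre (D : ℤ × ℤ) (ε δ : Bool) (z : ℂ × ℂ) :
    frame D (ix ε δ) z = (chart (ix ε δ) z).2 ^ D.2 * frame D (ix ε (!δ)) z := by
  cases ε <;> cases δ <;>
  · simp only [ix, frame, chart, chartMat, transLog, ← Complex.exp_int_mul, ← Complex.exp_add]
    congr 1
    simp <;> ring

/-- The exponent of the base coordinate in the change of frame. -/
def weight (D : ℤ × ℤ) : Bool → ℤ
  | false => D.1 + D.2
  | true => D.1

theorem frame_base (D : ℤ × ℤ) (ε δ : Bool) (z : ℂ × ℂ) :
    frame D (ix ε δ) z = (chart (ix ε δ) z).1 ^ weight D δ * frame D (ix (!ε) δ) z := by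
  cases ε <;> cases δ <;>
  · simp only [ix, frame, chart, chartMat, transLog, weight, ← Complex.exp_int_mul,
      ← Complex.exp_add]
    congr 1
    simp
    ring

/-- The same section is read in two charts, and the ratio of the frames is the transition function.
-/
theorem transition_fibre {D : ℤ × ℤ} {ε : Bool} {F : ℂ × ℂ → ℂ} {G : Bool → ℂ × ℂ → ℂ}
    (h : ∀ δ z, frame D (ix ε δ) z * F z = G δ (chart (ix ε δ) z)) (δ : Bool) {w₁ w₂ : ℂ}
    (h₁ : w₁ ≠ 0) (h₂ : w₂ ≠ 0) : G δ (w₁, w₂) = w₂ ^ D.2 * G (!δ) (w₁, w₂⁻¹) := by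
  obtain ⟨z, hz⟩ := exists_chart_eq (ix ε δ) h₁ h₂
  have e1 := h δ z
  have e2 := h (!δ) z
  rw [chart_fibre, hz] at e2
  rw [frame_fibre, hz, mul_assoc, e2] at e1
  exact e1.symm

theorem transition_base {D : ℤ × ℤ} {δ : Bool} {F : ℂ × ℂ → ℂ} {G : Bool → ℂ × ℂ → ℂ}
    (h : ∀ ε z, frame D (ix ε δ) z * F z = G ε (chart (ix ε δ) z)) (ε : Bool) {w₁ w₂ : ℂ}
    (h₁ : w₁ ≠ 0) (h₂ : w₂ ≠ 0) :
    G ε (w₁, w₂) = w₁ ^ weight D δ * G (!ε) (w₁⁻¹, w₂ * w₁ ^ twist δ) := by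
  obtain ⟨z, hz⟩ := exists_chart_eq (ix ε δ) h₁ h₂
  have e1 := h ε z
  have e2 := h (!ε) z
  rw [chart_base, hz] at e2
  rw [frame_base, hz, mul_assoc, e2] at e1
  exact e1.symm

/-- The second component of the covariant derivative, in a chart. -/
theorem frame_mul_cov_snd {D : ℤ × ℤ} {ε δ : Bool} {F K : ℂ × ℂ → ℂ} (hK : ContDiff ℝ ∞ K)
    (h : ∀ z, frame D (ix ε δ) z * F z = K (chart (ix ε δ) z)) (z : ℂ × ℂ) :
    frame D (ix ε δ) z * (dbar (0, 1) F z + (lagr D (moment z)).2 * F z) =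
      sgn δ * (star (chart (ix ε δ) z).2 * dbar (0, 1) K (chart (ix ε δ) z)) := by
  have := frame_mul_dbar hK h z (0, 1) (by simp) (by simp)
  rw [chartMat_zero_one, chartMat_one_one] at this
  simp only [star_mul', star_intCast, Int.cast_zero, mul_zero, zero_mul, zero_add, add_zero,
    mul_one, star_zero, Complex.one_re, Complex.zero_re, Complex.ofReal_one,
    Complex.ofReal_zero] at this
  rw [this]
  ring

/-- The first component of the covariant derivative, in a chart. -/
theorem frame_mul_cov_fst {D : ℤ × ℤ} {ε δ : Bool} {F K : ℂ × ℂ → ℂ} (hK : ContDiff ℝ ∞ K)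
    (h : ∀ z, frame D (ix ε δ) z * F z = K (chart (ix ε δ) z)) (z : ℂ × ℂ) :
    frame D (ix ε δ) z * (dbar (1, 0) F z + (lagr D (moment z)).1 * F z) =
      sgn ε * (star (chart (ix ε δ) z).1 * dbar (1, 0) K (chart (ix ε δ) z))
        + chartMat (ix ε δ) 1 0
          * (star (chart (ix ε δ) z).2 * dbar (0, 1) K (chart (ix ε δ) z)) := by
  have := frame_mul_dbar hK h z (1, 0) (by simp) (by simp)
  rw [chartMat_zero_zero, chartMat_zero_one, chartMat_one_one] at this
  simp only [star_mul', star_intCast, Int.cast_zero, mul_zero, add_zero,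
    mul_one, Complex.one_re, Complex.zero_re, Complex.ofReal_one,
    Complex.ofReal_zero] at this
  rw [this]
  ring

theorem dense_torus : Dense {p : ℂ × ℂ | p.1 ≠ 0 ∧ p.2 ≠ 0} := by
  refine ((dense_compl_singleton (0 : ℂ)).prod (dense_compl_singleton (0 : ℂ))).mono ?_
  rintro p ⟨h, h'⟩
  exact ⟨h, h'⟩

theorem eq_of_eq_on_charts {j : Fin 4} {K K' : ℂ × ℂ → ℂ} (hK : Continuous K)
    (hK' : Continuous K') (h : ∀ z, K (chart j z) = K' (chart j z)) (p : ℂ × ℂ) : K p = K' p := by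
  refine congrFun (hK.ext_on dense_torus hK' ?_) p
  rintro ⟨w₁, w₂⟩ ⟨h₁, h₂⟩
  obtain ⟨z, hz⟩ := exists_chart_eq j h₁ h₂
  rw [← hz]
  exact h z

theorem contDiff_star_fst : ContDiff ℝ ∞ (fun w : ℂ × ℂ => star w.1) :=
  Complex.conjCLE.contDiff.comp contDiff_fst

theorem contDiffAt_zpow_fst (n : ℤ) {p : ℂ × ℂ} (hp : p.1 ≠ 0) :
    ContDiffAt ℝ ∞ (fun p : ℂ × ℂ => p.1 ^ n) p := by
  cases n with
  | ofNat k => simpa using contDiffAt_fst.pow k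
  | negSucc k =>
    simp only [zpow_negSucc]
    exact (contDiffAt_fst.pow (k + 1)).inv (pow_ne_zero _ hp)

/-- A section over a base chart, multiplied by a function with compact support on the base chart,
extends by zero. -/
theorem exists_cutoff_section (D : ℤ × ℤ) (ε : Bool) {κ : ℂ → ℂ} (hκ : ContDiff ℝ ∞ κ) {R : ℝ}
    (hR : 0 < R) (h0 : ∀ w, R < ‖w‖ → κ w = 0) {f : Bool → ℂ × ℂ → ℂ}
    (hf : ∀ δ, ContDiff ℝ ∞ (f δ))
    (h : ∀ w₁ w₂, w₁ ≠ 0 → w₂ ≠ 0 → f false (w₁, w₂) = w₂ ^ D.2 * f true (w₁, w₂⁻¹)) :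
    ∃ F : ℂ × ℂ → ℂ,
      (∀ δ z, frame D (ix ε δ) z * F z
        = κ (chart (ix ε δ) z).1 * f δ (chart (ix ε δ) z)) ∧
      ∀ (m : ℕ) (δ : Bool), ∃ Ψ : ℂ × ℂ → ℂ, ContDiff ℝ ∞ Ψ ∧
        ∀ z, frame D (ix (!ε) δ) z * F z
          = star (chart (ix (!ε) δ) z).1 ^ m * Ψ (chart (ix (!ε) δ) z) := by
  let F : ℂ × ℂ → ℂ := fun z => (frame D (ix ε false) z)⁻¹
    * (κ (chart (ix ε false) z).1 * f false (chart (ix ε false) z))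
  have hF : ∀ δ z, frame D (ix ε δ) z * F z
      = κ (chart (ix ε δ) z).1 * f δ (chart (ix ε δ) z) := by
    intro δ z
    have hne := frame_ne D (ix ε false) z
    have e1 : frame D (ix ε false) z * F z
        = κ (chart (ix ε false) z).1 * f false (chart (ix ε false) z) :=
      mul_inv_cancel_left₀ hne _
    cases δ
    · exact e1
    · have e2 := frame_fibre D ε false z
      have e3 := chart_fibre ε false z
      have e4 := h _ _ (chart_fst_ne (ix ε false) z) (chart_snd_ne (ix ε false) z)
      rw [Bool.not_false] at e2 e3
      rw [e3]
      have hw : (chart (ix ε false) z).2 ^ D.2 ≠ 0 := zpow_ne_zero _ (chart_snd_ne _ _)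
      apply mul_left_cancel₀ hw
      rw [← mul_assoc, ← e2, e1]
      rw [show f false (chart (ix ε false) z) = _ from e4]
      ring
  refine ⟨F, hF, fun m δ => ?_⟩
  -- Division by w̄^m is harmless, because the cut-off vanishes near w = 0 in the opposite base
  -- chart. The choice m = 0 serves for functions, m = 1 for the coefficient of dw̄₁.
  have hΦ : ∀ p : ℂ × ℂ, p.1 ≠ 0 → ContDiffAt ℝ ∞ (fun p : ℂ × ℂ => (star p.1 ^ m)⁻¹
      * (p.1 ^ weight D δ * f δ (p.1⁻¹, p.2 * p.1 ^ twist δ))) p := by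
    intro p hp
    have hs : star p.1 ≠ 0 := star_ne_zero.2 hp
    refine ((contDiff_star_fst.pow m).contDiffAt.inv (pow_ne_zero m hs)).mul
      ((contDiffAt_zpow_fst _ hp).mul ((hf δ).contDiffAt.comp p ?_))
    exact (contDiffAt_fst.inv hp).prodMk (contDiffAt_snd.mul (contDiffAt_zpow_fst _ hp))
  obtain ⟨Ψ, hΨ, hΨ'⟩ := exists_extension_by_zero hκ hR h0 hΦ
  refine ⟨Ψ, hΨ, fun z => ?_⟩
  rw [hΨ' _ (chart_fst_ne _ _), frame_base, mul_assoc, Bool.not_not, hF δ z]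
  have e := chart_base (!ε) δ z
  rw [Bool.not_not] at e
  rw [e]
  have hs : star (chart (ix (!ε) δ) z).1 ^ m ≠ 0 :=
    pow_ne_zero m (star_ne_zero.2 (chart_fst_ne _ _))
  field_simp

/-- Fibrewise solution of the `∂̄`-equation for sections over the base charts, cut off along the
base. -/
theorem exists_fibre_solution {D : ℤ × ℤ} {n : ℕ} (hn : D.2 + 1 = n) (ε : Bool) {κ : ℂ → ℂ}
    (hκ : ContDiff ℝ ∞ κ) {R : ℝ} (hR : 0 < R) (h0 : ∀ w, R < ‖w‖ → κ w = 0)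
    {q : Bool → ℂ × ℂ → ℂ} (hq : ∀ δ, ContDiff ℝ ∞ (q δ))
    (h : ∀ δ w₁ w₂, w₁ ≠ 0 → w₂ ≠ 0 →
      star w₂ ^ 2 * q δ (w₁, w₂) = -(w₂ ^ D.2 * q (!δ) (w₁, w₂⁻¹))) :
    ∃ (F : ℂ × ℂ → ℂ) (f : Bool → ℂ × ℂ → ℂ), (∀ δ, ContDiff ℝ ∞ (f δ)) ∧
      (∀ δ z, frame D (ix ε δ) z * F z
        = κ (chart (ix ε δ) z).1 * f δ (chart (ix ε δ) z)) ∧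
      (∀ (m : ℕ) (δ : Bool), ∃ Ψ : ℂ × ℂ → ℂ, ContDiff ℝ ∞ Ψ ∧
        ∀ z, frame D (ix (!ε) δ) z * F z
          = star (chart (ix (!ε) δ) z).1 ^ m * Ψ (chart (ix (!ε) δ) z)) ∧
      ∀ z, frame D (ix ε false) z * (dbar (0, 1) F z + (lagr D (moment z)).2 * F z) =
        star (chart (ix ε false) z).2
          * (κ (chart (ix ε false) z).1 * q false (chart (ix ε false) z)) := by
  -- The transition rule is multiplied by w, so that the exponent D.2 becomes the natural number n =
  -- D.2 + 1, and is extended to x = 0 by continuity.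
  have hrel : ∀ δ x w, w ≠ 0 → w * star w ^ 2 * q δ (x, w) = -(w ^ n * q (!δ) (x, w⁻¹)) := by
    intro δ x w hw
    have c1 : Continuous fun x : ℂ => w * star w ^ 2 * q δ (x, w) :=
      continuous_const.mul ((hq δ).continuous.comp (by fun_prop))
    have c2 : Continuous fun x : ℂ => -(w ^ n * q (!δ) (x, w⁻¹)) :=
      (continuous_const.mul ((hq _).continuous.comp (by fun_prop))).neg
    refine congrFun (c1.ext_on (dense_compl_singleton (0 : ℂ)) c2 fun x hx => ?_) x
    have e := h δ x w hx hw
    have e2 : w ^ n = w * w ^ D.2 := by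
      rw [← zpow_natCast, ← hn, zpow_add_one₀ hw, mul_comm]
    simp only [mul_assoc, e, e2]
    ring
  obtain ⟨f, hf, df, rf⟩ := exists_dbar_snd n hq hrel
  obtain ⟨F, hF, hF'⟩ := exists_cutoff_section D ε hκ hR h0 hf fun w₁ w₂ _ h₂ => by
    have := rf false w₁ w₂ h₂
    rw [← zpow_natCast, ← hn, zpow_add_one₀ h₂] at this
    apply mul_left_cancel₀ h₂
    rw [this, Bool.not_false]
    ring
  refine ⟨F, f, hf, hF, hF', fun z => ?_⟩
  have hκ' : ContDiff ℝ ∞ fun p : ℂ × ℂ => κ p.1 := hκ.comp contDiff_fst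
  rw [frame_mul_cov_snd (K := fun p => κ p.1 * f false p) (hκ'.mul (hf false)) (hF false)]
  have d1 : DifferentiableAt ℝ (fun p : ℂ × ℂ => κ p.1) (chart (ix ε false) z) :=
    hκ'.differentiable (by simp) _
  have e1 : dbar (0, 1) (fun p : ℂ × ℂ => κ p.1) (chart (ix ε false) z) = 0 := by
    have h1 : HasFDerivAt (fun p : ℂ × ℂ => κ p.1) _ (chart (ix ε false) z) :=
      ((hκ.differentiable (by simp) _).hasFDerivAt).comp _ hasFDerivAt_fst
    unfold dbar
    rw [h1.fderiv]
    simp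
  rw [dbar_mul d1 ((hf false).differentiable (by simp) _), e1, df]
  simp [sgn]

/-! ### Dolbeault cohomology -/

theorem sgn_ne_zero (ε : Bool) : sgn ε ≠ 0 := by cases ε <;> simp [sgn]

theorem dbar_zero (e z : ℂ × ℂ) : dbar e (0 : ℂ × ℂ → ℂ) z = 0 :=
  dbar_holomorphic (differentiableAt_const (0 : ℂ)) e

theorem chart_base_fst (ε δ δ' : Bool) (z : ℂ × ℂ) :
    (chart (ix (!ε) δ) z).1 = (chart (ix ε δ') z).1⁻¹ := by
  cases ε <;> cases δ <;> cases δ' <;> simp [ix, chart, chartMat, ← Complex.exp_neg]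

/-- `(0, 2)`-forms are exact. -/
theorem exists_primitive_deg_two {L L' : ℤ × ℤ} {n : ℕ} (hn : (L' - L).2 + 1 = n)
    {H : ℂ × ℂ → ℂ} (hH : ((0, 0, 0, H) : Form) ∈ formsOn (L' - L)) :
    ∃ F : Form, F ∈ formsOn (L' - L) ∧ formD L L' F = (0, 0, 0, H) := by
  set D := L' - L with hD
  obtain ⟨ρ, hρ, hρ0, hρ1⟩ := exists_cutoffs
  choose G p q h hG hp hq hh hF using hH
  have hh' (ε δ : Bool) (z : ℂ × ℂ) : frame D (ix ε δ) z * H z = sgn ε * sgn δ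
      * (star (chart (ix ε δ) z).1 * star (chart (ix ε δ) z).2
        * h (ix ε δ) (chart (ix ε δ) z)) := by
    have := (hF (ix ε δ) z).2.2.2
    rw [chartMat_zero_zero, chartMat_zero_one, chartMat_one_one] at this
    simpa using this
  -- The factor w̄ is part of the cut-off because a multiple of dz̄₁ is a smooth multiple of dw̄₁
  -- only if its coefficient is divisible by w̄₁.
  have hκ (ε : Bool) : ContDiff ℝ ∞ fun w : ℂ => ρ ε w * star w :=
    (hρ ε).mul Complex.conjCLE.contDiff
  choose F f hf hF1 hF2 hF3 using fun ε : Bool => exists_fibre_solution hn ε (hκ ε) two_pos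
    (fun w hw => by simp [hρ0 ε w hw]) (fun δ => hh (ix ε δ)) (fun δ w₁ w₂ h₁ h₂ => by
      have := transition_fibre (D := D) (ε := ε) (F := H)
        (G := fun δ w => sgn ε * sgn δ * (star w.1 * star w.2 * h (ix ε δ) w))
        (fun δ z => hh' ε δ z) δ h₁ h₂
      have s₁ : star w₁ ≠ 0 := star_ne_zero.2 h₁
      have s₂ : star w₂ ≠ 0 := star_ne_zero.2 h₂
      have e1 := sgn_ne ε
      have e2 := sgn_ne δ
      simp only [sgn_not, star_inv₀, Int.cast_neg] at this
      field_simp at this ⊢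
      linear_combination this)
  -- The signs come from two places: a form K dz̄₁ enters the differential with minus its derivative
  -- along z̄₂, and `F ε` solves the equation with right-hand side sgn(ε) ρ H.
  let K : ℂ × ℂ → ℂ := fun z => -F false z + F true z
  have hK (ε δ : Bool) : ∃ Ψ : ℂ × ℂ → ℂ, ContDiff ℝ ∞ Ψ ∧ ∀ z, frame D (ix ε δ) z * K z
      = sgn ε * (star (chart (ix ε δ) z).1 * Ψ (chart (ix ε δ) z)) := by
    obtain ⟨Ψ, hΨ, hΨ'⟩ := hF2 (!ε) 1 δ
    rw [Bool.not_not] at hΨ'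
    have hr : ContDiff ℝ ∞ fun w : ℂ × ℂ => ρ ε w.1 := (hρ ε).comp contDiff_fst
    refine ⟨fun w => Ψ w - ρ ε w.1 * f ε δ w, hΨ.sub (hr.mul (hf ε δ)), fun z => ?_⟩
    have e1 := hΨ' z
    have e2 := hF1 ε δ z
    rw [pow_one] at e1
    cases ε
    · simp only [K, sgn, Bool.not_false] at e1 ⊢
      push_cast
      linear_combination e1 - e2
    · simp only [K, sgn, Bool.not_true] at e1 ⊢
      push_cast
      linear_combination e2 - e1
  have hmem : ((0, K, 0, 0) : Form) ∈ formsOn D := by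
    intro j
    obtain ⟨ε, δ, rfl⟩ := ix_surjective j
    obtain ⟨Ψ, hΨ, hΨ'⟩ := hK ε δ
    refine ⟨0, Ψ, 0, 0, contDiff_const, hΨ, contDiff_const, contDiff_const, fun z => ?_⟩
    rw [chartMat_zero_zero, chartMat_zero_one]
    exact ⟨by simp, by simpa using hΨ' z, by simp, by simp⟩
  refine ⟨(0, K, 0, 0), hmem, ?_⟩
  have hFd (ε : Bool) : Differentiable ℝ (F ε) := by
    have hr : ContDiff ℝ ∞ fun w : ℂ × ℂ => ρ ε w.1 * star w.1 :=
      (hκ ε).comp contDiff_fst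
    exact differentiable_of_frame (K := fun w => (ρ ε w.1 * star w.1) * f ε false w)
      (hr.mul (hf ε false)) (hF1 ε false)
  refine Prod.ext rfl (Prod.ext ?_ (Prod.ext ?_ ?_)) <;> funext z
  · simp [formD, dbar_zero]
  · simp [formD, dbar_zero]
  · have d1 : dbar (0, 1) K z = -dbar (0, 1) (F false) z + dbar (0, 1) (F true) z := by
      have h1 : K = fun z => (-1 : ℂ) * F false z + F true z := by funext z; simp [K]
      rw [h1, dbar_add ((hFd false z).const_mul _) (hFd true z), dbar_const_mul (hFd false z)]
      ring
    have key (ε : Bool) : dbar (0, 1) (F ε) z + (lagr D (moment z)).2 * F ε z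
        = sgn ε * (ρ ε (chart (ix ε false) z).1 * H z) := by
      apply mul_left_cancel₀ (frame_ne D (ix ε false) z)
      rw [hF3 ε z]
      have := hh' ε false z
      have e2 := sgn_mul_self ε
      rw [show (sgn false : ℂ) = 1 by simp [sgn]] at this
      linear_combination (-ρ ε (chart (ix ε false) z).1 * sgn ε) * this
        - ρ ε (chart (ix ε false) z).1 * star (chart (ix ε false) z).1
          * star (chart (ix ε false) z).2 * h (ix ε false) (chart (ix ε false) z) * e2
    have k0 := key false
    have k1 := key true
    have e := hρ1 false _ (chart_fst_ne (ix false false) z)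
    have e' := chart_base_fst false false false z
    rw [Bool.not_false] at e e'
    rw [← e'] at e
    simp only [formD, disp_eq, d1, ← hD, dbar_zero, K]
    simp only [sgn] at k0 k1
    push_cast at k0 k1
    simp only [Pi.zero_apply]
    linear_combination k0 - k1 + H z * e

/-- A closed `(0, 1)`-form is cohomologous to one without vertical component. -/
theorem exists_sub_vertical {L L' : ℤ × ℤ} {n : ℕ} (hn : (L' - L).2 + 1 = n)
    {F₁ F₂ : ℂ × ℂ → ℂ} (hF : ((0, F₁, F₂, 0) : Form) ∈ formsOn (L' - L)) :
    ∃ g : ℂ × ℂ → ℂ, ((g, 0, 0, 0) : Form) ∈ formsOn (L' - L) ∧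
      (formD L L' (g, 0, 0, 0)).2.2.1 = F₂ := by
  set D := L' - L with hD
  obtain ⟨ρ, hρ, hρ0, hρ1⟩ := exists_cutoffs
  choose G p q h hG hp hq hh hF using hF
  have hq' (ε δ : Bool) (z : ℂ × ℂ) : frame D (ix ε δ) z * F₂ z = sgn δ
      * (star (chart (ix ε δ) z).2 * q (ix ε δ) (chart (ix ε δ) z)) := by
    have := (hF (ix ε δ) z).2.2.1
    rw [chartMat_zero_one, chartMat_one_one] at this
    simpa using this
  choose F f hf hF1 hF2 hF3 using fun ε : Bool => exists_fibre_solution hn ε (hρ ε) two_pos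
    (hρ0 ε) (fun δ => hq (ix ε δ)) (fun δ w₁ w₂ h₁ h₂ => by
      have := transition_fibre (D := D) (ε := ε) (F := F₂)
        (G := fun δ w => sgn δ * (star w.2 * q (ix ε δ) w))
        (fun δ z => hq' ε δ z) δ h₁ h₂
      have s₂ : star w₂ ≠ 0 := star_ne_zero.2 h₂
      have e2 := sgn_ne δ
      simp only [sgn_not, star_inv₀, Int.cast_neg] at this
      field_simp at this ⊢
      linear_combination this)
  let K : ℂ × ℂ → ℂ := fun z => F false z + F true z
  have hK (ε δ : Bool) : ∃ Ψ : ℂ × ℂ → ℂ, ContDiff ℝ ∞ Ψ ∧ ∀ z, frame D (ix ε δ) z * K z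
      = Ψ (chart (ix ε δ) z) := by
    obtain ⟨Ψ, hΨ, hΨ'⟩ := hF2 (!ε) 0 δ
    rw [Bool.not_not] at hΨ'
    have hr : ContDiff ℝ ∞ fun w : ℂ × ℂ => ρ ε w.1 := (hρ ε).comp contDiff_fst
    refine ⟨fun w => Ψ w + ρ ε w.1 * f ε δ w, hΨ.add (hr.mul (hf ε δ)), fun z => ?_⟩
    have e1 := hΨ' z
    have e2 := hF1 ε δ z
    rw [pow_zero, one_mul] at e1
    cases ε
    · simp only [K, Bool.not_false] at e1 ⊢
      linear_combination e1 + e2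
    · simp only [K, Bool.not_true] at e1 ⊢
      linear_combination e2 + e1
  refine ⟨K, ?_, ?_⟩
  · intro j
    obtain ⟨ε, δ, rfl⟩ := ix_surjective j
    obtain ⟨Ψ, hΨ, hΨ'⟩ := hK ε δ
    exact ⟨Ψ, 0, 0, 0, hΨ, contDiff_const, contDiff_const, contDiff_const, fun z =>
      ⟨hΨ' z, by simp, by simp, by simp⟩⟩
  have hFd (ε : Bool) : Differentiable ℝ (F ε) := by
    have hr : ContDiff ℝ ∞ fun w : ℂ × ℂ => ρ ε w.1 := (hρ ε).comp contDiff_fst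
    exact differentiable_of_frame (K := fun w => ρ ε w.1 * f ε false w)
      (hr.mul (hf ε false)) (hF1 ε false)
  funext z
  have key (ε : Bool) : dbar (0, 1) (F ε) z + (lagr D (moment z)).2 * F ε z
      = ρ ε (chart (ix ε false) z).1 * F₂ z := by
    apply mul_left_cancel₀ (frame_ne D (ix ε false) z)
    rw [hF3 ε z]
    have := hq' ε false z
    rw [show (sgn false : ℂ) = 1 by simp [sgn]] at this
    linear_combination (-ρ ε (chart (ix ε false) z).1) * this
  have k0 := key false
  have k1 := key true
  have e := hρ1 false _ (chart_fst_ne (ix false false) z)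
  have e' := chart_base_fst false false false z
  rw [Bool.not_false] at e e'
  rw [← e'] at e
  have d1 : dbar (0, 1) K z = dbar (0, 1) (F false) z + dbar (0, 1) (F true) z :=
    dbar_add (hFd false z) (hFd true z) _
  simp only [formD, disp_eq, d1, ← hD, K]
  linear_combination k0 + k1 + F₂ z * e

/-! ### Reduction from the surface to the base. -/

/-- This is the Cauchy–Riemann criterion in the second variable. -/
theorem differentiable_of_dbar_eq_zero {f : ℂ × ℂ → ℂ} (hf : ContDiff ℝ ∞ f)
    (h : ∀ p, dbar (0, 1) f p = 0) (x : ℂ) : Differentiable ℂ fun w => f (x, w) := by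
  intro w
  have h1 : HasFDerivAt (fun w : ℂ => (x, w)) (ContinuousLinearMap.inr ℝ ℂ ℂ) w :=
    hasFDerivAt_prodMk_right x w
  have h2 : HasFDerivAt (fun w => f (x, w)) _ w :=
    (hf.differentiable (by simp) (x, w)).hasFDerivAt.comp w h1
  rw [differentiableAt_complex_iff_differentiableAt_real]
  refine ⟨h2.differentiableAt, ?_⟩
  rw [h2.fderiv]
  have := h (x, w)
  unfold dbar at this
  simp only [ContinuousLinearMap.comp_apply, ContinuousLinearMap.inr_apply]
  simp only [Prod.smul_mk, mul_zero, smul_eq_mul, mul_one] at this ⊢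
  linear_combination (-Complex.I) * this + (fderiv ℝ f (x, w)) (0, Complex.I) * Complex.I_sq

/-- Fibrewise holomorphic sections are polynomial along the fibres. -/
theorem fibre_polynomial {D : ℤ × ℤ} {f : Bool → ℂ × ℂ → ℂ} (hf : ∀ δ, ContDiff ℝ ∞ (f δ))
    (hd : ∀ p, dbar (0, 1) (f false) p = 0)
    (h : ∀ w₁ w₂, w₁ ≠ 0 → w₂ ≠ 0 → f false (w₁, w₂) = w₂ ^ D.2 * f true (w₁, w₂⁻¹)) :
    (D.2 = -1 → ∀ p, f false p = 0) ∧ (D.2 = 0 → ∀ p, f false p = f false (p.1, 0)) ∧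
      (D.2 = 1 → ∀ p, f false p = f false (p.1, 0) + f true (p.1, 0) * p.2) := by
  have hh (n : ℕ) (hn : D.2 + 1 = n) (x w : ℂ) (hw : w ≠ 0) :
      w * f false (x, w) = w ^ n * f true (x, w⁻¹) := by
    have c1 : Continuous fun x : ℂ => w * f false (x, w) :=
      continuous_const.mul ((hf _).continuous.comp (by fun_prop))
    have c2 : Continuous fun x : ℂ => w ^ n * f true (x, w⁻¹) :=
      continuous_const.mul ((hf _).continuous.comp (by fun_prop))
    refine congrFun (c1.ext_on (dense_compl_singleton (0 : ℂ)) c2 fun x hx => ?_) x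
    simp only
    rw [h x w hx hw, ← zpow_natCast, ← hn, zpow_add_one₀ hw]
    ring
  have hp (n : ℕ) (hn : D.2 + 1 = n) (x : ℂ) := exists_eq_sum_pow n
    (differentiable_of_dbar_eq_zero (hf false) hd x) (g := fun w => f true (x, w))
    ((hf true).continuous.comp (by fun_prop)).continuousAt fun w hw => hh n hn x w hw
  refine ⟨fun hb p => ?_, fun hb p => ?_, fun hb p => ?_⟩
  · obtain ⟨a, ha⟩ := hp 0 (by simp [hb]) p.1
    simpa using ha p.2
  · obtain ⟨a, ha⟩ := hp 1 (by simp [hb]) p.1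
    have h0 := ha 0
    have h1 := ha p.2
    simp only [Finset.range_one, Finset.sum_singleton, pow_zero, mul_one] at h0 h1
    rw [h0]
    exact h1
  · obtain ⟨a, ha⟩ := hp 2 (by simp [hb]) p.1
    simp only [Finset.sum_range_succ, Finset.range_zero, Finset.sum_empty, pow_zero, mul_one,
      zero_add, pow_one] at ha
    have h0 := ha 0
    rw [mul_zero, add_zero] at h0
    have h1 : f true (p.1, 0) = a 1 := by
      have c1 : Continuous fun w : ℂ => f true (p.1, w) := (hf _).continuous.comp (by fun_prop)
      have c2 : Continuous fun w : ℂ => a 0 * w + a 1 := by fun_prop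
      have := congrFun (c1.ext_on (dense_compl_singleton (0 : ℂ)) c2 fun w hw => ?_) 0
      · simpa using this
      · have hw0 : w ≠ 0 := hw
        have e := hh 2 (by simp [hb]) p.1 w⁻¹ (inv_ne_zero hw0)
        rw [ha, inv_inv] at e
        field_simp at e
        linear_combination -e
    rw [h0, h1]
    exact ha p.2

/-- Sections of the form `C(w₁) w₂ᵏ`. -/
theorem exists_monomial_section {D : ℤ × ℤ} {k l n : ℕ} (hb : D.2 = k + l) (hn : D.1 + l + 1 = n)
    {C : Bool → ℂ → ℂ} (h : ∀ ε w, w ≠ 0 → w * C ε w = w ^ n * C (!ε) w⁻¹) :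
    ∃ F : ℂ × ℂ → ℂ, ∀ ε δ z, frame D (ix ε δ) z * F z
      = C ε (chart (ix ε δ) z).1 * (chart (ix ε δ) z).2 ^ (if δ then l else k) := by
  let F : ℂ × ℂ → ℂ := fun z => (frame D (ix false false) z)⁻¹
    * (C false (chart (ix false false) z).1 * (chart (ix false false) z).2 ^ k)
  have hF : ∀ z, frame D (ix false false) z * F z
      = C false (chart (ix false false) z).1 * (chart (ix false false) z).2 ^ k :=
    fun z => mul_inv_cancel_left₀ (frame_ne D (ix false false) z) _
  have hF' : ∀ z, frame D (ix true false) z * F z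
      = C true (chart (ix true false) z).1 * (chart (ix true false) z).2 ^ k := by
    intro z
    have e1 := hF z
    have hb' := chart_base false false z
    have h1 := chart_fst_ne (ix false false) z
    rw [frame_base, mul_assoc] at e1
    rw [Bool.not_false] at hb' e1
    rw [hb']
    generalize chart (ix false false) z = w at *
    have hw : w.1 ^ weight D false ≠ 0 := zpow_ne_zero _ h1
    apply mul_left_cancel₀ hw
    rw [e1]
    have e2 := h false w.1 h1
    rw [Bool.not_false] at e2
    have e3 : w.1 ^ weight D false = w.1 ^ n * (w.1)⁻¹ * w.1 ^ k := by
      rw [← zpow_natCast, ← zpow_natCast, ← hn, ← zpow_neg_one, ← zpow_add₀ h1, ← zpow_add₀ h1]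
      congr 1
      simp only [weight, hb]
      ring
    have e4 : C false w.1 = w.1⁻¹ * (w.1 ^ n * C true w.1⁻¹) := by
      rw [← e2, inv_mul_cancel_left₀ h1]
    rw [e3, e4]
    simp only [twist, zpow_neg_one, mul_pow, inv_pow]
    field_simp
  refine ⟨F, fun ε δ z => ?_⟩
  have base : ∀ ε z, frame D (ix ε false) z * F z
      = C ε (chart (ix ε false) z).1 * (chart (ix ε false) z).2 ^ k := by
    intro ε z
    cases ε
    exacts [hF z, hF' z]
  cases δ
  · simpa using base ε z
  · have e1 := base ε z
    have hb' := chart_fibre ε false z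
    have h1 := chart_snd_ne (ix ε false) z
    rw [frame_fibre, mul_assoc] at e1
    rw [Bool.not_false] at hb' e1
    rw [hb']
    generalize chart (ix ε false) z = w at *
    have hw : w.2 ^ D.2 ≠ 0 := zpow_ne_zero _ h1
    apply mul_left_cancel₀ hw
    rw [e1, hb, zpow_add₀ h1, zpow_natCast, zpow_natCast]
    simp only [if_true, inv_pow]
    field_simp

/-- The fibrewise result is reused with a dummy first variable, evaluated at 0. -/
theorem exists_base_solution (n : ℕ) {c : Bool → ℂ → ℂ} (hc : ∀ ε, ContDiff ℝ ∞ (c ε))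
    (h : ∀ ε w, w ≠ 0 → w * star w ^ 2 * c ε w = -(w ^ n * c (!ε) w⁻¹)) :
    ∃ C : Bool → ℂ → ℂ, (∀ ε, ContDiff ℝ ∞ (C ε)) ∧
      (∀ ε (p : ℂ × ℂ), dbar (1, 0) (fun p => C ε p.1) p = c ε p.1) ∧
      (∀ ε (p : ℂ × ℂ), dbar (0, 1) (fun p => C ε p.1) p = 0) ∧
      ∀ ε w, w ≠ 0 → w * C ε w = w ^ n * C (!ε) w⁻¹ := by
  obtain ⟨f, hf, df, rf⟩ := exists_dbar_snd n (q := fun ε p => c ε p.2)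
    (fun ε => (hc ε).comp contDiff_snd) (fun ε x w hw => h ε w hw)
  have hφ (p : ℂ × ℂ) : HasFDerivAt (fun p : ℂ × ℂ => ((0 : ℂ), p.1))
      ((ContinuousLinearMap.inr ℂ ℂ ℂ).comp (ContinuousLinearMap.fst ℂ ℂ ℂ)) p :=
    ((ContinuousLinearMap.inr ℂ ℂ ℂ).comp (ContinuousLinearMap.fst ℂ ℂ ℂ)).hasFDerivAt
  have hd (ε : Bool) (p : ℂ × ℂ) (e : ℂ × ℂ) :=
    dbar_comp_holomorphic (K := f ε) ((hf ε).differentiable (by simp) _) (hφ p) e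
  refine ⟨fun ε w => f ε (0, w), fun ε => (hf ε).comp (by fun_prop), fun ε p => ?_,
    fun ε p => ?_, fun ε w hw => rf ε 0 w hw⟩
  · rw [hd]
    simpa using df ε (0, p.1)
  · rw [hd]
    simp [dbar, Prod.mk_zero_zero]

/-- The ansatz C(w₁) w₂ᵏ is holomorphic along the fibres, so only the equation for C on the base ℙ¹
remains, in degree n - 1 = D.1 + l. -/
theorem exists_monomial_primitive {D : ℤ × ℤ} {k l n : ℕ} (hb : D.2 = k + l)
    (hn : D.1 + l + 1 = n) {c : Bool → ℂ → ℂ} (hc : ∀ ε, ContDiff ℝ ∞ (c ε))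
    (h : ∀ ε w, w ≠ 0 → w * star w ^ 2 * c ε w = -(w ^ n * c (!ε) w⁻¹)) :
    ∃ g : ℂ × ℂ → ℂ, ((g, 0, 0, 0) : Form) ∈ formsOn D ∧
      (∀ z, dbar (0, 1) g z + (lagr D (moment z)).2 * g z = 0) ∧
      ∀ z, frame D (ix false false) z * (dbar (1, 0) g z + (lagr D (moment z)).1 * g z)
        = star (chart (ix false false) z).1 * (c false (chart (ix false false) z).1
          * (chart (ix false false) z).2 ^ k) := by
  obtain ⟨C, hC, d1, d2, rC⟩ := exists_base_solution n hc h
  obtain ⟨F, hF⟩ := exists_monomial_section hb hn rC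
  have hK (ε : Bool) (i : ℕ) : ContDiff ℝ ∞ fun w : ℂ × ℂ => C ε w.1 * w.2 ^ i :=
    ((hC ε).comp contDiff_fst).mul (contDiff_snd.pow i)
  have hCd (ε : Bool) (w : ℂ × ℂ) : DifferentiableAt ℝ (fun w : ℂ × ℂ => C ε w.1) w :=
    (((hC ε).comp contDiff_fst).differentiable (by simp)) w
  have hp (i : ℕ) (w : ℂ × ℂ) : DifferentiableAt ℂ (fun w : ℂ × ℂ => w.2 ^ i) w := by fun_prop
  have dK (e w : ℂ × ℂ) (ε : Bool) (i : ℕ) : dbar e (fun w : ℂ × ℂ => C ε w.1 * w.2 ^ i) w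
      = dbar e (fun w : ℂ × ℂ => C ε w.1) w * w.2 ^ i := by
    rw [dbar_mul (hCd ε w) ((hp i w).restrictScalars ℝ), dbar_holomorphic (hp i w)]
    ring
  refine ⟨F, ?_, fun z => ?_, fun z => ?_⟩
  · intro j
    obtain ⟨ε, δ, rfl⟩ := ix_surjective j
    exact ⟨_, 0, 0, 0, hK ε (if δ then l else k), contDiff_const, contDiff_const, contDiff_const,
      fun z => ⟨hF ε δ z, by simp, by simp, by simp⟩⟩
  · apply mul_left_cancel₀ (frame_ne D (ix false false) z)
    rw [frame_mul_cov_snd (hK false k) (hF false false), dK, d2]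
    simp
  · rw [frame_mul_cov_fst (hK false k) (hF false false), dK, dK, d1, d2]
    simp [sgn]

/-- The line bundles whose higher cohomology vanishes for the reasons used here. -/
def Acyclic (D : ℤ × ℤ) : Prop := D.2 = -1 ∨ (-1 ≤ D.1 ∧ (D.2 = 0 ∨ D.2 = 1))

/-- Closedness makes the coefficient p of dw̄₁ holomorphic along the fibres. Hence p is zero,
constant or affine in the fibre coordinate for b = -1, 0, 1, and each of its coefficients is a
(0,1)-form on the base with values in a bundle of degree at least -1. -/
theorem exists_primitive_horizontal {L L' : ℤ × ℤ} (hA : Acyclic (L' - L)) {K : ℂ × ℂ → ℂ}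
    (hK : ((0, K, 0, 0) : Form) ∈ formsOn (L' - L)) (hc : formD L L' (0, K, 0, 0) = 0) :
    ∃ g : ℂ × ℂ → ℂ, ((g, 0, 0, 0) : Form) ∈ formsOn (L' - L) ∧
      formD L L' (g, 0, 0, 0) = (0, K, 0, 0) := by
  have hd : ∀ z, dbar (0, 1) K z + (lagr (L' - L) (moment z)).2 * K z = 0 := by
    intro z
    have := congrFun (congrArg (fun F : Form => F.2.2.2) hc) z
    simp only [formD, disp_eq, dbar_zero, Pi.zero_apply, mul_zero, add_zero, zero_sub,
      Prod.snd_zero] at this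
    exact neg_eq_zero.1 this
  suffices ∃ g : ℂ × ℂ → ℂ, ((g, 0, 0, 0) : Form) ∈ formsOn (L' - L) ∧
      (∀ z, dbar (0, 1) g z + (lagr (L' - L) (moment z)).2 * g z = 0) ∧
      ∀ z, frame (L' - L) (ix false false) z
          * (dbar (1, 0) g z + (lagr (L' - L) (moment z)).1 * g z)
        = frame (L' - L) (ix false false) z * K z by
    obtain ⟨g, hg, h2, h1⟩ := this
    refine ⟨g, hg, Prod.ext rfl (Prod.ext ?_ (Prod.ext ?_ ?_))⟩ <;> funext z
    · have := mul_left_cancel₀ (frame_ne _ _ z) (h1 z)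
      simpa [formD, disp_eq] using this
    · simpa [formD, disp_eq] using h2 z
    · simp [formD, dbar_zero]
  generalize L' - L = D at *
  choose G p q h hG hp hq hh hF using hK
  have hp' (ε δ : Bool) (z : ℂ × ℂ) : frame D (ix ε δ) z * K z = sgn ε
      * (star (chart (ix ε δ) z).1 * p (ix ε δ) (chart (ix ε δ) z)) := by
    have e1 := (hF (ix ε δ) z).2.2.1
    have e2 := (hF (ix ε δ) z).2.1
    rw [chartMat_zero_one, chartMat_one_one] at e1
    rw [chartMat_zero_zero] at e2
    simp only [Pi.zero_apply, mul_zero, Int.cast_zero, zero_mul, zero_add] at e1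
    have e3 := (mul_eq_zero.1 e1.symm).resolve_left (sgn_ne δ)
    rw [e3, mul_zero, add_zero] at e2
    exact e2
  have hKc (ε δ : Bool) : ContDiff ℝ ∞ fun w : ℂ × ℂ => sgn ε * (star w.1 * p (ix ε δ) w) :=
    contDiff_const.mul (contDiff_star_fst.mul (hp _))
  have dp (ε δ : Bool) (w : ℂ × ℂ) : dbar (0, 1) (p (ix ε δ)) w = 0 := by
    refine eq_of_eq_on_charts (j := ix ε δ) (contDiff_dbar (hp _) _).continuous
      (continuous_const (y := (0 : ℂ))) (fun z => ?_) w
    have e := frame_mul_cov_snd (hKc ε δ) (hp' ε δ) z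
    have d1 := contDiff_star_fst.differentiable (by simp) (chart (ix ε δ) z)
    have d2 := (hp (ix ε δ)).differentiable (by simp) (chart (ix ε δ) z)
    rw [hd, mul_zero, dbar_const_mul (F := fun w => star w.1 * p (ix ε δ) w) (d1.mul d2),
      dbar_mul d1 d2, dbar_star_fst] at e
    have s1 : star (chart (ix ε δ) z).1 ≠ 0 := star_ne_zero.2 (chart_fst_ne _ _)
    have s2 : star (chart (ix ε δ) z).2 ≠ 0 := star_ne_zero.2 (chart_snd_ne _ _)
    simpa [sgn_ne_zero, chart_fst_ne, chart_snd_ne] using e.symm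
  have tf (w₁ w₂ : ℂ) (h₁ : w₁ ≠ 0) (h₂ : w₂ ≠ 0) :
      p (ix false false) (w₁, w₂) = w₂ ^ D.2 * p (ix false true) (w₁, w₂⁻¹) := by
    have := transition_fibre (D := D) (ε := false) (F := K)
      (G := fun δ w => sgn false * (star w.1 * p (ix false δ) w)) (hp' false) false h₁ h₂
    have s1 : star w₁ ≠ 0 := star_ne_zero.2 h₁
    simp only [sgn, Bool.not_false] at this
    apply mul_left_cancel₀ s1
    push_cast at this
    linear_combination this
  have tb (δ : Bool) (n : ℕ) (hn : weight D δ + 1 = n) (ε : Bool) (w : ℂ) (hw : w ≠ 0) :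
      w * star w ^ 2 * p (ix ε δ) (w, 0) = -(w ^ n * p (ix (!ε) δ) (w⁻¹, 0)) := by
    have c1 : Continuous fun x : ℂ => w * star w ^ 2 * p (ix ε δ) (w, x) :=
      continuous_const.mul ((hp _).continuous.comp (by fun_prop))
    have c2 : Continuous fun x : ℂ => -(w ^ n * p (ix (!ε) δ) (w⁻¹, x * w ^ twist δ)) :=
      (continuous_const.mul ((hp _).continuous.comp (by fun_prop))).neg
    have := congrFun (c1.ext_on (dense_compl_singleton (0 : ℂ)) c2 fun x hx => ?_) 0
    · simpa using this
    have e := transition_base (D := D) (δ := δ) (F := K)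
      (G := fun ε w => sgn ε * (star w.1 * p (ix ε δ) w)) (fun ε z => hp' ε δ z) ε hw hx
    have s1 : star w ≠ 0 := star_ne_zero.2 hw
    have s2 := sgn_ne ε
    simp only [sgn_not, star_inv₀, Int.cast_neg] at e ⊢
    rw [← zpow_natCast w n, ← hn, zpow_add_one₀ hw]
    field_simp at e ⊢
    linear_combination e
  obtain ⟨f1, f2, f3⟩ := fibre_polynomial (D := D) (fun δ => hp (ix false δ)) (dp false false) tf
  have hcc (ε δ : Bool) : ContDiff ℝ ∞ fun w : ℂ => p (ix ε δ) (w, 0) :=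
    (hp _).comp (by fun_prop)
  have hpf (z : ℂ × ℂ) : frame D (ix false false) z * K z
      = star (chart (ix false false) z).1 * p (ix false false) (chart (ix false false) z) := by
    simpa [sgn] using hp' false false z
  rcases hA with hb | ⟨ha, hb | hb⟩
  · refine ⟨0, Submodule.zero_mem (formsOn D), fun z => by simp [dbar_zero], fun z => ?_⟩
    rw [hpf, f1 hb]
    simp [dbar_zero]
  · obtain ⟨n, hn⟩ := Int.eq_ofNat_of_zero_le (show 0 ≤ D.1 + 1 by omega)
    obtain ⟨g, hg, g2, g1⟩ := exists_monomial_primitive (D := D) (k := 0) (l := 0) (n := n)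
      (by simpa using hb) (by simpa using hn) (fun ε => hcc ε false)
      (tb false n (by simpa [weight, hb] using hn))
    refine ⟨g, hg, g2, fun z => ?_⟩
    rw [g1, hpf, f2 hb (chart (ix false false) z)]
    simp
  -- The two coefficients are the restrictions of p to w₂ = 0 and w₂ = ∞. They live in degrees D.1 +
  -- 1 and D.1 on the base, whence the parameters n + 1 and n.
  · obtain ⟨n, hn⟩ := Int.eq_ofNat_of_zero_le (show 0 ≤ D.1 + 1 by omega)
    obtain ⟨g, hg, g2, g1⟩ := exists_monomial_primitive (D := D) (k := 0) (l := 1) (n := n + 1)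
      (by simpa using hb) (by push_cast; omega) (fun ε => hcc ε false)
      (tb false (n + 1) (by simp only [weight, hb]; push_cast; omega))
    obtain ⟨g', hg', g2', g1'⟩ := exists_monomial_primitive (D := D) (k := 1) (l := 0) (n := n)
      (by simpa using hb) (by simpa using hn) (fun ε => hcc ε true)
      (tb true n (by simpa [weight] using hn))
    have dg := (contDiff_of_mem hg).1.differentiable (by simp)
    have dg' := (contDiff_of_mem hg').1.differentiable (by simp)
    have hs (e z : ℂ × ℂ) : dbar e (g + g') z = dbar e g z + dbar e g' z :=
      dbar_add (dg z) (dg' z) e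
    refine ⟨g + g', ?_, fun z => ?_, fun z => ?_⟩
    · have := Submodule.add_mem _ hg hg'
      simpa using this
    · rw [hs, Pi.add_apply]
      linear_combination g2 z + g2' z
    · rw [hs, Pi.add_apply, hpf, f3 hb (chart (ix false false) z)]
      linear_combination g1 z + g1' z

/-- Closed `(0, 1)`-forms are exact. -/
theorem exists_primitive_deg_one {L L' : ℤ × ℤ} (hA : Acyclic (L' - L)) {F₁ F₂ : ℂ × ℂ → ℂ}
    (hF : ((0, F₁, F₂, 0) : Form) ∈ formsOn (L' - L)) (hc : formD L L' (0, F₁, F₂, 0) = 0) :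
    ∃ F : Form, F ∈ formsOn (L' - L) ∧ formD L L' F = (0, F₁, F₂, 0) := by
  obtain ⟨n, hn⟩ := Int.eq_ofNat_of_zero_le (show 0 ≤ (L' - L).2 + 1 by
    rcases hA with h | ⟨-, h | h⟩ <;> omega)
  obtain ⟨g, hg, hg2⟩ := exists_sub_vertical hn hF
  have hdg := formD_mem hg
  have e1 : ((0, F₁, F₂, 0) : Form) + (-1 : ℂ) • formD L L' (g, 0, 0, 0)
      = (0, F₁ - (formD L L' (g, 0, 0, 0)).2.1, 0, 0) := by
    refine Prod.ext ?_ (Prod.ext ?_ (Prod.ext ?_ ?_))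
    · simp [formD]
    · simp [sub_eq_add_neg]
    · simp [hg2]
    · funext z
      simp [formD, dbar_zero]
  have hmem := Submodule.add_mem _ hF (Submodule.smul_mem _ (-1 : ℂ) hdg)
  have hcl : formD L L' (((0, F₁, F₂, 0) : Form) + (-1 : ℂ) • formD L L' (g, 0, 0, 0)) = 0 := by
    rw [formD_add hF (Submodule.smul_mem _ (-1 : ℂ) hdg), formD_smul hdg, formD_formD hg, hc]
    simp
  rw [e1] at hmem hcl
  obtain ⟨g', hg', e2⟩ := exists_primitive_horizontal hA hmem hcl
  refine ⟨_, Submodule.add_mem _ hg hg', ?_⟩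
  rw [formD_add hg hg', e2, ← e1]
  module

/-- Holomorphic sections are combinations of monomials. -/
theorem exists_eq_sum_monomials {L L' : ℤ × ℤ} (hA : Acyclic (L' - L)) {F : ℂ × ℂ → ℂ}
    (hF : ((F, 0, 0, 0) : Form) ∈ formsOn (L' - L)) (hc : formD L L' (F, 0, 0, 0) = 0) :
    ∃ A : ℕ → ℕ → ℂ, ∀ z, frame (L' - L) 1 z * F z =
      ∑ k₂ ∈ Finset.range ((L' - L).2 + 1).toNat,
        ∑ k₁ ∈ Finset.range ((L' - L).1 + (L' - L).2 - k₂ + 1).toNat,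
          A k₁ k₂ * (Complex.exp z.1 ^ k₁ * Complex.exp z.2 ^ k₂) := by
  have hd2 : ∀ z, dbar (0, 1) F z + (lagr (L' - L) (moment z)).2 * F z = 0 := by
    intro z
    have := congrFun (congrArg (fun F : Form => F.2.2.1) hc) z
    simpa [formD, disp_eq] using this
  have hd1 : ∀ z, dbar (1, 0) F z + (lagr (L' - L) (moment z)).1 * F z = 0 := by
    intro z
    have := congrFun (congrArg (fun F : Form => F.2.1) hc) z
    simpa [formD, disp_eq] using this
  generalize L' - L = D at *
  choose G p q h hG hp hq hh hF using hF
  have hG' (ε δ : Bool) (z : ℂ × ℂ) : frame D (ix ε δ) z * F z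
      = G (ix ε δ) (chart (ix ε δ) z) := (hF (ix ε δ) z).1
  have d2 (ε δ : Bool) (w : ℂ × ℂ) : dbar (0, 1) (G (ix ε δ)) w = 0 := by
    refine eq_of_eq_on_charts (j := ix ε δ) (contDiff_dbar (hG _) _).continuous
      (continuous_const (y := (0 : ℂ))) (fun z => ?_) w
    have e := frame_mul_cov_snd (hG _) (hG' ε δ) z
    rw [hd2, mul_zero] at e
    simpa [sgn_ne_zero, chart_fst_ne, chart_snd_ne] using e.symm
  have d1 (ε δ : Bool) (w : ℂ × ℂ) : dbar (1, 0) (G (ix ε δ)) w = 0 := by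
    refine eq_of_eq_on_charts (j := ix ε δ) (contDiff_dbar (hG _) _).continuous
      (continuous_const (y := (0 : ℂ))) (fun z => ?_) w
    have e := frame_mul_cov_fst (hG _) (hG' ε δ) z
    rw [hd1, d2, mul_zero] at e
    simpa [sgn_ne_zero, chart_fst_ne, chart_snd_ne] using e.symm
  have tf (w₁ w₂ : ℂ) (h₁ : w₁ ≠ 0) (h₂ : w₂ ≠ 0) :
      G (ix false false) (w₁, w₂) = w₂ ^ D.2 * G (ix false true) (w₁, w₂⁻¹) :=
    transition_fibre (hG' false) false h₁ h₂
  have tb (δ : Bool) (n : ℕ) (hn : weight D δ + 1 = n) (w : ℂ) (hw : w ≠ 0) :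
      w * G (ix false δ) (w, 0) = w ^ n * G (ix true δ) (w⁻¹, 0) := by
    have c1 : Continuous fun x : ℂ => w * G (ix false δ) (w, x) :=
      continuous_const.mul ((hG _).continuous.comp (by fun_prop))
    have c2 : Continuous fun x : ℂ => w ^ n * G (ix true δ) (w⁻¹, x * w ^ twist δ) :=
      continuous_const.mul ((hG _).continuous.comp (by fun_prop))
    have := congrFun (c1.ext_on (dense_compl_singleton (0 : ℂ)) c2 fun x hx => ?_) 0
    · simpa using this
    have e := transition_base (fun ε z => hG' ε δ z) false hw hx
    rw [← zpow_natCast, ← hn, zpow_add_one₀ hw]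
    simp only [e, Bool.not_false]
    ring
  have hol (ε δ : Bool) : Differentiable ℂ fun w : ℂ => G (ix ε δ) (w, 0) := by
    -- The coordinates are exchanged, because the holomorphy criterion concerns the second variable.
    have hφ (p : ℂ × ℂ) : HasFDerivAt (fun p : ℂ × ℂ => (p.2, p.1))
        ((ContinuousLinearMap.snd ℂ ℂ ℂ).prod (ContinuousLinearMap.fst ℂ ℂ ℂ)) p :=
      ((ContinuousLinearMap.snd ℂ ℂ ℂ).prod (ContinuousLinearMap.fst ℂ ℂ ℂ)).hasFDerivAt
    have := differentiable_of_dbar_eq_zero (f := fun p => G (ix ε δ) (p.2, p.1))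
      ((hG _).comp (by fun_prop)) (fun p => by
        rw [dbar_comp_holomorphic (K := G (ix ε δ)) ((hG _).differentiable (by simp) _) (hφ p)]
        simpa using d1 ε δ (p.2, p.1)) 0
    exact this
  have pol (δ : Bool) (n : ℕ) (hn : weight D δ + 1 = n) := exists_eq_sum_pow n (hol false δ)
    (g := fun w => G (ix true δ) (w, 0)) (hol true δ).continuous.continuousAt (tb δ n hn)
  obtain ⟨f1, f2, f3⟩ := fibre_polynomial (D := D) (fun δ => hG (ix false δ)) (d2 false false) tf
  have hz (z : ℂ × ℂ) : chart (ix false false) z = (Complex.exp z.1, Complex.exp z.2) := by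
    simp [ix, chart, chartMat]
  have hGf (z : ℂ × ℂ) : frame D 1 z * F z
      = G (ix false false) (Complex.exp z.1, Complex.exp z.2) := by
    rw [← hz]
    exact hG' false false z
  rcases hA with hb | ⟨ha, hb | hb⟩
  · refine ⟨0, fun z => ?_⟩
    rw [hGf, f1 hb, hb]
    simp
  · obtain ⟨n, hn⟩ := Int.eq_ofNat_of_zero_le (show 0 ≤ D.1 + 1 by omega)
    obtain ⟨a, ha'⟩ := pol false n (by simpa [weight, hb] using hn)
    refine ⟨fun k₁ _ => a k₁, fun z => ?_⟩
    rw [hGf, f2 hb, ha']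
    simp [hb, hn]
  · obtain ⟨n, hn⟩ := Int.eq_ofNat_of_zero_le (show 0 ≤ D.1 + 1 by omega)
    obtain ⟨a, ha'⟩ := pol false (n + 1) (by simp only [weight, hb]; push_cast; omega)
    obtain ⟨a', ha''⟩ := pol true n (by simpa [weight] using hn)
    refine ⟨fun k₁ k₂ => if k₂ = 0 then a k₁ else a' k₁, fun z => ?_⟩
    rw [hGf, f3 hb, ha', ha'', hb]
    rw [show ((1 : ℤ) + 1).toNat = 2 from rfl,
      Finset.sum_range_succ (n := 1), Finset.sum_range_one]
    rw [show (D.1 + 1 - ((0 : ℕ) : ℤ) + 1).toNat = n + 1 by omega,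
      show (D.1 + 1 - ((1 : ℕ) : ℤ) + 1).toNat = n by omega, Finset.sum_mul]
    simp [mul_assoc]

/-! ### Normalized Bernstein polynomials -/

def bern (k l : ℕ) (r : ℝ) : ℝ := r ^ k * (1 - r) ^ l

/-- The maximum of `bern k l` on `[0, 1]`. -/
def bernMax (k l : ℕ) : ℝ := bern k l (k / (k + l))

theorem bernMax_pos (k l : ℕ) : 0 < bernMax k l := by
  have h1 : 0 < ((k : ℝ) / (k + l)) ^ k := by
    rcases Nat.eq_zero_or_pos k with rfl | hk
    · simp
    · positivity
  have h2 : 0 < (1 - (k : ℝ) / (k + l)) ^ l := by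
    rcases Nat.eq_zero_or_pos l with rfl | hl
    · simp
    · have : (0 : ℝ) < k + l := by positivity
      have e : 1 - (k : ℝ) / (k + l) = l / (k + l) := by field_simp; ring
      rw [e]
      positivity
  exact mul_pos h1 h2

theorem bern_nonneg {k l : ℕ} {r : ℝ} (h0 : 0 ≤ r) (h1 : r ≤ 1) : 0 ≤ bern k l r :=
  mul_nonneg (pow_nonneg h0 _) (pow_nonneg (by linarith) _)

/-- The equation is free of division so as to include k = l = 0, when the polynomial is 1 and every
r is a maximum. -/
theorem bern_eq_bernMax {k l : ℕ} {r : ℝ} (h : ((k : ℝ) + l) * r = k) :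
    bern k l r = bernMax k l := by
  rcases Nat.eq_zero_or_pos (k + l) with h0 | h0
  · obtain ⟨rfl, rfl⟩ : k = 0 ∧ l = 0 := by omega
    simp [bern, bernMax]
  · have : (0 : ℝ) < k + l := by exact_mod_cast h0
    have e : r = k / (k + l) := by rw [eq_div_iff this.ne', mul_comm, h]
    rw [bernMax, ← e]

/-- In the interior this is Gibbs' inequality: with p = k/(k+l), the bound log x ≤ x - 1 gives k
log(r/p) + l log((1-r)/(1-p)) ≤ 0, strictly if r ≠ p. Vanishing exponents and the end points are
treated apart. -/
theorem bern_lt_bernMax {k l : ℕ} {r : ℝ} (h0 : 0 ≤ r) (h1 : r ≤ 1) (h : ((k : ℝ) + l) * r ≠ k) :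
    bern k l r < bernMax k l := by
  rcases Nat.eq_zero_or_pos k with rfl | hk
  · have hr : r ≠ 0 := by rintro rfl; simp at h
    have hl : l ≠ 0 := by rintro rfl; simp at h
    have : (1 - r) ^ l < 1 := pow_lt_one₀ (by linarith) (by
      have := lt_of_le_of_ne h0 hr.symm
      linarith) hl
    simpa [bern, bernMax] using this
  rcases Nat.eq_zero_or_pos l with rfl | hl
  · have hr : r ≠ 1 := by rintro rfl; simp at h
    have hk' : (k : ℝ) ≠ 0 := by exact_mod_cast hk.ne'
    have : r ^ k < 1 := pow_lt_one₀ h0 (lt_of_le_of_ne h1 hr) hk.ne'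
    simpa [bern, bernMax, hk'] using this
  rcases h0.eq_or_lt with rfl | h0
  · simpa [bern, hk.ne'] using bernMax_pos k l
  rcases h1.eq_or_lt with rfl | h1
  · simpa [bern, hl.ne'] using bernMax_pos k l
  have hk' : (0 : ℝ) < k := by exact_mod_cast hk
  have hl' : (0 : ℝ) < l := by exact_mod_cast hl
  have hr1 : 0 < 1 - r := by linarith
  set p : ℝ := k / (k + l) with hp
  have hp0 : 0 < p := by positivity
  have hq : 1 - p = l / (k + l) := by rw [hp]; field_simp; ring
  have hq0 : 0 < 1 - p := by rw [hq]; positivity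
  have hne : r / p ≠ 1 := by
    intro e
    rw [div_eq_one_iff_eq hp0.ne'] at e
    apply h
    rw [e, hp]
    field_simp
  have l1 := Real.log_lt_sub_one_of_pos (div_pos h0 hp0) hne
  have l2 := Real.log_le_sub_one_of_pos (div_pos hr1 hq0)
  rw [Real.log_div h0.ne' hp0.ne'] at l1
  rw [Real.log_div hr1.ne' hq0.ne'] at l2
  have hb : 0 < bern k l r := mul_pos (pow_pos h0 _) (pow_pos hr1 _)
  rw [← Real.log_lt_log_iff hb (bernMax_pos k l)]
  rw [bernMax, bern, bern, ← hp, Real.log_mul (pow_pos h0 _).ne' (pow_pos hr1 _).ne',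
    Real.log_mul (pow_pos hp0 _).ne' (pow_pos hq0 _).ne', Real.log_pow, Real.log_pow,
    Real.log_pow, Real.log_pow]
  have e1 : k * (r / p - 1) + l * ((1 - r) / (1 - p) - 1) = 0 := by
    rw [hq, hp]
    field_simp
    ring
  have := mul_lt_mul_of_pos_left l1 hk'
  have := mul_le_mul_of_nonneg_left l2 hl'.le
  linarith

/-- `bern` normalized to maximum `1`, and its square root. -/
def peak (k l : ℕ) (r : ℝ) : ℝ := √(bern k l r / bernMax k l)

theorem peak_nonneg (k l : ℕ) (r : ℝ) : 0 ≤ peak k l r := Real.sqrt_nonneg _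

theorem peak_eq_one {k l : ℕ} {r : ℝ} (h : ((k : ℝ) + l) * r = k) : peak k l r = 1 := by
  rw [peak, bern_eq_bernMax h, div_self (bernMax_pos k l).ne', Real.sqrt_one]

theorem peak_lt_one {k l : ℕ} {r : ℝ} (h0 : 0 ≤ r) (h1 : r ≤ 1) (h : ((k : ℝ) + l) * r ≠ k) :
    peak k l r < 1 := by
  rw [peak, Real.sqrt_lt' one_pos, one_pow, div_lt_one (bernMax_pos k l)]
  exact bern_lt_bernMax h0 h1 h

theorem peak_le_one {k l : ℕ} {r : ℝ} (h0 : 0 ≤ r) (h1 : r ≤ 1) : peak k l r ≤ 1 := by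
  by_cases h : ((k : ℝ) + l) * r = k
  · exact (peak_eq_one h).le
  · exact (peak_lt_one h0 h1 h).le

theorem continuous_peak (k l : ℕ) : Continuous (peak k l) := by
  unfold peak bern
  fun_prop

/-- This is the difference of the values of a primitive that computes the area of an edge; see
`lintegral_logistic`. -/
theorem neg_log_peak {k l : ℕ} {r : ℝ} (h0 : 0 < r) (h1 : r < 1) :
    -Real.log (peak k l r) = -(1 / 2) * (k * Real.log r + l * Real.log (1 - r))
      + 1 / 2 * (k * Real.log (k / (k + l)) + l * Real.log (1 - k / (k + l))) := by
  have hr1 : 0 < 1 - r := by linarith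
  have hb : 0 < bern k l r := mul_pos (pow_pos h0 _) (pow_pos hr1 _)
  have hm := bernMax_pos k l
  rw [peak, Real.log_sqrt (div_pos hb hm).le, Real.log_div hb.ne' hm.ne']
  have hne := hm.ne'
  rw [bernMax, bern] at hne ⊢
  rw [bern, Real.log_mul (pow_pos h0 _).ne' (pow_pos hr1 _).ne',
    Real.log_mul (left_ne_zero_of_mul hne) (right_ne_zero_of_mul hne), Real.log_pow, Real.log_pow,
    Real.log_pow, Real.log_pow]
  ring

/-! ### Monomials in homogeneous coordinates -/

/-- Exponents of monomials in the four homogeneous coordinates of `𝔽₁`. -/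
structure Cox where
  k₁ : ℕ
  l₁ : ℕ
  k₂ : ℕ
  l₂ : ℕ

namespace Cox

instance : Add Cox := ⟨fun κ κ' => ⟨κ.k₁ + κ'.k₁, κ.l₁ + κ'.l₁, κ.k₂ + κ'.k₂, κ.l₂ + κ'.l₂⟩⟩

variable (κ κ' : Cox)

theorem add_k₁ : (κ + κ').k₁ = κ.k₁ + κ'.k₁ := rfl
theorem add_l₁ : (κ + κ').l₁ = κ.l₁ + κ'.l₁ := rfl
theorem add_k₂ : (κ + κ').k₂ = κ.k₂ + κ'.k₂ := rfl
theorem add_l₂ : (κ + κ').l₂ = κ.l₂ + κ'.l₂ := rfl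

/-- The class of a monomial in the Picard group. -/
def deg : ℤ × ℤ := (κ.k₁ + κ.l₁ - κ.l₂, κ.k₂ + κ.l₂)

theorem deg_add : (κ + κ').deg = κ.deg + κ'.deg := by
  simp only [deg, add_k₁, add_l₁, add_k₂, add_l₂, Prod.mk_add_mk]
  push_cast
  ext <;> simp only <;> ring

/-- The second degree and k₂ determine l₂; the first degree and k₁ then determine l₁. -/
theorem eq_of_deg_eq {κ κ' : Cox} (h : κ.deg = κ'.deg) (h₁ : κ.k₁ = κ'.k₁) (h₂ : κ.k₂ = κ'.k₂) :
    κ = κ' := by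
  obtain ⟨a, b, c, d⟩ := κ
  obtain ⟨a', b', c', d'⟩ := κ'
  simp only [deg, Prod.mk.injEq] at h h₁ h₂
  subst h₁ h₂
  obtain rfl : d = d' := by omega
  obtain rfl : b = b' := by omega
  rfl

/-- The normalizing constant. -/
def const : ℝ := (√(bernMax κ.k₁ κ.l₁ * bernMax κ.k₂ κ.l₂))⁻¹

theorem const_pos : 0 < κ.const :=
  inv_pos.2 (Real.sqrt_pos.2 (mul_pos (bernMax_pos _ _) (bernMax_pos _ _)))

/-- The monomial as a section, in the unitary frame. -/
def sect (z : ℂ × ℂ) : ℂ :=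
  κ.const * Complex.exp (κ.k₁ * z.1 + κ.k₂ * z.2 - potential κ.deg z)

end Cox

/-- The coordinate `s / (1 + s)` on `P`. -/
def rr (x : ℝ × ℝ) : ℝ := x.1 / (4 - x.2)

/-- The coordinate `t / (1 + s + t)` on `P`. -/
def tt (x : ℝ × ℝ) : ℝ := x.2 / 2

theorem rr_nonneg {x : ℝ × ℝ} (hx : x ∈ P) : 0 ≤ rr x := div_nonneg hx.1 (by linarith [hx.2.2.2])

theorem rr_le_one {x : ℝ × ℝ} (hx : x ∈ P) : rr x ≤ 1 := by
  rw [rr, div_le_one (by linarith [hx.2.2.2])]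
  exact hx.2.1

theorem tt_nonneg {x : ℝ × ℝ} (hx : x ∈ P) : 0 ≤ tt x := div_nonneg hx.2.2.1 (by norm_num)

theorem tt_le_one {x : ℝ × ℝ} (hx : x ∈ P) : tt x ≤ 1 := by
  rw [tt, div_le_one (by norm_num)]
  exact hx.2.2.2

namespace Cox

variable (κ κ' : Cox)

/-- The absolute value of the section, as a function on `P`. -/
def height (x : ℝ × ℝ) : ℝ := peak κ.k₁ κ.l₁ (rr x) * peak κ.k₂ κ.l₂ (tt x)

/-- The set of `P` where the absolute value is maximal. -/
def cell : Set (ℝ × ℝ) :=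
  {x | x ∈ P ∧ ((κ.k₁ : ℝ) + κ.l₁) * rr x = κ.k₁ ∧ ((κ.k₂ : ℝ) + κ.l₂) * tt x = κ.k₂}

theorem height_nonneg (x : ℝ × ℝ) : 0 ≤ κ.height x := mul_nonneg (peak_nonneg _ _ _) (peak_nonneg _ _ _)

theorem height_eq_one {x : ℝ × ℝ} (hx : x ∈ κ.cell) : κ.height x = 1 := by
  rw [height, peak_eq_one hx.2.1, peak_eq_one hx.2.2, mul_one]

theorem height_le_one {x : ℝ × ℝ} (hx : x ∈ P) : κ.height x ≤ 1 :=
  mul_le_one₀ (peak_le_one (rr_nonneg hx) (rr_le_one hx)) (peak_nonneg _ _ _)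
    (peak_le_one (tt_nonneg hx) (tt_le_one hx))

theorem mem_cell_of_height_eq_one {x : ℝ × ℝ} (hx : x ∈ P) (h : κ.height x = 1) : x ∈ κ.cell := by
  have a1 := peak_nonneg κ.k₁ κ.l₁ (rr x)
  have a2 := peak_nonneg κ.k₂ κ.l₂ (tt x)
  have b1 := peak_le_one (k := κ.k₁) (l := κ.l₁) (rr_nonneg hx) (rr_le_one hx)
  have b2 := peak_le_one (k := κ.k₂) (l := κ.l₂) (tt_nonneg hx) (tt_le_one hx)
  rw [height] at h
  refine ⟨hx, ?_, ?_⟩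
  · by_contra hc
    have := peak_lt_one (rr_nonneg hx) (rr_le_one hx) hc
    nlinarith
  · by_contra hc
    have := peak_lt_one (tt_nonneg hx) (tt_le_one hx) hc
    nlinarith

theorem cell_nonempty : ∃ x, x ∈ κ.cell := by
  have hr (k l : ℕ) : 0 ≤ (k : ℝ) / (k + l) ∧ (k : ℝ) / (k + l) ≤ 1
      ∧ ((k : ℝ) + l) * (k / (k + l)) = k := by
    refine ⟨by positivity, div_le_one_of_le₀ (by simp) (by positivity), ?_⟩
    rcases Nat.eq_zero_or_pos (k + l) with h0 | h0
    · obtain ⟨rfl, rfl⟩ : k = 0 ∧ l = 0 := by omega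
      simp
    · have : (0 : ℝ) < k + l := by exact_mod_cast h0
      field_simp
  obtain ⟨a1, a2, a3⟩ := hr κ.k₁ κ.l₁
  obtain ⟨b1, b2, b3⟩ := hr κ.k₂ κ.l₂
  generalize (κ.k₁ : ℝ) / (κ.k₁ + κ.l₁) = r at *
  generalize (κ.k₂ : ℝ) / (κ.k₂ + κ.l₂) = τ at *
  have e : rr (r * (4 - 2 * τ), 2 * τ) = r := by
    have : (4 : ℝ) - 2 * τ ≠ 0 := by linarith
    simp only [rr]
    field_simp
  refine ⟨(r * (4 - 2 * τ), 2 * τ), ⟨?_, ?_, ?_, ?_⟩, ?_, ?_⟩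
  · exact mul_nonneg a1 (by linarith)
  · show r * (4 - 2 * τ) ≤ 4 - 2 * τ
    nlinarith
  · show 0 ≤ 2 * τ
    linarith
  · show 2 * τ ≤ 2
    linarith
  · rw [e, a3]
  · simpa [tt] using b3

theorem continuousOn_height : ContinuousOn κ.height P := by
  have h : ContinuousOn rr P := by
    refine continuousOn_fst.div (continuousOn_const.sub continuousOn_snd) fun x hx => ?_
    have := hx.2.2.2
    linarith
  have h' : ContinuousOn tt P := by
    unfold tt
    fun_prop
  exact ((continuous_peak _ _).comp_continuousOn h).mul ((continuous_peak _ _).comp_continuousOn h')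

end Cox

theorem rr_moment (z : ℂ × ℂ) :
    rr (moment z) = Real.exp (2 * z.1.re) / (1 + Real.exp (2 * z.1.re)) := by
  have h1 := Real.exp_pos (2 * z.1.re)
  have h2 := Real.exp_pos (2 * z.2.re)
  simp only [rr, moment]
  generalize Real.exp (2 * z.1.re) = s at *
  generalize Real.exp (2 * z.2.re) = t at *
  have h4 : (4 : ℝ) - 2 * t / (1 + s + t) = (4 + 4 * s + 2 * t) / (1 + s + t) := by
    field_simp; ring
  rw [h4]
  field_simp
  ring

theorem tt_moment (z : ℂ × ℂ) : tt (moment z) = Real.exp (2 * z.2.re)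
    / (1 + Real.exp (2 * z.1.re) + Real.exp (2 * z.2.re)) := by
  simp only [tt, moment]
  ring

namespace Cox

variable (κ κ' : Cox)

/-- With r = s/(1+s) and τ = t/(1+s+t) one has 1 - r = 1/(1+s) and 1 - τ = (1+s)/(1+s+t). Collecting
powers of 1+s gives the exponent -(k₁+l₁-l₂), and of 1+s+t the exponent -(k₂+l₂), exactly the
weights in the potential of the degree. -/
theorem exp_sub_potential (z : ℂ × ℂ) :
    Real.exp (κ.k₁ * z.1.re + κ.k₂ * z.2.re - potential κ.deg z)
      = √(bern κ.k₁ κ.l₁ (rr (moment z)) * bern κ.k₂ κ.l₂ (tt (moment z))) := by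
  symm
  rw [Real.sqrt_eq_iff_mul_self_eq_of_pos (Real.exp_pos _), ← Real.exp_add, rr_moment, tt_moment]
  have h1 := Real.exp_pos (2 * z.1.re)
  have h2 := Real.exp_pos (2 * z.2.re)
  have hA : 0 < 1 + Real.exp (2 * z.1.re) := by positivity
  have hB : 0 < 1 + Real.exp (2 * z.1.re) + Real.exp (2 * z.2.re) := by positivity
  have e1 : 1 - Real.exp (2 * z.1.re) / (1 + Real.exp (2 * z.1.re))
      = (1 + Real.exp (2 * z.1.re))⁻¹ := by field_simp; ring
  have e2 : 1 - Real.exp (2 * z.2.re) / (1 + Real.exp (2 * z.1.re) + Real.exp (2 * z.2.re))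
      = (1 + Real.exp (2 * z.1.re)) / (1 + Real.exp (2 * z.1.re) + Real.exp (2 * z.2.re)) := by
    field_simp; ring
  rw [bern, bern, e1, e2, potential]
  obtain ⟨B, hB'⟩ : ∃ B, 1 + Real.exp (2 * z.1.re) + Real.exp (2 * z.2.re) = Real.exp B :=
    ⟨_, (Real.exp_log hB).symm⟩
  obtain ⟨A, hA'⟩ : ∃ A, 1 + Real.exp (2 * z.1.re) = Real.exp A := ⟨_, (Real.exp_log hA).symm⟩
  rw [hB', hA', Real.log_exp, Real.log_exp]
  rw [← Real.exp_neg, ← Real.exp_sub, ← Real.exp_sub, ← Real.exp_sub, ← Real.exp_nat_mul,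
    ← Real.exp_nat_mul, ← Real.exp_nat_mul, ← Real.exp_nat_mul, ← Real.exp_add, ← Real.exp_add,
    ← Real.exp_add]
  congr 1
  simp only [deg]
  push_cast
  ring

theorem section_eq (z : ℂ × ℂ) : κ.sect z = κ.height (moment z)
    * Complex.exp (Complex.I * (κ.k₁ * z.1.im + κ.k₂ * z.2.im)) := by
  have h : κ.height (moment z) = κ.const
      * Real.exp (κ.k₁ * z.1.re + κ.k₂ * z.2.re - potential κ.deg z) := by
    have hm : moment z ∈ P := by
      have h1 := Real.exp_pos (2 * z.1.re)
      have h2 := Real.exp_pos (2 * z.2.re)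
      have h3 := (moment_snd_lt z).le
      have h4 : rr (moment z) ≤ 1 := by
        rw [rr_moment, div_le_one (by positivity)]
        linarith
      rw [rr, div_le_one (by linarith)] at h4
      exact ⟨by simp only [moment]; positivity, h4, by simp only [moment]; positivity, h3⟩
    have b1 := bern_nonneg (k := κ.k₁) (l := κ.l₁) (rr_nonneg hm) (rr_le_one hm)
    have b2 := bern_nonneg (k := κ.k₂) (l := κ.l₂) (tt_nonneg hm) (tt_le_one hm)
    have c1 := (bernMax_pos κ.k₁ κ.l₁).le
    rw [exp_sub_potential, height, peak, peak, const, Real.sqrt_div b1, Real.sqrt_div b2,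
      Real.sqrt_mul b1, Real.sqrt_mul c1]
    ring
  rw [sect, h, Complex.ofReal_mul, mul_assoc, Complex.ofReal_exp, ← Complex.exp_add]
  congr 2
  have e1 := Complex.re_add_im z.1
  have e2 := Complex.re_add_im z.2
  push_cast
  linear_combination (-(κ.k₁ : ℂ)) * e1 - κ.k₂ * e2

/-- A chart sets two homogeneous coordinates equal to 1, so the other two exponents remain and the
expression is a polynomial. -/
theorem frame_mul_section (ε δ : Bool) (z : ℂ × ℂ) : frame κ.deg (ix ε δ) z * κ.sect z
    = κ.const * ((chart (ix ε δ) z).1 ^ (if ε then κ.l₁ else κ.k₁)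
      * (chart (ix ε δ) z).2 ^ (if δ then κ.l₂ else κ.k₂)) := by
  rw [sect, mul_left_comm, frame, ← Complex.exp_add]
  congr 1
  cases ε <;> cases δ <;>
  · simp only [ix, chart, chartMat, transLog, ← Complex.exp_nat_mul, ← Complex.exp_add, deg]
    congr 1
    simp
    try ring

theorem section_mem : ((κ.sect, 0, 0, 0) : Form) ∈ formsOn κ.deg := by
  intro j
  obtain ⟨ε, δ, rfl⟩ := ix_surjective j
  refine ⟨fun w => κ.const * (w.1 ^ (if ε then κ.l₁ else κ.k₁)
      * w.2 ^ (if δ then κ.l₂ else κ.k₂)), 0, 0, 0, ?_, contDiff_const, contDiff_const,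
    contDiff_const, fun z => ⟨κ.frame_mul_section ε δ z, by simp, by simp, by simp⟩⟩
  exact contDiff_const.mul ((contDiff_fst.pow _).mul (contDiff_snd.pow _))

theorem formD_section {L L' : ℤ × ℤ} (h : κ.deg = L' - L) :
    formD L L' (κ.sect, 0, 0, 0) = 0 := by
  have hK : ContDiff ℝ ∞ fun w : ℂ × ℂ => (κ.const : ℂ) * (w.1 ^ κ.k₁ * w.2 ^ κ.k₂) :=
    contDiff_const.mul ((contDiff_fst.pow _).mul (contDiff_snd.pow _))
  have hd (e w : ℂ × ℂ) : dbar e (fun w : ℂ × ℂ => (κ.const : ℂ) * (w.1 ^ κ.k₁ * w.2 ^ κ.k₂)) w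
      = 0 := dbar_holomorphic (by fun_prop) e
  have hF (z : ℂ × ℂ) := κ.frame_mul_section false false z
  simp only [Bool.false_eq_true, if_false] at hF
  refine Prod.ext rfl (Prod.ext ?_ (Prod.ext ?_ ?_)) <;> funext z
  · apply mul_left_cancel₀ (frame_ne κ.deg (ix false false) z)
    have := frame_mul_cov_fst hK hF z
    simp only [formD, disp_eq, ← h]
    rw [this, hd, hd]
    simp
  · apply mul_left_cancel₀ (frame_ne κ.deg (ix false false) z)
    have := frame_mul_cov_snd hK hF z
    simp only [formD, disp_eq, ← h]
    rw [this, hd]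
    simp
  · simp [formD, dbar_zero]

theorem potential_add (D D' : ℤ × ℤ) (z : ℂ × ℂ) :
    potential (D + D') z = potential D z + potential D' z := by
  simp only [potential, Prod.fst_add, Prod.snd_add]
  push_cast
  ring

/-- Exponents and potentials add, so only the normalizing constants fail to match. -/
theorem section_mul (z : ℂ × ℂ) : κ.sect z * κ'.sect z
    = (κ.const * κ'.const / (κ + κ').const : ℝ) * (κ + κ').sect z := by
  have hc : ((κ + κ').const : ℂ) ≠ 0 := by exact_mod_cast (κ + κ').const_pos.ne'
  simp only [sect, deg_add, potential_add, add_k₁, add_k₂]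
  push_cast
  rw [div_mul_eq_mul_div, eq_div_iff hc]
  have e : Complex.exp ((κ.k₁ + κ'.k₁ : ℂ) * z.1 + (κ.k₂ + κ'.k₂) * z.2
        - (potential κ.deg z + potential κ'.deg z))
      = Complex.exp (κ.k₁ * z.1 + κ.k₂ * z.2 - potential κ.deg z)
        * Complex.exp (κ'.k₁ * z.1 + κ'.k₂ * z.2 - potential κ'.deg z) := by
    rw [← Complex.exp_add]
    congr 1
    ring
  rw [e]
  ring

/-- The structure constants are the products of the heights at the maximum of the product. -/
theorem const_mul_const {x : ℝ × ℝ} (hx : x ∈ (κ + κ').cell) :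
    κ.const * κ'.const / (κ + κ').const = κ.height x * κ'.height x := by
  have key (κ : Cox) : κ.height x = κ.const
      * √(bern κ.k₁ κ.l₁ (rr x) * bern κ.k₂ κ.l₂ (tt x)) := by
    have b1 := bern_nonneg (k := κ.k₁) (l := κ.l₁) (rr_nonneg hx.1) (rr_le_one hx.1)
    have b2 := bern_nonneg (k := κ.k₂) (l := κ.l₂) (tt_nonneg hx.1) (tt_le_one hx.1)
    have c1 := (bernMax_pos κ.k₁ κ.l₁).le
    rw [height, peak, peak, const, Real.sqrt_div b1, Real.sqrt_div b2,
      Real.sqrt_mul b1, Real.sqrt_mul c1]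
    ring
  have e1 := key (κ + κ')
  rw [(κ + κ').height_eq_one hx] at e1
  have b (κ : Cox) : 0 ≤ bern κ.k₁ κ.l₁ (rr x) * bern κ.k₂ κ.l₂ (tt x) :=
    mul_nonneg (bern_nonneg (rr_nonneg hx.1) (rr_le_one hx.1))
      (bern_nonneg (tt_nonneg hx.1) (tt_le_one hx.1))
  have e2 : √(bern κ.k₁ κ.l₁ (rr x) * bern κ.k₂ κ.l₂ (tt x))
      * √(bern κ'.k₁ κ'.l₁ (rr x) * bern κ'.k₂ κ'.l₂ (tt x))
      = √(bern (κ + κ').k₁ (κ + κ').l₁ (rr x) * bern (κ + κ').k₂ (κ + κ').l₂ (tt x)) := by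
    rw [← Real.sqrt_mul (b κ)]
    congr 1
    simp only [bern, add_k₁, add_l₁, add_k₂, add_l₂, pow_add]
    ring
  have hc := (κ + κ').const_pos.ne'
  rw [key κ, key κ', div_eq_iff hc]
  calc κ.const * κ'.const = κ.const * κ'.const * 1 := by ring
    _ = _ := by rw [e1, ← e2]; ring

end Cox

/-! ### Level sets and generators -/

theorem lagr_eq (D : ℤ × ℤ) (x : ℝ × ℝ) :
    lagr D x = (rr x * (D.1 + D.2 * (1 - tt x)), D.2 * tt x) := by
  ext
  · simp only [lagr, rr, tt]
    rw [mul_comm 2 (4 - x.2), ← div_div]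
    ring
  · simp only [lagr, tt]
    ring

/-- Clearing denominators and inserting the second equation into the first makes the conditions
affine in x; this is why level sets are convex. -/
theorem lagr_eq_iff {D : ℤ × ℤ} {x : ℝ × ℝ} (hx : x.2 < 4) {i₁ i₂ : ℝ} : lagr D x = (i₁, i₂) ↔
    D.2 * x.2 = 2 * i₂ ∧ (D.1 + D.2 - i₂) * x.1 = i₁ * (4 - x.2) := by
  have h4 : 4 - x.2 ≠ 0 := by linarith
  rw [lagr, Prod.mk.injEq, div_eq_iff (by positivity), div_eq_iff two_ne_zero]
  constructor
  · rintro ⟨h1, h2⟩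
    exact ⟨by linarith, by linear_combination (1 / 2) * h1 + (1 / 2) * x.1 * h2⟩
  · rintro ⟨h1, h2⟩
    exact ⟨by linear_combination 2 * h2 - x.1 * h1, by linarith⟩

theorem snd_lt_of_mem {x : ℝ × ℝ} (hx : x ∈ P) : x.2 < 4 := by linarith [hx.2.2.2]

theorem convex_level (D : ℤ × ℤ) (i : ℝ × ℝ) : Convex ℝ {x | x ∈ P ∧ lagr D x = i} := by
  intro x hx y hy s t hs ht hst
  have hz := convex_P hx.1 hy.1 hs ht hst
  have h1 := (lagr_eq_iff (snd_lt_of_mem hx.1)).1 hx.2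
  have h2 := (lagr_eq_iff (snd_lt_of_mem hy.1)).1 hy.2
  refine ⟨hz, (lagr_eq_iff (snd_lt_of_mem hz)).2 ?_⟩
  simp only [Prod.fst_add, Prod.snd_add, Prod.smul_fst, Prod.smul_snd, smul_eq_mul]
  constructor
  · linear_combination s * h1.1 + t * h2.1 + 2 * i.2 * hst
  · linear_combination s * h1.2 + t * h2.2 + 4 * i.1 * hst

theorem continuousOn_lagr (D : ℤ × ℤ) : ContinuousOn (lagr D) P := by
  unfold lagr
  refine ContinuousOn.prodMk (ContinuousOn.div (by fun_prop) (by fun_prop) fun x hx => ?_)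
    (by fun_prop)
  have := snd_lt_of_mem hx
  linarith

theorem isDiscrete_range_intCast : IsDiscrete (range ((↑) : ℤ → ℝ)) :=
  ⟨(Int.isClosedEmbedding_coe_real.isEmbedding.toHomeomorph).symm.isEmbedding.discreteTopology⟩

/-- On π(L ∩ L') the displacement is continuous with integer values, hence constant on components;
conversely its level sets are convex. -/
theorem connectedComponentIn_inter {L L' : ℤ × ℤ} {x : ℝ × ℝ} (hx : x ∈ inter L L') :
    connectedComponentIn (inter L L') x = {y | y ∈ P ∧ lagr (L' - L) y = lagr (L' - L) x} := by
  apply Subset.antisymm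
  · intro y hy
    have hs := connectedComponentIn_subset (inter L L') x
    have hp : IsPreconnected (connectedComponentIn (inter L L') x) :=
      isPreconnected_connectedComponentIn
    have hc : ContinuousOn (lagr (L' - L)) (connectedComponentIn (inter L L') x) :=
      (continuousOn_lagr _).mono fun z hz => (hs hz).1
    have hm := mem_connectedComponentIn hx
    refine ⟨(hs hy).1, Prod.ext ?_ ?_⟩
    · refine hp.constant_of_mapsTo isDiscrete_range_intCast hc.fst ?_ hy hm
      intro z hz
      obtain ⟨-, i, hi⟩ := hs hz
      rw [disp_eq] at hi
      exact ⟨i.1, by simp [hi]⟩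
    · refine hp.constant_of_mapsTo isDiscrete_range_intCast hc.snd ?_ hy hm
      intro z hz
      obtain ⟨-, i, hi⟩ := hs hz
      rw [disp_eq] at hi
      exact ⟨i.2, by simp [hi]⟩
  · refine (convex_level _ _).isPreconnected.subset_connectedComponentIn ⟨hx.1, rfl⟩ ?_
    rintro y ⟨hy, e⟩
    obtain ⟨-, i, hi⟩ := hx
    exact ⟨hy, i, by rw [disp_eq, e, ← disp_eq, hi]⟩

/-- The two descriptions differ only by a multiple of the second equation: the first component of
the displacement is r(a + b(1 - τ)), and bτ = k₂ turns the bracket into k₁ + l₁. -/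
theorem Cox.mem_cell_iff {κ : Cox} {x : ℝ × ℝ} (hx : x ∈ P) :
    x ∈ κ.cell ↔ lagr κ.deg x = ((κ.k₁ : ℝ), (κ.k₂ : ℝ)) := by
  have e : x ∈ κ.cell ↔ ((κ.k₁ : ℝ) + κ.l₁) * rr x = κ.k₁ ∧ ((κ.k₂ : ℝ) + κ.l₂) * tt x = κ.k₂ :=
    ⟨fun h => h.2, fun h => ⟨hx, h⟩⟩
  rw [e, lagr_eq, Prod.mk.injEq]
  simp only [Cox.deg]
  push_cast
  constructor
  · rintro ⟨h1, h2⟩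
    exact ⟨by linear_combination h1 - rr x * h2, h2⟩
  · rintro ⟨h1, h2⟩
    exact ⟨by linear_combination h1 + rr x * h2, h2⟩

theorem Cox.cell_eq (κ : Cox) :
    κ.cell = {x | x ∈ P ∧ lagr κ.deg x = ((κ.k₁ : ℝ), (κ.k₂ : ℝ))} := by
  ext x
  exact ⟨fun h => ⟨h.1, (Cox.mem_cell_iff h.1).1 h⟩, fun h => (Cox.mem_cell_iff h.1).2 h.2⟩

theorem Cox.convex_cell (κ : Cox) : Convex ℝ κ.cell := by
  rw [Cox.cell_eq]
  exact convex_level _ _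

/-- Any point of the cell gives back (k₁, k₂) as the value of the displacement. -/
theorem Cox.eq_of_cell_eq {κ κ' : Cox} (h : κ.deg = κ'.deg) (hc : κ.cell = κ'.cell) : κ = κ' := by
  obtain ⟨x, hx⟩ := κ.cell_nonempty
  have h1 := (Cox.mem_cell_iff hx.1).1 hx
  have h2 := (Cox.mem_cell_iff (hc ▸ hx).1).1 (hc ▸ hx : x ∈ κ'.cell)
  rw [← h, h1, Prod.mk.injEq] at h2
  exact Cox.eq_of_deg_eq h (by exact_mod_cast h2.1) (by exact_mod_cast h2.2)

/-! ### Trajectories -/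

theorem eq_exp_of_hasDerivWithinAt {S : Set ℝ} (hS : Convex ℝ S) (hu : UniqueDiffOn ℝ S)
    (h0 : (0 : ℝ) ∈ S) {y : ℝ → ℝ} {c y₀ : ℝ}
    (hy : ∀ t ∈ S, HasDerivWithinAt y (c * (y t - y₀)) S t) {t : ℝ} (ht : t ∈ S) :
    y t = y₀ + (y 0 - y₀) * Real.exp (c * t) := by
  have hd (s : ℝ) (hs : s ∈ S) :
      HasDerivWithinAt (fun t => (y t - y₀) * Real.exp (-(c * t))) 0 S s := by
    have h1 := ((hy s hs).sub_const y₀).mul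
      ((((hasDerivAt_id s).const_mul c).neg.exp).hasDerivWithinAt (s := S))
    refine h1.congr_deriv ?_
    simp only [id]
    ring
  have := hS.is_const_of_fderivWithin_eq_zero (𝕜 := ℝ)
    (f := fun t => (y t - y₀) * Real.exp (-(c * t)))
    (fun s hs => (hd s hs).differentiableWithinAt)
    (fun s hs => by
      rw [(hd s hs).hasFDerivWithinAt.fderivWithin (hu s hs)]
      ext
      simp) ht h0
  simp only [mul_zero, neg_zero, Real.exp_zero, mul_one] at this
  rw [← this, mul_assoc, ← Real.exp_add]
  simp

theorem eq_of_tendsto_exp {c y₀ d : ℝ} (hc : 0 ≤ c) {y : ℝ → ℝ}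
    (hy : ∀ t, 0 ≤ t → y t = y₀ + d * Real.exp (c * t)) (h : Tendsto y atTop (𝓝 y₀)) : d = 0 := by
  have h1 : Tendsto (fun t => |y t - y₀|) atTop (𝓝 0) := by
    simpa using (h.sub_const y₀).abs
  have h2 : |d| ≤ 0 := by
    refine ge_of_tendsto h1 ?_
    filter_upwards [eventually_ge_atTop 0] with t ht
    rw [hy t ht, add_sub_cancel_left, abs_mul, Real.abs_exp]
    exact le_mul_of_one_le_right (abs_nonneg d) (Real.one_le_exp (mul_nonneg hc ht))
  exact abs_nonpos_iff.1 h2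

theorem gradField_snd (L L' : ℤ × ℤ) (v x : ℝ × ℝ) :
    (gradField L L' v x).2 = ((L' - L).2 : ℝ) / 2 * (x.2 - v.2) := by
  simp only [gradField, disp_eq, lagr, Prod.snd_sub]
  ring

/-- On a horizontal line the field is linear in x¹, although it is not so on the plane. It is
applied once a trajectory is known to keep x² constant. -/
theorem gradField_fst {L L' : ℤ × ℤ} {v x : ℝ × ℝ} (h : x.2 = v.2) :
    (gradField L L' v x).1 =
      ((L' - L).1 + (L' - L).2 - (lagr (L' - L) v).2) / (4 - v.2) * (x.1 - v.1) := by
  simp only [gradField, disp_eq, Prod.fst_sub, lagr, h]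
  rcases eq_or_ne (4 - v.2) 0 with h4 | h4
  · simp [h4]
  · field_simp
    ring

theorem Cox.gradField_fst {κ : Cox} {L L' : ℤ × ℤ} (hκ : κ.deg = L' - L) {v x : ℝ × ℝ}
    (hv : v ∈ κ.cell) (h : x.2 = v.2) :
    (gradField L L' v x).1 = ((κ.k₁ : ℝ) + κ.l₁) / (4 - v.2) * (x.1 - v.1) := by
  rw [HMS.gradField_fst h, ← hκ, (Cox.mem_cell_iff hv.1).1 hv]
  simp only [Cox.deg]
  push_cast
  ring

theorem Cox.gradField_snd {κ : Cox} {L L' : ℤ × ℤ} (hκ : κ.deg = L' - L) (v x : ℝ × ℝ) :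
    (gradField L L' v x).2 = ((κ.k₂ : ℝ) + κ.l₂) / 2 * (x.2 - v.2) := by
  rw [HMS.gradField_snd, ← hκ]
  simp [Cox.deg]

theorem _root_.HasDerivWithinAt.prod_fst {γ : ℝ → ℝ × ℝ} {γ' : ℝ × ℝ} {S : Set ℝ} {t : ℝ}
    (h : HasDerivWithinAt γ γ' S t) : HasDerivWithinAt (fun t => (γ t).1) γ'.1 S t := by
  simpa using h.hasFDerivWithinAt.fst.hasDerivWithinAt

theorem _root_.HasDerivWithinAt.prod_snd {γ : ℝ → ℝ × ℝ} {γ' : ℝ × ℝ} {S : Set ℝ} {t : ℝ}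
    (h : HasDerivWithinAt γ γ' S t) : HasDerivWithinAt (fun t => (γ t).2) γ'.2 S t := by
  simpa using h.hasFDerivWithinAt.snd.hasDerivWithinAt

/-- The rates (k₂+l₂)/2 and (k₁+l₁)/(4-v²) are nonnegative, so no nonconstant trajectory converges
to v. The coordinate x² comes first, since the equation for x¹ is linear only when x² is constant.
-/
theorem Cox.forward_const {κ : Cox} {L L' : ℤ × ℤ} (hκ : κ.deg = L' - L) {v : ℝ × ℝ}
    (hv : v ∈ κ.cell) {γ : ℝ → ℝ × ℝ}
    (hγ : ∀ t, 0 ≤ t → HasDerivWithinAt γ (gradField L L' v (γ t)) (Ici 0) t)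
    (h : Tendsto γ atTop (𝓝 v)) : ∀ t, 0 ≤ t → γ t = v := by
  have h4 := snd_lt_of_mem hv.1
  have e2 := fun t (ht : 0 ≤ t) => eq_exp_of_hasDerivWithinAt (convex_Ici 0) (uniqueDiffOn_Ici 0)
    self_mem_Ici (y := fun t => (γ t).2) (c := ((κ.k₂ : ℝ) + κ.l₂) / 2) (y₀ := v.2)
    (fun t ht => by
      have := (hγ t ht).prod_snd
      rwa [Cox.gradField_snd hκ] at this) (mem_Ici.2 ht)
  have d2 := eq_of_tendsto_exp (by positivity) e2 h.snd_nhds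
  have c2 : ∀ t, 0 ≤ t → (γ t).2 = v.2 := fun t ht => by simpa [d2] using e2 t ht
  have e1 := fun t (ht : 0 ≤ t) => eq_exp_of_hasDerivWithinAt (convex_Ici 0) (uniqueDiffOn_Ici 0)
    self_mem_Ici (y := fun t => (γ t).1) (c := ((κ.k₁ : ℝ) + κ.l₁) / (4 - v.2)) (y₀ := v.1)
    (fun t ht => by
      have := (hγ t ht).prod_fst
      rwa [Cox.gradField_fst hκ hv (c2 t ht)] at this) (mem_Ici.2 ht)
  have d1 := eq_of_tendsto_exp (div_nonneg (by positivity) (by linarith)) e1 h.fst_nhds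
  exact fun t ht => Prod.ext (by simpa [d1] using e1 t ht) (c2 t ht)

theorem gradField_self (L L' : ℤ × ℤ) (v : ℝ × ℝ) : gradField L L' v v = 0 := sub_self _

theorem Cox.stable_eq {κ : Cox} {L L' : ℤ × ℤ} (hκ : κ.deg = L' - L) {v : ℝ × ℝ}
    (hv : v ∈ κ.cell) : stable L L' v = {v} := by
  apply Subset.antisymm
  · rintro x ⟨γ, h0, hγ, h⟩
    rw [← h0]
    exact Cox.forward_const hκ hv (fun t ht => (hγ t ht).2) h 0 le_rfl
  · rintro x hx
    rw [mem_singleton_iff] at hx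
    subst hx
    refine ⟨fun _ => x, rfl, fun t _ => ⟨snd_lt_of_mem hv.1, ?_⟩, tendsto_const_nhds⟩
    rw [gradField_self]
    exact hasDerivWithinAt_const _ _ _

/-- The stable manifold is the single point, so the interior condition holds trivially. -/
theorem Cox.isGen {κ : Cox} {L L' : ℤ × ℤ} (hκ : κ.deg = L' - L) : IsGen L L' κ.cell := by
  obtain ⟨x, hx⟩ := κ.cell_nonempty
  have h := (Cox.mem_cell_iff hx.1).1 hx
  have hi : x ∈ inter L L' := ⟨hx.1, ((κ.k₁ : ℤ), (κ.k₂ : ℤ)), by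
    rw [disp_eq, ← hκ, h]
    simp⟩
  refine ⟨⟨x, hi, ?_⟩, x, hx, ?_⟩
  · rw [connectedComponentIn_inter hi, ← hκ, h, Cox.cell_eq]
  · refine eventually_nhdsWithin_of_forall fun z hz => ?_
    rw [Cox.stable_eq hκ hx] at hz
    rw [hz]
    exact hx.1

/-- Along this trajectory the ratio `x¹ / (4 - x²)` is constant. -/
theorem radial_mem_stable {L L' : ℤ × ℤ} {v : ℝ × ℝ} (hv : v ∈ P) (hb : (L' - L).2 = -1) {s : ℝ}
    (hs : |s| < 1) : (rr v * (4 - (v.2 + s)), v.2 + s) ∈ stable L L' v := by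
  have h2 := hv.2.2.2
  have hr : rr v * (4 - v.2) = v.1 := by
    rw [rr, div_mul_cancel₀]
    linarith
  have hlt (t : ℝ) (ht : 0 ≤ t) : v.2 + s * Real.exp (-(1 / 2) * t) < 4 := by
    have h3 : Real.exp (-(1 / 2) * t) ≤ 1 := Real.exp_le_one_iff.2 (by linarith)
    have h4 := abs_lt.1 hs
    have h5 := Real.exp_pos (-(1 / 2) * t)
    nlinarith
  have hd (t : ℝ) : HasDerivAt (fun t => v.2 + s * Real.exp (-(1 / 2) * t))
      (-(1 / 2) * (s * Real.exp (-(1 / 2) * t))) t := by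
    refine ((((hasDerivAt_id t).const_mul (-(1 / 2))).exp.const_mul s).const_add v.2).congr_deriv ?_
    simp only [id]
    ring
  refine ⟨fun t => (rr v * (4 - (v.2 + s * Real.exp (-(1 / 2) * t))),
    v.2 + s * Real.exp (-(1 / 2) * t)), by simp, fun t ht => ⟨hlt t ht, ?_⟩, ?_⟩
  · refine ((((hd t).const_sub 4).const_mul (rr v)).prodMk (hd t)).hasDerivWithinAt.congr_deriv ?_
    have h4 : 4 - (v.2 + s * Real.exp (-(1 / 2) * t)) ≠ 0 := by linarith [hlt t ht]
    have e : rr (rr v * (4 - (v.2 + s * Real.exp (-(1 / 2) * t))),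
        v.2 + s * Real.exp (-(1 / 2) * t)) = rr v := by
      rw [rr]
      exact mul_div_cancel_right₀ _ h4
    simp only [gradField, disp_eq, lagr_eq, e, hb, tt]
    ext
    · simp only [Prod.fst_sub]
      push_cast
      ring
    · simp only [Prod.snd_sub]
      push_cast
      ring
  · have h0 : Tendsto (fun t : ℝ => Real.exp (-(1 / 2) * t)) atTop (𝓝 0) :=
      Real.tendsto_exp_atBot.comp (tendsto_id.const_mul_atTop_of_neg (by norm_num))
    have h1 : Tendsto (fun t => v.2 + s * Real.exp (-(1 / 2) * t)) atTop (𝓝 v.2) := by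
      simpa using (h0.const_mul s).const_add v.2
    have h3 := ((h1.const_sub 4).const_mul (rr v)).prodMk_nhds h1
    rwa [hr] at h3

/-- The rate in the direction of x¹ is -1/(4 - v²), so the whole horizontal line flows into v. -/
theorem horizontal_mem_stable {L L' : ℤ × ℤ} {v : ℝ × ℝ} (hv : v ∈ P)
    (hn : ((L' - L).1 : ℝ) + (L' - L).2 - (lagr (L' - L) v).2 = -1) (s : ℝ) :
    (v.1 + s, v.2) ∈ stable L L' v := by
  have h4 : 0 < 4 - v.2 := by linarith [hv.2.2.2]
  have hd (t : ℝ) : HasDerivAt (fun t => v.1 + s * Real.exp (-1 / (4 - v.2) * t))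
      (-1 / (4 - v.2) * (s * Real.exp (-1 / (4 - v.2) * t))) t := by
    refine ((((hasDerivAt_id t).const_mul _).exp.const_mul s).const_add v.1).congr_deriv ?_
    simp only [id]
    ring
  refine ⟨fun t => (v.1 + s * Real.exp (-1 / (4 - v.2) * t), v.2), by simp,
    fun t ht => ⟨(snd_lt_of_mem hv : v.2 < 4), ?_⟩, ?_⟩
  · refine ((hd t).prodMk (hasDerivAt_const t v.2)).hasDerivWithinAt.congr_deriv ?_
    ext
    · beta_reduce
      rw [gradField_fst (by rfl), hn]
      simp
    · simp [gradField_snd]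
  · have h0 : Tendsto (fun t : ℝ => Real.exp (-1 / (4 - v.2) * t)) atTop (𝓝 0) :=
      Real.tendsto_exp_atBot.comp (tendsto_id.const_mul_atTop_of_neg
        (div_neg_of_neg_of_pos (by norm_num) h4))
    have h1 : Tendsto (fun t => v.1 + s * Real.exp (-1 / (4 - v.2) * t)) atTop (𝓝 v.1) := by
      simpa using (h0.const_mul s).const_add v.1
    exact h1.prodMk_nhds tendsto_const_nhds

/-- A curve in S that leaves P at v on one side shows that v is not interior to S ∩ P relative to S.
-/
theorem not_eventually_mem_P {S : Set (ℝ × ℝ)} {v : ℝ × ℝ} {f : ℝ → ℝ × ℝ}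
    (hf : ContinuousAt f 0) (h0 : f 0 = v) (hS : ∀ s, |s| < 1 → f s ∈ S)
    (hP : (∀ s < 0, f s ∉ P) ∨ ∀ s > 0, f s ∉ P) : ¬ ∀ᶠ z in 𝓝[S] v, z ∈ P := by
  intro h
  have hb : ∀ᶠ s in 𝓝 (0 : ℝ), f s ∈ S := by
    filter_upwards [Metric.ball_mem_nhds (0 : ℝ) one_pos] with s hs
    exact hS s (by simpa using hs)
  have ht : Tendsto f (𝓝 0) (𝓝[S] v) := tendsto_nhdsWithin_iff.2 ⟨h0 ▸ hf, hb⟩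
  have h1 := ht.eventually h
  rcases hP with hP | hP
  · obtain ⟨s, h2, h3⟩ := ((h1.filter_mono nhdsWithin_le_nhds).and
      (self_mem_nhdsWithin (s := Iio (0 : ℝ)))).exists
    exact hP s h3 h2
  · obtain ⟨s, h2, h3⟩ := ((h1.filter_mono nhdsWithin_le_nhds).and
      (self_mem_nhdsWithin (s := Ioi (0 : ℝ)))).exists
    exact hP s h3 h2

theorem int_eq_neg_one_or_zero {r : ℝ} (h0 : 0 ≤ r) (h1 : r ≤ 1) {i : ℤ} (h : -r = i) :
    i = -1 ∨ i = 0 := by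
  have h2 : (-1 : ℝ) ≤ i := by linarith
  have h3 : (i : ℝ) ≤ 0 := by linarith
  have h2' : -1 ≤ i := by exact_mod_cast h2
  have h3' : i ≤ 0 := by exact_mod_cast h3
  omega

/-- Let i be the value of the displacement. If b = -1, integrality forces τ ∈ {0, 1}, and the radial
curve in the stable manifold leaves P through a horizontal side. If a + b - i₂ = -1, then r ∈ {0,
1}, and the horizontal line in the stable manifold leaves through the left or the slanted side. In
all other cases i₁, a + b - i₂ - i₁, i₂ and b - i₂ are nonnegative, and they are the exponents. -/
theorem exists_cox_of_isGen {L L' : ℤ × ℤ} (hA : Acyclic (L' - L)) {V : Set (ℝ × ℝ)}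
    (hV : IsGen L L' V) : ∃ κ : Cox, κ.deg = L' - L ∧ V = κ.cell := by
  obtain ⟨⟨x, hx, rfl⟩, v, hv, hev⟩ := hV
  rw [connectedComponentIn_inter hx] at hv ⊢
  obtain ⟨-, i, hi⟩ := hx
  rw [disp_eq] at hi
  rw [hi] at hv ⊢
  obtain ⟨hvP, hvi⟩ := hv
  have r0 := rr_nonneg hvP
  have r1 := rr_le_one hvP
  have t0 := tt_nonneg hvP
  have t1 := tt_le_one hvP
  have h4 := snd_lt_of_mem hvP
  have hvi' := hvi
  rw [lagr_eq, Prod.mk.injEq] at hvi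
  obtain ⟨i1, i2⟩ := hvi
  have i1' : rr v * ((L' - L).1 + (L' - L).2 - i.2) = i.1 := by
    rw [← i1, ← i2]
    ring
  by_cases hb : (L' - L).2 = -1
  · exfalso
    revert hev
    refine not_eventually_mem_P (f := fun s => (rr v * (4 - (v.2 + s)), v.2 + s))
      (by fun_prop) ?_ (fun s hs => radial_mem_stable hvP hb hs) ?_
    · ext
      · simp only [add_zero, rr]
        rw [div_mul_cancel₀]
        linarith
      · simp
    · rw [hb] at i2
      rcases int_eq_neg_one_or_zero t0 t1 (i := i.2) (by rw [← i2]; push_cast; ring) with h | h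
      · right
        rintro s hs ⟨-, -, -, h'⟩
        rw [h, tt] at i2
        push_cast at i2
        simp only at h'
        linarith
      · left
        rintro s hs ⟨-, -, h', -⟩
        rw [h, tt] at i2
        push_cast at i2
        simp only at h'
        linarith
  obtain ⟨ha, hb⟩ := hA.resolve_left hb
  have b0 : (0 : ℝ) ≤ (L' - L).2 := by rcases hb with h | h <;> rw [h] <;> norm_num
  have hk2 : 0 ≤ i.2 := by
    have : (0 : ℝ) ≤ i.2 := i2 ▸ mul_nonneg b0 t0
    exact_mod_cast this
  have hl2 : 0 ≤ (L' - L).2 - i.2 := by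
    have : (0 : ℝ) ≤ (L' - L).2 - i.2 := by nlinarith
    exact_mod_cast this
  by_cases hn : (L' - L).1 + (L' - L).2 - i.2 = -1
  · exfalso
    have hn' : ((L' - L).1 + (L' - L).2 - i.2 : ℝ) = -1 := by exact_mod_cast hn
    revert hev
    refine not_eventually_mem_P (f := fun s => (v.1 + s, v.2)) (by fun_prop) (by simp)
      (fun s _ => horizontal_mem_stable hvP (by rw [hvi']; exact hn') s) ?_
    rw [hn'] at i1'
    have e4 : 4 - v.2 ≠ 0 := by linarith
    rcases int_eq_neg_one_or_zero r0 r1 (i := i.1) (by rw [← i1']; ring) with h | h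
    · right
      rintro s hs ⟨-, h', -⟩
      rw [h, rr] at i1'
      push_cast at i1'
      have : v.1 / (4 - v.2) = 1 := by linarith
      rw [div_eq_one_iff_eq e4] at this
      simp only at h'
      linarith
    · left
      rintro s hs ⟨h', -⟩
      rw [h, rr] at i1'
      push_cast at i1'
      have : v.1 / (4 - v.2) = 0 := by linarith
      rw [div_eq_zero_iff] at this
      have := this.resolve_right e4
      simp only at h'
      linarith
  have hn0 : 0 ≤ (L' - L).1 + (L' - L).2 - i.2 := by omega
  have hn0' : (0 : ℝ) ≤ (L' - L).1 + (L' - L).2 - i.2 := by exact_mod_cast hn0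
  have hk1 : 0 ≤ i.1 := by
    have : (0 : ℝ) ≤ i.1 := i1' ▸ mul_nonneg r0 hn0'
    exact_mod_cast this
  have hl1 : 0 ≤ (L' - L).1 + (L' - L).2 - i.2 - i.1 := by
    have : (0 : ℝ) ≤ (L' - L).1 + (L' - L).2 - i.2 - i.1 := by nlinarith
    exact_mod_cast this
  obtain ⟨k₁, e1⟩ := Int.eq_ofNat_of_zero_le hk1
  obtain ⟨l₁, e2⟩ := Int.eq_ofNat_of_zero_le hl1
  obtain ⟨k₂, e3⟩ := Int.eq_ofNat_of_zero_le hk2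
  obtain ⟨l₂, e4⟩ := Int.eq_ofNat_of_zero_le hl2
  have hdeg : (⟨k₁, l₁, k₂, l₂⟩ : Cox).deg = L' - L := by
    ext <;> simp only [Cox.deg] <;> omega
  refine ⟨⟨k₁, l₁, k₂, l₂⟩, hdeg, ?_⟩
  rw [Cox.cell_eq, hdeg, e1, e3]
  simp

/-! ### The metric along edges -/

/-- Up to the factor 4 this is the variance of a Bernoulli variable with parameter r plus the
covariance form of a three-point distribution with weights σ, τ and 1 - σ - τ = (1-τ)(1-r), written
as a sum over pairs of outcomes. -/
theorem cometric_nonneg {x : ℝ × ℝ} (hx : x ∈ P) (ξ : ℝ × ℝ) : 0 ≤ cometric x ξ := by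
  have r0 := rr_nonneg hx
  have r1 : 0 ≤ 1 - rr x := sub_nonneg.2 (rr_le_one hx)
  have t0 := tt_nonneg hx
  have t1 : 0 ≤ 1 - tt x := sub_nonneg.2 (tt_le_one hx)
  have h4 : 4 - x.2 ≠ 0 := by linarith [hx.2.2.2]
  have e : cometric x ξ = 4 * (rr x * (1 - rr x) * ξ.1 ^ 2
      + rr x * (1 - tt x) * ((1 - tt x) * (1 - rr x)) * ξ.1 ^ 2
      + tt x * ((1 - tt x) * (1 - rr x)) * ξ.2 ^ 2
      + rr x * (1 - tt x) * tt x * (ξ.1 - ξ.2) ^ 2) := by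
    have e' : x.1 * (2 - x.2) / (2 * (4 - x.2)) = rr x * (1 - tt x) := by
      rw [rr, tt]
      field_simp
    simp only [cometric, e']
    rw [← rr, ← tt]
    ring
  rw [e]
  positivity

theorem metricSq_zero {x : ℝ × ℝ} (hx : x ∈ P) : metricSq x 0 = 0 := by
  refine le_antisymm (iSup_le fun ξ => ?_) zero_le
  rw [ENNReal.ofReal_of_nonpos]
  have := cometric_nonneg hx ξ
  simpa using this

/-- On a horizontal side τ is 0 or 1, so only the ξ₁² term of the cometric survives, and the
supremum is that of a quadratic polynomial in one variable, attained at ξ₁ = w/K. -/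
theorem metricSq_horizontal {x : ℝ × ℝ} (h : x.2 = 0 ∨ x.2 = 2) (h0 : 0 < rr x) (h1 : rr x < 1)
    (w : ℝ) : metricSq x (w, 0)
      = ENNReal.ofReal (w ^ 2 / (2 * (4 - x.2) * (rr x * (1 - rr x)))) := by
  have hr : 0 < rr x * (1 - rr x) := mul_pos h0 (by linarith)
  have hK : 0 < 2 * (4 - x.2) * (rr x * (1 - rr x)) := by
    rcases h with h | h <;> rw [h] <;> linarith
  have e (ξ : ℝ × ℝ) : cometric x ξ = 2 * (4 - x.2) * (rr x * (1 - rr x)) * ξ.1 ^ 2 := by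
    rcases h with h | h
    · simp only [cometric, rr, h]
      ring
    · simp only [cometric, rr, h]
      ring
  simp only [metricSq, e]
  generalize 2 * (4 - x.2) * (rr x * (1 - rr x)) = K at *
  refine le_antisymm (iSup_le fun ξ => ENNReal.ofReal_le_ofReal ?_) ?_
  · rw [le_div_iff₀ hK]
    nlinarith [sq_nonneg (K * ξ.1 - w)]
  · refine le_iSup_of_le (w / K, 0) (ENNReal.ofReal_le_ofReal (le_of_eq ?_))
    simp only
    field_simp
    ring

/-- A nonnegative derivative of a function with a limit is automatically integrable; reflection in t
reduces this to the positive half-line. -/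
theorem lintegral_Iic_of_hasDerivAt {f f' : ℝ → ℝ} {l : ℝ}
    (hf : ∀ t ≤ 0, HasDerivAt f (f' t) t) (h0 : ∀ t ≤ 0, 0 ≤ f' t)
    (hl : Tendsto f atBot (𝓝 l)) :
    ∫⁻ t in Iic (0 : ℝ), ENNReal.ofReal (f' t) = ENNReal.ofReal (f 0 - l) := by
  have hi : IntegrableOn f' (Iic 0) := by
    have h1 : IntegrableOn (fun t => f' (-t)) (Ioi 0) := by
      refine integrableOn_Ioi_deriv_of_nonneg' (g := fun t => -f (-t)) (l := -l) ?_
        (fun t ht => h0 _ (by simpa using (mem_Ioi.1 ht).le)) ?_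
      · intro t ht
        have h2 := (hf (-t) (by simpa using ht)).comp t (hasDerivAt_neg t)
        exact h2.neg.congr_deriv (by ring)
      · exact (hl.comp tendsto_neg_atTop_atBot).neg
    have h2 : IntegrableOn (fun t => f' (-t)) (Ioi (-0)) := by simpa using h1
    have h3 := h2.comp_neg_Iio
    simp only [neg_neg] at h3
    exact (integrableOn_Iic_iff_integrableOn_Iio (by simp)).2 h3
  rw [← ofReal_integral_eq_lintegral_ofReal hi
    ((ae_restrict_iff' measurableSet_Iic).2 (ae_of_all _ fun t ht => h0 t ht)),
    integral_Iic_of_hasDerivAt_of_tendsto' (fun t ht => hf t ht) hi hl]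

/-- Here ρ' = ((k+l)ρ - k)/m, so the integrand is the derivative of -½(k log ρ + l log(1-ρ)). The
trajectory starts at the maximum of the Bernstein polynomial, and the total change is minus the
logarithm of the normalized root at r. -/
theorem lintegral_logistic {k l : ℕ} {r m : ℝ} (hm : 0 < m) (h0 : 0 < r) (h1 : r < 1)
    (hn : (0 : ℝ) < k + l) {ρ : ℝ → ℝ}
    (hρ : ρ = fun t => k / (k + l) + (r - k / (k + l)) * Real.exp ((k + l) / m * t)) :
    ∫⁻ t in Iic (0 : ℝ), ENNReal.ofReal ((((k : ℝ) + l) * ρ t - k) ^ 2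
        / (2 * m * (ρ t * (1 - ρ t))))
      = ENNReal.ofReal (-Real.log (peak k l r)) := by
  have hρd (t : ℝ) : HasDerivAt ρ ((((k : ℝ) + l) * ρ t - k) / m) t := by
    rw [hρ]
    refine ((((hasDerivAt_id t).const_mul (((k : ℝ) + l) / m)).exp.const_mul
      (r - k / (k + l))).const_add _).congr_deriv ?_
    simp only [id]
    field_simp
    ring
  have k0 : 0 ≤ (k : ℝ) / (k + l) := by positivity
  have k1 : (k : ℝ) / (k + l) ≤ 1 := div_le_one_of_le₀ (by simp) hn.le
  have hpos (t : ℝ) (ht : t ≤ 0) : 0 < ρ t ∧ ρ t < 1 := by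
    have e0 := Real.exp_pos ((k + l) / m * t)
    have e1 : Real.exp ((k + l) / m * t) ≤ 1 :=
      Real.exp_le_one_iff.2 (mul_nonpos_of_nonneg_of_nonpos (by positivity) ht)
    rw [hρ]
    simp only
    generalize Real.exp ((k + l) / m * t) = E at *
    constructor
    · nlinarith [mul_pos h0 e0, mul_nonneg k0 (sub_nonneg.2 e1)]
    · nlinarith [mul_pos (sub_pos.2 h1) e0, mul_nonneg (sub_nonneg.2 k1) (sub_nonneg.2 e1)]
  have hρl : Tendsto ρ atBot (𝓝 (k / (k + l))) := by
    have h2 : Tendsto (fun t : ℝ => Real.exp ((k + l) / m * t)) atBot (𝓝 0) :=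
      Real.tendsto_exp_atBot.comp (tendsto_id.const_mul_atBot (by positivity))
    rw [hρ]
    simpa using (h2.const_mul (r - k / (k + l))).const_add ((k : ℝ) / (k + l))
  have hρ0 : ρ 0 = r := by simp [hρ]
  rw [lintegral_Iic_of_hasDerivAt
    (f := fun t => -(1 / 2) * (k * Real.log (ρ t) + l * Real.log (1 - ρ t)))
    (l := -(1 / 2) * (k * Real.log (k / (k + l)) + l * Real.log (1 - k / (k + l))))]
  · simp only [hρ0]
    rw [neg_log_peak h0 h1]
    congr 1
    ring
  · intro t ht
    obtain ⟨p0, p1⟩ := hpos t ht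
    have q1 : 0 < 1 - ρ t := by linarith
    refine ((((hρd t).log p0.ne').const_mul (k : ℝ)).add
      ((((hρd t).const_sub 1).log q1.ne').const_mul (l : ℝ)) |>.const_mul (-(1 / 2))).congr_deriv ?_
    field_simp
    ring
  · intro t ht
    obtain ⟨p0, p1⟩ := hpos t ht
    have q1 : 0 < 1 - ρ t := by linarith
    positivity
  · refine Tendsto.const_mul _ (Tendsto.add ?_ ?_)
    -- For k = 0 the argument of the logarithm tends to 0, but the coefficient k removes the term;
    -- likewise for l = 0 below.
    · rcases Nat.eq_zero_or_pos k with rfl | hk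
      · simp
      · exact (hρl.log (by positivity)).const_mul _
    · rcases Nat.eq_zero_or_pos l with rfl | hl
      · simp
      · refine ((hρl.const_sub 1).log ?_).const_mul _
        have : 1 - (k : ℝ) / (k + l) = l / (k + l) := by field_simp; ring
        rw [this]
        positivity

/-! ### Edges of gradient trees -/

namespace Cox

/-- The starting point of the trajectory through `x`. -/
def edgeStart (κ : Cox) (x : ℝ × ℝ) : ℝ × ℝ :=
  -- If k₁ + l₁ = 0, the flow in x¹ is stationary and the trajectory is constant.
  (if κ.k₁ + κ.l₁ = 0 then x.1 else κ.k₁ / (κ.k₁ + κ.l₁) * (4 - x.2), x.2)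

/-- The trajectory that reaches `x` at time `0`, continued constantly. -/
def edge (κ : Cox) (x : ℝ × ℝ) (t : ℝ) : ℝ × ℝ :=
  ((κ.edgeStart x).1 + (x.1 - (κ.edgeStart x).1)
    * Real.exp ((κ.k₁ + κ.l₁) / (4 - x.2) * min t 0), x.2)

variable {κ : Cox} {L L' : ℤ × ℤ} {x : ℝ × ℝ}

theorem edgeStart_mem (hx : x ∈ P) (h2 : ((κ.k₂ : ℝ) + κ.l₂) * tt x = κ.k₂) :
    κ.edgeStart x ∈ κ.cell := by
  have h4 : 0 < 4 - x.2 := by linarith [hx.2.2.2]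
  by_cases hn : κ.k₁ + κ.l₁ = 0
  · have e : κ.edgeStart x = x := by simp [edgeStart, hn]
    obtain ⟨a, b⟩ : κ.k₁ = 0 ∧ κ.l₁ = 0 := by omega
    rw [e]
    exact ⟨hx, by simp [a, b], h2⟩
  · have hn' : (0 : ℝ) < κ.k₁ + κ.l₁ := by exact_mod_cast Nat.pos_of_ne_zero hn
    have e : rr (κ.edgeStart x) = κ.k₁ / (κ.k₁ + κ.l₁) := by
      simp only [edgeStart, hn, if_false, rr]
      exact mul_div_cancel_right₀ _ h4.ne'
    refine ⟨⟨?_, ?_, hx.2.2⟩, ?_, h2⟩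
    · simp only [edgeStart, hn, if_false]
      positivity
    · simp only [edgeStart, hn, if_false]
      exact mul_le_of_le_one_left h4.le (div_le_one_of_le₀ (by simp) hn'.le)
    · rw [e]
      field_simp

theorem edge_zero : κ.edge x 0 = x := by
  simp [edge]

theorem edge_of_nonneg {t : ℝ} (ht : 0 ≤ t) : κ.edge x t = κ.edge x 0 := by
  simp [edge, ht]

theorem edge_mem (hx : x ∈ P) (h2 : ((κ.k₂ : ℝ) + κ.l₂) * tt x = κ.k₂) (t : ℝ) :
    κ.edge x t ∈ P := by
  have h4 : 0 < 4 - x.2 := by linarith [hx.2.2.2]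
  have e0 := Real.exp_pos ((κ.k₁ + κ.l₁) / (4 - x.2) * min t 0)
  have e1 : Real.exp ((κ.k₁ + κ.l₁) / (4 - x.2) * min t 0) ≤ 1 :=
    Real.exp_le_one_iff.2 (mul_nonpos_of_nonneg_of_nonpos (by positivity) (min_le_right _ _))
  -- A point of the edge is a convex combination of its start and end, the exponential being the
  -- weight of the end.
  have := convex_P (edgeStart_mem hx h2).1 hx (sub_nonneg.2 e1) e0.le (by ring)
  convert! this using 1
  ext
  · simp only [edge, Prod.fst_add, Prod.smul_fst, smul_eq_mul]
    ring
  · simp only [edge, edgeStart, Prod.snd_add, Prod.smul_snd, smul_eq_mul]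
    ring

theorem gradField_edge (hκ : κ.deg = L' - L) (hx : x ∈ P)
    (h2 : ((κ.k₂ : ℝ) + κ.l₂) * tt x = κ.k₂) (t : ℝ) :
    gradField L L' (κ.edgeStart x) (κ.edge x t) =
      ((κ.k₁ + κ.l₁) / (4 - x.2) * ((κ.edge x t).1 - (κ.edgeStart x).1), 0) := by
  ext
  · exact gradField_fst hκ (edgeStart_mem hx h2) rfl
  · rw [gradField_snd hκ]
    simp [edge, edgeStart]

theorem hasDerivWithinAt_edge (hκ : κ.deg = L' - L) (hx : x ∈ P)
    (h2 : ((κ.k₂ : ℝ) + κ.l₂) * tt x = κ.k₂) {t : ℝ} (ht : t ≤ 0) :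
    HasDerivWithinAt (κ.edge x) (gradField L L' (κ.edgeStart x) (κ.edge x t)) (Iic 0) t := by
  have h := ((((hasDerivAt_id t).const_mul (((κ.k₁ : ℝ) + κ.l₁) / (4 - x.2))).exp.const_mul
      (x.1 - (κ.edgeStart x).1)).const_add (κ.edgeStart x).1).prodMk (hasDerivAt_const t x.2)
  rw [gradField_edge hκ hx h2]
  refine (h.hasDerivWithinAt.congr_of_mem (s := Iic 0) (fun s hs => ?_) ht).congr_deriv ?_
  · simp [edge, mem_Iic.1 hs]
  · ext
    · simp only [edge, min_eq_left ht, id]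
      ring
    · rfl

theorem tendsto_edge (hx : x ∈ P) : Tendsto (κ.edge x) atBot (𝓝 (κ.edgeStart x)) := by
  have h4 : 0 < 4 - x.2 := by linarith [hx.2.2.2]
  by_cases hn : κ.k₁ + κ.l₁ = 0
  · obtain ⟨a, b⟩ : κ.k₁ = 0 ∧ κ.l₁ = 0 := by omega
    refine tendsto_const_nhds.congr fun t => ?_
    simp [edge, edgeStart, hn]
  · have hn' : (0 : ℝ) < κ.k₁ + κ.l₁ := by exact_mod_cast Nat.pos_of_ne_zero hn
    have h1 : Tendsto (fun t : ℝ => min t 0) atBot atBot :=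
      tendsto_atBot_mono (fun t => min_le_left t 0) tendsto_id
    have h2 : Tendsto (fun t : ℝ => Real.exp ((κ.k₁ + κ.l₁) / (4 - x.2) * min t 0)) atBot (𝓝 0) :=
      Real.tendsto_exp_atBot.comp (h1.const_mul_atBot (by positivity))
    have h3 := ((h2.const_mul (x.1 - (κ.edgeStart x).1)).const_add
      (κ.edgeStart x).1).prodMk_nhds (tendsto_const_nhds (x := x.2))
    simp only [mul_zero, add_zero] at h3
    exact h3

/-- Uniqueness of the trajectory ending at a point on the right level of `x²`. -/
theorem eq_edge (hκ : κ.deg = L' - L) (h2 : ((κ.k₂ : ℝ) + κ.l₂) * tt x = κ.k₂)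
    {v : ℝ × ℝ} (hv : v ∈ κ.cell) {e : ℝ → ℝ × ℝ} (h0 : e 0 = x)
    (he : ∀ t ≤ 0, HasDerivWithinAt e (gradField L L' v (e t)) (Iic 0) t)
    (hl : Tendsto e atBot (𝓝 v)) (hext : ∀ t, 0 ≤ t → e t = e 0) :
    v = κ.edgeStart x ∧ e = κ.edge x := by
  have e2 := fun t (ht : t ≤ 0) => eq_exp_of_hasDerivWithinAt (convex_Iic 0) (uniqueDiffOn_Iic 0)
    self_mem_Iic (y := fun t => (e t).2) (c := ((κ.k₂ : ℝ) + κ.l₂) / 2) (y₀ := v.2)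
    (fun t ht => by
      have := (he t ht).prod_snd
      rwa [Cox.gradField_snd hκ] at this) (mem_Iic.2 ht)
  have hv2 : x.2 = v.2 := by
    by_cases hb : ((κ.k₂ : ℝ) + κ.l₂) = 0
    · have h3 : Tendsto (fun t => (e t).2) atBot (𝓝 x.2) := by
        refine tendsto_const_nhds.congr' ?_
        filter_upwards [eventually_le_atBot 0] with t ht
        have := e2 t ht
        simp only [hb, h0] at this
        rw [this]
        simp
      exact tendsto_nhds_unique h3 hl.snd_nhds
    · have := mul_left_cancel₀ hb (hv.2.2.trans h2.symm)
      simp only [tt] at this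
      linarith
  have c2 : ∀ t ≤ 0, (e t).2 = v.2 := fun t ht => by
    have := e2 t ht
    simp only [h0, hv2, sub_self, zero_mul, add_zero] at this
    exact this
  have e1 := fun t (ht : t ≤ 0) => eq_exp_of_hasDerivWithinAt (convex_Iic 0) (uniqueDiffOn_Iic 0)
    self_mem_Iic (y := fun t => (e t).1) (c := ((κ.k₁ : ℝ) + κ.l₁) / (4 - v.2)) (y₀ := v.1)
    (fun t ht => by
      have := (he t ht).prod_fst
      rwa [Cox.gradField_fst hκ hv (c2 t ht)] at this) (mem_Iic.2 ht)
  have h4 : 4 - v.2 ≠ 0 := by linarith [hv.1.2.2.2]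
  have hs : v = κ.edgeStart x := by
    ext
    · simp only [edgeStart]
      split_ifs with hn
      · obtain ⟨a, b⟩ : κ.k₁ = 0 ∧ κ.l₁ = 0 := by omega
        have h3 : Tendsto (fun t => (e t).1) atBot (𝓝 x.1) := by
          refine tendsto_const_nhds.congr' ?_
          filter_upwards [eventually_le_atBot 0] with t ht
          have := e1 t ht
          simp only [a, b, h0] at this
          rw [this]
          simp
        exact tendsto_nhds_unique hl.fst_nhds h3
      · have hn' : (κ.k₁ : ℝ) + κ.l₁ ≠ 0 := by exact_mod_cast hn
        have h3 := hv.2.1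
        rw [rr] at h3
        rw [hv2]
        field_simp at h3 ⊢
        linarith
    · exact hv2.symm
  refine ⟨hs, funext fun t => ?_⟩
  have key : ∀ t ≤ 0, e t = κ.edge x t := fun t ht => by
    ext
    · have := e1 t ht
      simp only [h0, ← hv2] at this
      rw [this, hs, edge, min_eq_left ht]
    · rw [c2 t ht, ← hv2, edge]
  rcases le_total t 0 with ht | ht
  · exact key t ht
  · rw [hext t ht, key 0 le_rfl, edge_of_nonneg ht]

/-- A constant edge has area 0 and height 1 at x. Otherwise the edge lies in a horizontal side,
where the metric is one-dimensional and `lintegral_logistic` applies to r along the edge. -/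
theorem lintegral_edge (hκ : κ.deg = L' - L) (hx : x ∈ P)
    (h2 : ((κ.k₂ : ℝ) + κ.l₂) * tt x = κ.k₂)
    (h : ((κ.k₁ : ℝ) + κ.l₁) * rr x = κ.k₁ ∨ ((0 < rr x ∧ rr x < 1) ∧ (x.2 = 0 ∨ x.2 = 2))) :
    ∫⁻ t in Iic (0 : ℝ), metricSq (κ.edge x t) (gradField L L' (κ.edgeStart x) (κ.edge x t))
      = ENNReal.ofReal (-Real.log (κ.height x)) := by
  have h4 : 0 < 4 - x.2 := by linarith [hx.2.2.2]
  by_cases hk : ((κ.k₁ : ℝ) + κ.l₁) * rr x = κ.k₁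
  · have hs : κ.edgeStart x = x := by
      ext
      · simp only [edgeStart]
        split_ifs with hn
        · rfl
        · have hn' : (κ.k₁ : ℝ) + κ.l₁ ≠ 0 := by exact_mod_cast hn
          rw [rr] at hk
          field_simp at hk ⊢
          linarith
      · rfl
    have e (t : ℝ) : κ.edge x t = x := by simp [edge, hs]
    simp only [e, hs, gradField_self, metricSq_zero hx]
    rw [κ.height_eq_one ⟨hx, hk, h2⟩]
    simp
  obtain ⟨⟨r0, r1⟩, hq⟩ := h.resolve_left hk
  have hn : κ.k₁ + κ.l₁ ≠ 0 := by
    intro hn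
    obtain ⟨a, b⟩ : κ.k₁ = 0 ∧ κ.l₁ = 0 := by omega
    simp [a, b] at hk
  have hn' : (0 : ℝ) < κ.k₁ + κ.l₁ := by exact_mod_cast Nat.pos_of_ne_zero hn
  have hs : (κ.edgeStart x).1 = κ.k₁ / (κ.k₁ + κ.l₁) * (4 - x.2) := by
    simp only [edgeStart, hn, if_false]
  set ρ : ℝ → ℝ := fun t => κ.k₁ / (κ.k₁ + κ.l₁) + (rr x - κ.k₁ / (κ.k₁ + κ.l₁))
    * Real.exp ((κ.k₁ + κ.l₁) / (4 - x.2) * t) with hρ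
  have hr (t : ℝ) (ht : t ≤ 0) : rr (κ.edge x t) = ρ t := by
    simp only [hρ, edge, rr, hs, min_eq_left ht]
    field_simp
  have hpos (t : ℝ) (ht : t ≤ 0) : 0 < ρ t ∧ ρ t < 1 := by
    have k0 : 0 ≤ (κ.k₁ : ℝ) / (κ.k₁ + κ.l₁) := by positivity
    have k1 : (κ.k₁ : ℝ) / (κ.k₁ + κ.l₁) ≤ 1 := div_le_one_of_le₀ (by simp) hn'.le
    have e0 := Real.exp_pos ((κ.k₁ + κ.l₁) / (4 - x.2) * t)
    have e1 : Real.exp ((κ.k₁ + κ.l₁) / (4 - x.2) * t) ≤ 1 :=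
      Real.exp_le_one_iff.2 (mul_nonpos_of_nonneg_of_nonpos (by positivity) ht)
    simp only [hρ]
    generalize Real.exp ((κ.k₁ + κ.l₁) / (4 - x.2) * t) = E at *
    constructor
    · nlinarith [mul_pos r0 e0, mul_nonneg k0 (sub_nonneg.2 e1)]
    · nlinarith [mul_pos (sub_pos.2 r1) e0, mul_nonneg (sub_nonneg.2 k1) (sub_nonneg.2 e1)]
  rw [height, peak_eq_one h2, mul_one, ← lintegral_logistic h4 r0 r1 hn' hρ]
  refine setLIntegral_congr_fun measurableSet_Iic fun t ht => ?_
  have ht' : t ≤ 0 := ht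
  obtain ⟨p0, p1⟩ := hpos t ht'
  have hg : (κ.k₁ + κ.l₁) / (4 - x.2) * ((κ.edge x t).1 - (κ.edgeStart x).1)
      = ((κ.k₁ : ℝ) + κ.l₁) * ρ t - κ.k₁ := by
    rw [← hr t ht', hs, rr]
    simp only [edge]
    field_simp
  rw [gradField_edge hκ hx h2, metricSq_horizontal (by exact hq) (by rwa [hr t ht'])
    (by rwa [hr t ht']), hr t ht', hg]
  rfl

end Cox

/-! ### Gradient trees -/

namespace Cox

variable {κ κ' : Cox} {x : ℝ × ℝ}

/-- As k₂ + l₂ ≤ 1 for the sum, one summand imposes no condition on τ and the other imposes that of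
the sum. So the root lies on the right level for both incoming edges, which are therefore
horizontal. -/
theorem tt_of_mem_add (hb : (κ + κ').k₂ + (κ + κ').l₂ ≤ 1) (hx : x ∈ (κ + κ').cell) :
    ((κ.k₂ : ℝ) + κ.l₂) * tt x = κ.k₂ ∧ ((κ'.k₂ : ℝ) + κ'.l₂) * tt x = κ'.k₂ := by
  have h := hx.2.2
  rw [add_k₂, add_l₂] at h hb
  push_cast at h
  rcases (by omega : κ.k₂ + κ.l₂ = 0 ∨ κ'.k₂ + κ'.l₂ = 0) with h0 | h0
  · obtain ⟨a, b⟩ : κ.k₂ = 0 ∧ κ.l₂ = 0 := by omega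
    simpa [a, b] using h
  · obtain ⟨a, b⟩ : κ'.k₂ = 0 ∧ κ'.l₂ = 0 := by omega
    simpa [a, b] using h

theorem exponents_add_comm (κ κ' : Cox) : κ + κ' = κ' + κ := by
  refine eq_of_deg_eq ?_ (Nat.add_comm _ _) (Nat.add_comm _ _)
  rw [deg_add, deg_add, add_comm]

/-- An edge of a tree ending in `x` is constant or runs in the interior of a horizontal side. -/
theorem rr_of_mem_add (hb : (κ + κ').k₂ + (κ + κ').l₂ ≤ 1)
    (hn : (κ + κ').k₂ + (κ + κ').l₂ = 0 → (κ + κ').k₁ + (κ + κ').l₁ ≤ 1)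
    (hx : x ∈ (κ + κ').cell) : ((κ.k₁ : ℝ) + κ.l₁) * rr x = κ.k₁ ∨
      ((0 < rr x ∧ rr x < 1) ∧ (x.2 = 0 ∨ x.2 = 2)) := by
  by_cases hk : ((κ.k₁ : ℝ) + κ.l₁) * rr x = κ.k₁
  · exact Or.inl hk
  have h1 := hx.2.1
  have h2 := hx.2.2
  rw [add_k₁, add_l₁] at h1
  push_cast at h1
  refine Or.inr ⟨⟨(rr_nonneg hx.1).lt_of_ne ?_, (rr_le_one hx.1).lt_of_ne ?_⟩, ?_⟩
  · intro h
    rw [← h, mul_zero] at h1 hk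
    have : κ.k₁ = 0 := by
      have : κ.k₁ + κ'.k₁ = 0 := by exact_mod_cast h1.symm
      omega
    simp [this] at hk
  · intro h
    rw [h, mul_one] at h1 hk
    have : κ.k₁ + κ'.k₁ + (κ.l₁ + κ'.l₁) = κ.k₁ + κ'.k₁ := by exact_mod_cast h1
    have : κ.l₁ = 0 := by omega
    simp [this] at hk
  · rcases Nat.eq_zero_or_pos ((κ + κ').k₂ + (κ + κ').l₂) with h0 | h0
    · exfalso
      have h3 := hn h0
      rw [add_k₁, add_l₁] at h3
      rcases (by omega : κ.k₁ + κ.l₁ = 0 ∨ κ'.k₁ + κ'.l₁ = 0) with h4 | h4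
      · obtain ⟨a, b⟩ : κ.k₁ = 0 ∧ κ.l₁ = 0 := by omega
        simp [a, b] at hk
      · obtain ⟨a, b⟩ : κ'.k₁ = 0 ∧ κ'.l₁ = 0 := by omega
        rw [a, b] at h1
        apply hk
        simpa using h1
    · rw [tt] at h2
      rcases (by omega : ((κ + κ').k₂ = 0 ∧ (κ + κ').l₂ = 1) ∨ ((κ + κ').k₂ = 1 ∧ (κ + κ').l₂ = 0))
        with ⟨a, b⟩ | ⟨a, b⟩ <;> rw [a, b] at h2 <;> push_cast at h2
      · left
        linarith
      · right
        linarith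

/-- Monomials may vanish on the boundary of P, but at a peak of the product the two heights multiply
to a positive structure constant. -/
theorem height_pos_of_mem_add (hx : x ∈ (κ + κ').cell) : 0 < κ.height x ∧ 0 < κ'.height x := by
  have h := κ.const_mul_const κ' hx
  have h1 : 0 < κ.height x * κ'.height x := h ▸ by
    have := κ.const_pos
    have := κ'.const_pos
    have := (κ + κ').const_pos
    positivity
  have h2 := κ.height_nonneg x
  have h3 := κ'.height_nonneg x
  exact ⟨h2.lt_of_ne fun e => by rw [← e] at h1; simp at h1,
    h3.lt_of_ne fun e => by rw [← e] at h1; simp at h1⟩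

theorem contDiffOn_edgeStart {S : Set ℝ} {X : ℝ → ℝ × ℝ} (hX : ContDiffOn ℝ ∞ X S) :
    ContDiffOn ℝ ∞ (fun q => κ.edgeStart (X q)) S := by
  unfold edgeStart
  refine ContDiffOn.prodMk ?_ hX.snd
  split_ifs
  · exact hX.fst
  · exact contDiffOn_const.mul (contDiffOn_const.sub hX.snd)

theorem contDiffOn_edge {S : Set ℝ} {X : ℝ → ℝ × ℝ} (hX : ContDiffOn ℝ ∞ X S)
    (hP : ∀ q ∈ S, X q ∈ P) :
    ContDiffOn ℝ ∞ (fun q : ℝ × ℝ => κ.edge (X q.1) q.2) (S ×ˢ Iic 0) := by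
  have hm : MapsTo Prod.fst (S ×ˢ Iic (0 : ℝ)) S := fun q hq => hq.1
  have h1 : ContDiffOn ℝ ∞ (fun q : ℝ × ℝ => X q.1) (S ×ˢ Iic 0) := hX.comp contDiffOn_fst hm
  have h2 : ContDiffOn ℝ ∞ (fun q : ℝ × ℝ => κ.edgeStart (X q.1)) (S ×ˢ Iic 0) :=
    (contDiffOn_edgeStart hX).comp contDiffOn_fst hm
  have h3 : ContDiffOn ℝ ∞ (fun q : ℝ × ℝ => (κ.k₁ + κ.l₁ : ℝ) / (4 - (X q.1).2) * q.2)
      (S ×ˢ Iic 0) :=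
    (contDiffOn_const.div (contDiffOn_const.sub h1.snd) fun q hq => by
      linarith [snd_lt_of_mem (hP q.1 hq.1)]).mul contDiffOn_snd
  refine ((h2.fst.add ((h1.fst.sub h2.fst).mul h3.exp)).prodMk h1.snd).congr fun q hq => ?_
  simp [edge, mem_Iic.1 hq.2]

end Cox

section Trees

variable {L1 L2 L3 : ℤ × ℤ} {V12 : Gen L1 L2} {V23 : Gen L2 L3} {V13 : Gen L1 L3}
  {κ κ' : Cox} {x : ℝ × ℝ}

theorem GTree.ext_of_eq {T T' : GTree V12 V23 V13} (h1 : T.v12 = T'.v12) (h2 : T.v23 = T'.v23)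
    (h3 : T.v13 = T'.v13) (h4 : T.e12 = T'.e12) (h5 : T.e23 = T'.e23) (h6 : T.e13 = T'.e13) :
    T = T' := by
  cases T
  cases T'
  simp only at h1 h2 h3 h4 h5 h6
  subst h1 h2 h3 h4 h5 h6
  rfl

/-- The tree with a given root. -/
def treeAt (hκ : κ.deg = L2 - L1) (hκ' : κ'.deg = L3 - L2) (h12 : V12.1 = κ.cell)
    (h23 : V23.1 = κ'.cell) (h13 : V13.1 = (κ + κ').cell)
    (hb : (κ + κ').k₂ + (κ + κ').l₂ ≤ 1) (x : ℝ × ℝ) (hx : x ∈ (κ + κ').cell) :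
    GTree V12 V23 V13 where
  v12 := κ.edgeStart x
  v23 := κ'.edgeStart x
  v13 := x
  e12 := κ.edge x
  e23 := κ'.edge x
  e13 _ := x
  mem12 := h12 ▸ Cox.edgeStart_mem hx.1 (Cox.tt_of_mem_add hb hx).1
  mem23 := h23 ▸ Cox.edgeStart_mem hx.1 (Cox.tt_of_mem_add hb hx).2
  mem13 := h13 ▸ hx
  index := by
    have m1 := Cox.edgeStart_mem hx.1 (Cox.tt_of_mem_add hb hx).1
    have m2 := Cox.edgeStart_mem hx.1 (Cox.tt_of_mem_add hb hx).2
    have hd : (κ + κ').deg = L3 - L1 := by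
      rw [Cox.deg_add, hκ, hκ']
      abel
    rw [disp_eq, disp_eq, disp_eq, ← hd, ← hκ, ← hκ', (Cox.mem_cell_iff hx.1).1 hx,
      (Cox.mem_cell_iff m1.1).1 m1, (Cox.mem_cell_iff m2.1).1 m2, Cox.add_k₁, Cox.add_k₂]
    simp
  flow12 t ht := ⟨Cox.edge_mem hx.1 (Cox.tt_of_mem_add hb hx).1 t,
    Cox.hasDerivWithinAt_edge hκ hx.1 (Cox.tt_of_mem_add hb hx).1 ht⟩
  flow23 t ht := ⟨Cox.edge_mem hx.1 (Cox.tt_of_mem_add hb hx).2 t,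
    Cox.hasDerivWithinAt_edge hκ' hx.1 (Cox.tt_of_mem_add hb hx).2 ht⟩
  flow13 t _ := ⟨hx.1, by
    rw [gradField_self]
    exact hasDerivWithinAt_const _ _ _⟩
  start12 := Cox.tendsto_edge hx.1
  start23 := Cox.tendsto_edge hx.1
  end13 := tendsto_const_nhds
  vertex12 := Cox.edge_zero
  vertex23 := Cox.edge_zero
  ext12 _ ht := Cox.edge_of_nonneg ht
  ext23 _ ht := Cox.edge_of_nonneg ht
  ext13 _ _ := rfl

/-- On cells the displacements are the exponents, so the lifting condition says that exponents add.
-/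
theorem GTree.eq_add (T : GTree V12 V23 V13) {κ'' : Cox} (hκ : κ.deg = L2 - L1)
    (hκ' : κ'.deg = L3 - L2) (hκ'' : κ''.deg = L3 - L1) (h12 : V12.1 = κ.cell)
    (h23 : V23.1 = κ'.cell) (h13 : V13.1 = κ''.cell) : κ'' = κ + κ' := by
  have m1 : T.v12 ∈ κ.cell := h12 ▸ T.mem12
  have m2 : T.v23 ∈ κ'.cell := h23 ▸ T.mem23
  have m3 : T.v13 ∈ κ''.cell := h13 ▸ T.mem13
  have h := T.index
  rw [disp_eq, disp_eq, disp_eq, ← hκ'', ← hκ, ← hκ', (Cox.mem_cell_iff m3.1).1 m3,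
    (Cox.mem_cell_iff m1.1).1 m1, (Cox.mem_cell_iff m2.1).1 m2, Prod.mk_add_mk,
    Prod.mk.injEq] at h
  refine Cox.eq_of_deg_eq ?_ (by exact_mod_cast h.1) (by exact_mod_cast h.2)
  rw [Cox.deg_add, hκ, hκ', hκ'']
  abel

variable (hκ : κ.deg = L2 - L1) (hκ' : κ'.deg = L3 - L2) (h12 : V12.1 = κ.cell)
  (h23 : V23.1 = κ'.cell) (h13 : V13.1 = (κ + κ').cell)
  (hb : (κ + κ').k₂ + (κ + κ').l₂ ≤ 1)

/-- The root edge is constant, since no nonconstant trajectory ends in a cell. The incoming edges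
are then trajectories reaching the known point `T.v13`, and `Cox.eq_edge` determines them. -/
theorem GTree.eq_treeAt (T : GTree V12 V23 V13) :
    T = treeAt hκ hκ' h12 h23 h13 hb T.v13 (h13 ▸ T.mem13) := by
  have hd : (κ + κ').deg = L3 - L1 := by
    rw [Cox.deg_add, hκ, hκ']
    abel
  have hx : T.v13 ∈ (κ + κ').cell := h13 ▸ T.mem13
  have c := Cox.forward_const hd hx (fun t ht => (T.flow13 t ht).2) T.end13
  have c0 := c 0 le_rfl
  obtain ⟨a1, a2⟩ := Cox.eq_edge hκ (Cox.tt_of_mem_add hb hx).1 (h12 ▸ T.mem12)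
    (T.vertex12.trans c0) (fun t ht => (T.flow12 t ht).2) T.start12 T.ext12
  obtain ⟨b1, b2⟩ := Cox.eq_edge hκ' (Cox.tt_of_mem_add hb hx).2 (h23 ▸ T.mem23)
    (T.vertex23.trans c0) (fun t ht => (T.flow23 t ht).2) T.start23 T.ext23
  refine GTree.ext_of_eq a1 b1 rfl a2 b2 (funext fun t => ?_)
  rcases le_total t 0 with ht | ht
  · exact (T.ext13 t ht).trans c0
  · exact c t ht

theorem treeAt_congr {x y : ℝ × ℝ} (h : x = y) (hx : x ∈ (κ + κ').cell) :
    treeAt hκ hκ' h12 h23 h13 hb x hx = treeAt hκ hκ' h12 h23 h13 hb y (h ▸ hx) := by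
  subst h
  rfl

include hκ hκ' h12 h23 h13 hb

theorem GTree.homotopic (T T' : GTree V12 V23 V13) : T.Homotopic T' := by
  have hx : T.v13 ∈ (κ + κ').cell := h13 ▸ T.mem13
  have hx' : T'.v13 ∈ (κ + κ').cell := h13 ▸ T'.mem13
  -- A homotopy is a family over all of ℝ, while the segment between the roots stays in the cell
  -- only for parameters in [0, 1]; hence the truncation.
  let s : ℝ → ℝ := fun q => max 0 (min q 1)
  have s0 (q : ℝ) : 0 ≤ s q := le_max_left _ _
  have s1 (q : ℝ) : s q ≤ 1 := max_le zero_le_one (min_le_right _ _)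
  let X : ℝ → ℝ × ℝ := fun q => (1 - s q) • T.v13 + s q • T'.v13
  have hX (q : ℝ) : X q ∈ (κ + κ').cell :=
    (κ + κ').convex_cell hx hx' (sub_nonneg.2 (s1 q)) (s0 q) (by ring)
  have e0 : X 0 = T.v13 := by simp [X, s]
  have e1 : X 1 = T'.v13 := by simp [X, s]
  have hXd : ContDiffOn ℝ ∞ X (Icc 0 1) := by
    have : ContDiffOn ℝ ∞ (fun q : ℝ => (1 - q) • T.v13 + q • T'.v13) (Icc 0 1) :=
      ContDiff.contDiffOn (by fun_prop)
    refine this.congr fun q hq => ?_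
    simp [X, s, hq.1, hq.2]
  refine ⟨fun q => treeAt hκ hκ' h12 h23 h13 hb (X q) (hX q), ?_, ?_, ?_, ?_, ?_, ?_, ?_, ?_⟩
  · rw [T.eq_treeAt hκ hκ' h12 h23 h13 hb]
    exact treeAt_congr hκ hκ' h12 h23 h13 hb e0 (hX 0)
  · rw [T'.eq_treeAt hκ hκ' h12 h23 h13 hb]
    exact treeAt_congr hκ hκ' h12 h23 h13 hb e1 (hX 1)
  · exact Cox.contDiffOn_edgeStart hXd
  · exact Cox.contDiffOn_edgeStart hXd
  · exact hXd
  · exact Cox.contDiffOn_edge hXd fun q _ => (hX q).1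
  · exact Cox.contDiffOn_edge hXd fun q _ => (hX q).1
  · exact hXd.comp contDiffOn_fst fun q hq => hq.1

/-- The root edge contributes nothing, and each incoming edge contributes minus the logarithm of its
height at the root. The product of the heights is the same at every point of the cell of the
product, so the area does not depend on the root. -/
theorem GTree.area_eq
    (hn : (κ + κ').k₂ + (κ + κ').l₂ = 0 → (κ + κ').k₁ + (κ + κ').l₁ ≤ 1)
    (T : GTree V12 V23 V13) :
    T.area = ENNReal.ofReal (-Real.log (κ.const * κ'.const / (κ + κ').const)) := by
  have hx : T.v13 ∈ (κ + κ').cell := h13 ▸ T.mem13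
  have hc : κ' + κ = κ + κ' := Cox.exponents_add_comm _ _
  obtain ⟨p1, p2⟩ := Cox.height_pos_of_mem_add hx
  have l1 := Real.log_nonpos p1.le (κ.height_le_one hx.1)
  have l2 := Real.log_nonpos p2.le (κ'.height_le_one hx.1)
  rw [T.eq_treeAt hκ hκ' h12 h23 h13 hb, κ.const_mul_const κ' hx, Real.log_mul p1.ne' p2.ne',
    neg_add, ENNReal.ofReal_add (by linarith) (by linarith)]
  simp only [GTree.area, treeAt, gradField_self, metricSq_zero hx.1, lintegral_zero, add_zero]
  rw [Cox.lintegral_edge hκ hx.1 (Cox.tt_of_mem_add hb hx).1 (Cox.rr_of_mem_add hb hn hx),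
    Cox.lintegral_edge hκ' hx.1 (Cox.tt_of_mem_add hb hx).2
      (Cox.rr_of_mem_add (κ := κ') (κ' := κ) (by rwa [hc]) (by rwa [hc]) (by rwa [hc]))]

end Trees

theorem Cox.hasDeg_iff {κ : Cox} {L L' : ℤ × ℤ} (hκ : κ.deg = L' - L) {V : Gen L L'}
    (hV : V.1 = κ.cell) (n : ℕ) : V.HasDeg n ↔ n = 0 := by
  have h (v : ℝ × ℝ) (hv : v ∈ V.1) : dimH (stable L L' v) = 0 := by
    rw [Cox.stable_eq hκ (hV ▸ hv), dimH_singleton]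
  obtain ⟨x, hx⟩ := κ.cell_nonempty
  constructor
  · intro hn
    have := hn x (hV ▸ hx)
    rw [h x (hV ▸ hx)] at this
    exact_mod_cast this.symm
  · rintro rfl v hv
    simpa using h v hv

theorem subsingleton_HGT {L1 L2 L3 : ℤ × ℤ} {V12 : Gen L1 L2} {V23 : Gen L2 L3} {V13 : Gen L1 L3}
    (h : ∀ T T' : GTree V12 V23 V13, T.Homotopic T') : Subsingleton (HGT V12 V23 V13) := by
  refine ⟨fun a b => ?_⟩
  induction a using Quot.ind
  induction b using Quot.ind
  exact Quot.sound (h _ _)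

/-- All degrees are 0 and there is exactly one homotopy class, so the sum is a single exponential.
-/
theorem treeCoeff_eq {L1 L2 L3 : ℤ × ℤ} {V12 : Gen L1 L2} {V23 : Gen L2 L3} {V13 : Gen L1 L3}
    {κ κ' : Cox} (hκ : κ.deg = L2 - L1) (hκ' : κ'.deg = L3 - L2) (h12 : V12.1 = κ.cell)
    (h23 : V23.1 = κ'.cell) (h13 : V13.1 = (κ + κ').cell)
    (hb : (κ + κ').k₂ + (κ + κ').l₂ ≤ 1)
    (hn : (κ + κ').k₂ + (κ + κ').l₂ = 0 → (κ + κ').k₁ + (κ + κ').l₁ ≤ 1) :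
    treeCoeff V12 V23 V13 = κ.const * κ'.const / (κ + κ').const := by
  have hd : (κ + κ').deg = L3 - L1 := by
    rw [Cox.deg_add, hκ, hκ']
    abel
  have := subsingleton_HGT (GTree.homotopic hκ hκ' h12 h23 h13 hb)
  obtain ⟨x, hx⟩ := (κ + κ').cell_nonempty
  obtain ⟨p1, p2⟩ := Cox.height_pos_of_mem_add hx
  have : Unique (HGT V12 V23 V13) :=
    uniqueOfSubsingleton (Quot.mk _ (treeAt hκ hκ' h12 h23 h13 hb x hx))
  rw [treeCoeff, if_pos ⟨0, 0, (Cox.hasDeg_iff hκ h12 0).2 rfl, (Cox.hasDeg_iff hκ' h23 0).2 rfl,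
    (Cox.hasDeg_iff hd h13 0).2 rfl⟩, finsum_unique,
    GTree.area_eq hκ hκ' h12 h23 h13 hb hn, ENNReal.toReal_ofReal, neg_neg, Real.exp_log]
  · rw [κ.const_mul_const κ' hx]
    positivity
  · rw [κ.const_mul_const κ' hx]
    exact neg_nonneg.2 (Real.log_nonpos (by positivity)
      (mul_le_one₀ (κ.height_le_one hx.1) p2.le (κ'.height_le_one hx.1)))

/-! ### The functor -/

section Functor

variable {L L' : ℤ × ℤ}

/-- The generator of a monomial. -/
def Cox.gen (κ : Cox) (hκ : κ.deg = L' - L) : Gen L L' := ⟨κ.cell, Cox.isGen hκ⟩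

/-- The exponents of the monomial of a generator. -/
def coxOf (hA : Acyclic (L' - L)) (V : Gen L L') : Cox := (exists_cox_of_isGen hA V.2).choose

theorem deg_coxOf (hA : Acyclic (L' - L)) (V : Gen L L') : (coxOf hA V).deg = L' - L :=
  (exists_cox_of_isGen hA V.2).choose_spec.1

theorem eq_cell_coxOf (hA : Acyclic (L' - L)) (V : Gen L L') : V.1 = (coxOf hA V).cell :=
  (exists_cox_of_isGen hA V.2).choose_spec.2

theorem coxOf_eq (hA : Acyclic (L' - L)) {V : Gen L L'} {κ : Cox} (hκ : κ.deg = L' - L)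
    (hV : V.1 = κ.cell) : coxOf hA V = κ :=
  Cox.eq_of_cell_eq ((deg_coxOf hA V).trans hκ.symm) ((eq_cell_coxOf hA V).symm.trans hV)

theorem coxOf_injective (hA : Acyclic (L' - L)) :
    Function.Injective (coxOf hA : Gen L L' → Cox) := fun V W h => by
  apply Subtype.ext
  rw [eq_cell_coxOf hA V, eq_cell_coxOf hA W, h]

/-- The degree bounds the exponents k₁ and k₂, and these determine the generator. -/
theorem finite_gen (hA : Acyclic (L' - L)) : Finite (Gen L L') := by
  have hb (V : Gen L L') : (coxOf hA V).k₁ < ((L' - L).1 + (L' - L).2).toNat + 1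
      ∧ (coxOf hA V).k₂ < (L' - L).2.toNat + 1 := by
    have := deg_coxOf hA V
    rw [← this]
    simp only [Cox.deg]
    omega
  refine Finite.of_injective (fun V : Gen L L' =>
    ((⟨(coxOf hA V).k₁, (hb V).1⟩, ⟨(coxOf hA V).k₂, (hb V).2⟩) : Fin _ × Fin _)) fun V W h => ?_
  simp only [Prod.mk.injEq, Fin.mk.injEq] at h
  exact coxOf_injective hA (Cox.eq_of_deg_eq ((deg_coxOf hA V).trans (deg_coxOf hA W).symm) h.1 h.2)

/-- The section of a generator. -/
def peakForm (hA : Acyclic (L' - L)) (V : Gen L L') : VHom L L' :=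
  ⟨((coxOf hA V).sect, 0, 0, 0), deg_coxOf hA V ▸ (coxOf hA V).section_mem⟩

/-- The functor on morphisms. -/
def iota (hA : Acyclic (L' - L)) : MoHom L L' →ₗ[ℂ] VHom L L' :=
  Finsupp.linearCombination ℂ (peakForm hA)

theorem iota_single (hA : Acyclic (L' - L)) (V : Gen L L') (a : ℂ) :
    iota hA (Finsupp.single V a) = a • peakForm hA V := Finsupp.linearCombination_single _ _ _

theorem peakForm_mem (hA : Acyclic (L' - L)) (V : Gen L L') : peakForm hA V ∈ vGr L L' 0 := by
  simp [vGr, peakForm]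

theorem iota_mem (hA : Acyclic (L' - L)) (f : MoHom L L') : iota hA f ∈ vGr L L' 0 := by
  rw [iota, Finsupp.linearCombination_apply]
  exact Submodule.sum_mem _ fun V _ => Submodule.smul_mem _ _ (peakForm_mem hA V)

theorem vD_iota (hA : Acyclic (L' - L)) (f : MoHom L L') : vD L L' (iota hA f) = 0 := by
  let d : VHom L L' →ₗ[ℂ] VHom L L' :=
    { toFun := vD L L'
      map_add' := fun F K => Subtype.ext (formD_add F.2 K.2)
      map_smul' := fun k F => Subtype.ext (formD_smul F.2 k) }
  have h : d ∘ₗ iota hA = 0 := by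
    refine Finsupp.lhom_ext fun V a => ?_
    rw [LinearMap.comp_apply, iota_single, map_smul]
    have : d (peakForm hA V) = 0 := Subtype.ext ((coxOf hA V).formD_section (deg_coxOf hA V))
    rw [this]
    simp
  exact LinearMap.congr_fun h f

theorem iota_apply (hA : Acyclic (L' - L)) (f : MoHom L L') (z : ℂ × ℂ) :
    (iota hA f).1.1 z = ∑ V ∈ f.support, f V * (coxOf hA V).sect z := by
  let ev : VHom L L' →ₗ[ℂ] ℂ :=
    { toFun := fun F => F.1.1 z
      map_add' := fun _ _ => rfl
      map_smul' := fun _ _ => rfl }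
  have : (iota hA f).1.1 z = ev (iota hA f) := rfl
  rw [this, iota, Finsupp.linearCombination_apply, Finsupp.sum, map_sum]
  rfl

/-- The character of the torus of a monomial. -/
def Cox.character (κ : Cox) : Multiplicative (ℂ × ℂ) →* ℂ where
  toFun z := Complex.exp (κ.k₁ * z.toAdd.1 + κ.k₂ * z.toAdd.2)
  map_one' := by simp
  map_mul' z w := by
    rw [← Complex.exp_add]
    congr 1
    simp only [toAdd_mul, Prod.fst_add, Prod.snd_add]
    ring

/-- Values at the real points (1, 0) and (0, 1) give back k₁ and k₂. -/
theorem character_injective (hA : Acyclic (L' - L)) :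
    Function.Injective fun V : Gen L L' => (coxOf hA V).character := by
  intro V W h
  have key (k k' : ℕ) (e : Complex.exp k = Complex.exp k') : k = k' := by
    have e' : Real.exp k = Real.exp k' := by
      apply Complex.ofReal_injective
      simpa using e
    exact_mod_cast Real.exp_injective e'
  refine coxOf_injective hA (Cox.eq_of_deg_eq ((deg_coxOf hA V).trans (deg_coxOf hA W).symm)
    (key _ _ ?_) (key _ _ ?_))
  · simpa [Cox.character] using DFunLike.congr_fun h (Multiplicative.ofAdd ((1 : ℂ), (0 : ℂ)))
  · simpa [Cox.character] using DFunLike.congr_fun h (Multiplicative.ofAdd ((0 : ℂ), (1 : ℂ)))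

/-- Up to the common nonvanishing factor e^{-f}, with f the potential, generators go to nonzero
multiples of distinct characters, which are linearly independent by Dedekind's theorem. -/
theorem iota_injective (hA : Acyclic (L' - L)) : Function.Injective (iota hA) := by
  rw [← LinearMap.ker_eq_bot, LinearMap.ker_eq_bot']
  intro f hf
  have hli := (linearIndependent_monoidHom (Multiplicative (ℂ × ℂ)) ℂ).comp _
    (character_injective hA)
  rw [linearIndependent_iff'] at hli
  have h := hli f.support (fun V => f V * (coxOf hA V).const) (by
    funext z
    have h1 := iota_apply hA f z.toAdd
    rw [hf] at h1
    have h2 : ∑ V ∈ f.support, f V * (coxOf hA V).sect z.toAdd = 0 := h1.symm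
    have h3 (V : Gen L L') : f V * (coxOf hA V).const * (coxOf hA V).character z =
        Complex.exp (potential (L' - L) z.toAdd) * (f V * (coxOf hA V).sect z.toAdd) := by
      simp only [Cox.sect, Cox.character, deg_coxOf, Complex.exp_sub]
      change _ * Complex.exp _ = _
      field_simp
    simp only [Finset.sum_apply, Pi.smul_apply, smul_eq_mul, Function.comp_apply, h3, Pi.zero_apply]
    rw [← Finset.mul_sum, h2, mul_zero])
  ext V
  by_contra hV
  have h0 := h V (Finsupp.mem_support_iff.2 hV)
  have hc : ((coxOf hA V).const : ℂ) ≠ 0 := by exact_mod_cast (coxOf hA V).const_pos.ne'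
  exact hV ((mul_eq_zero.1 h0).resolve_right hc)

theorem peaksOn_iota (hA : Acyclic (L' - L)) (V : Gen L L') :
    PeaksOn (iota hA (Finsupp.single V 1)) V.1 := by
  rw [iota_single, one_smul]
  set κ := coxOf hA V with hκ
  have hn (x : ℝ × ℝ) : ‖(κ.height x : ℂ)‖ = κ.height x := by
    rw [Complex.norm_real, Real.norm_of_nonneg (κ.height_nonneg x)]
  refine ⟨peakForm_mem hA V, ((κ.k₁ : ℤ), (κ.k₂ : ℤ)), fun x => κ.height x,
    Complex.continuous_ofReal.comp_continuousOn κ.continuousOn_height, fun z => ?_, ⟨?_, ?_⟩, ?_⟩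
  · exact (κ.section_eq z).trans (by simp)
  · obtain ⟨x, hx⟩ := κ.cell_nonempty
    exact ⟨x, hx.1, (hn x).trans (κ.height_eq_one hx)⟩
  · rintro _ ⟨x, hx, rfl⟩
    simp only [hn]
    exact κ.height_le_one hx
  · simp only [hn]
    rw [eq_cell_coxOf hA V]
    ext x
    exact ⟨fun h => κ.mem_cell_of_height_eq_one h.1 h.2, fun h => ⟨h.1, κ.height_eq_one h⟩⟩

/-- The generator P belongs to the monomial with all exponents 0, whose normalizing constant is 1.
-/
theorem iota_one (hA : Acyclic (L - L)) :
    iota hA (Finsupp.single ⟨P, isGen_P L⟩ 1) = vOne L := by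
  have hκ : coxOf hA (⟨P, isGen_P L⟩ : Gen L L) = ⟨0, 0, 0, 0⟩ := by
    refine coxOf_eq hA ?_ ?_
    · simp [Cox.deg]
    · simp [Cox.cell]
  refine (iota_single hA _ 1).trans ?_
  rw [one_smul]
  apply Subtype.ext
  simp only [peakForm, hκ, vOne]
  congr 1
  funext z
  simp [Cox.sect, Cox.const, bernMax, bern, Cox.deg, potential]

theorem moGr_zero (hA : Acyclic (L' - L)) : moGr L L' 0 = ⊤ := by
  rw [moGr, ← Finsupp.supported_univ]
  congr 1
  ext V
  simpa using (Cox.hasDeg_iff (deg_coxOf hA V) (eq_cell_coxOf hA V) 0).2 rfl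

theorem moGr_of_ne (hA : Acyclic (L' - L)) {d : ℤ} (hd : d ≠ 0) : moGr L L' d = ⊥ := by
  rw [moGr, ← Finsupp.supported_empty]
  congr 1
  ext V
  simp only [mem_ofPred_eq, mem_empty_iff_false, iff_false]
  rintro ⟨n, hn, h⟩
  rw [Cox.hasDeg_iff (deg_coxOf hA V) (eq_cell_coxOf hA V)] at h
  subst h
  exact hd (by simpa using hn.symm)

theorem iota_mem_of_mem (hA : Acyclic (L' - L)) {d : ℤ} {f : MoHom L L'} (hf : f ∈ moGr L L' d) :
    iota hA f ∈ vGr L L' d := by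
  by_cases hd : d = 0
  · subst hd
    exact iota_mem hA f
  · rw [moGr_of_ne hA hd] at hf
    rw [(Submodule.mem_bot ℂ).1 hf, map_zero]
    exact zero_mem _

/-- Every closed form is cohomologous to a combination of monomials. -/
theorem exists_iota_add (hA : Acyclic (L' - L)) {g : VHom L L'} (hg : vD L L' g = 0) :
    ∃ f, ∃ g', g = iota hA f + vD L L' g' := by
  obtain ⟨⟨F₀, F₁, F₂, F₃⟩, hF⟩ := g
  have hd : formD L L' (F₀, F₁, F₂, F₃) = 0 := congrArg Subtype.val hg
  have d1 := congrArg (fun F : Form => F.2.1) hd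
  have d2 := congrArg (fun F : Form => F.2.2.1) hd
  have d3 := congrArg (fun F : Form => F.2.2.2) hd
  have c0 : formD L L' (F₀, 0, 0, 0) = 0 := by
    refine Prod.ext rfl (Prod.ext d1 (Prod.ext d2 ?_))
    funext z
    simp [formD, dbar_zero]
  have c1 : formD L L' (0, F₁, F₂, 0) = 0 := by
    refine Prod.ext rfl (Prod.ext ?_ (Prod.ext ?_ d3)) <;>
    · funext z
      simp [formD, dbar_zero]
  have m0 := deg_zero_mem hF
  have m1 := deg_one_mem hF
  have m2 := deg_two_mem hF
  obtain ⟨G, hG, eG⟩ := exists_primitive_deg_one hA m1 c1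
  obtain ⟨H, hH, eH⟩ := exists_primitive_deg_two (n := ((L' - L).2 + 1).toNat)
    (by rcases hA with h | ⟨-, h | h⟩ <;> omega) m2
  obtain ⟨A, hA'⟩ := exists_eq_sum_monomials hA m0 c0
  -- The exponents l₁ and l₂ are forced by the degree. Inside the ranges of summation nothing is
  -- truncated, so the condition in `f` always holds.
  let κ (k₁ k₂ : ℕ) : Cox := ⟨k₁, ((L' - L).1 + (L' - L).2 - k₂ - k₁).toNat, k₂,
    ((L' - L).2 - k₂).toNat⟩
  open Classical in
  let f : MoHom L L' := ∑ k₂ ∈ Finset.range ((L' - L).2 + 1).toNat,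
    ∑ k₁ ∈ Finset.range ((L' - L).1 + (L' - L).2 - k₂ + 1).toNat,
      if h : (κ k₁ k₂).deg = L' - L then
        Finsupp.single ((κ k₁ k₂).gen h) (A k₁ k₂ / (κ k₁ k₂).const) else 0
  have e0 : (iota hA f).1.1 = F₀ := by
    funext z
    let ev : VHom L L' →ₗ[ℂ] ℂ :=
      { toFun := fun F => frame (L' - L) 1 z * F.1.1 z
        map_add' := fun _ _ => mul_add _ _ _
        map_smul' := fun _ _ => mul_left_comm _ _ _ }
    apply mul_left_cancel₀ (frame_ne (L' - L) 1 z)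
    have : frame (L' - L) 1 z * (iota hA f).1.1 z = ev (iota hA f) := rfl
    rw [this]
    simp only [f, map_sum]
    refine Eq.trans ?_ (hA' z).symm
    refine Finset.sum_congr rfl fun k₂ hk₂ => Finset.sum_congr rfl fun k₁ hk₁ => ?_
    rw [Finset.mem_range] at hk₁ hk₂
    have hdeg : (κ k₁ k₂).deg = L' - L := by
      ext <;> simp only [κ, Cox.deg] <;> omega
    have hc : ((κ k₁ k₂).const : ℂ) ≠ 0 := by exact_mod_cast (κ k₁ k₂).const_pos.ne'
    rw [dif_pos hdeg, iota_single, map_smul]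
    have hs := (κ k₁ k₂).frame_mul_section false false z
    rw [hdeg] at hs
    have hv : ev (peakForm hA ((κ k₁ k₂).gen hdeg)) =
        frame (L' - L) 1 z * (κ k₁ k₂).sect z := by
      change frame (L' - L) 1 z * (coxOf hA ((κ k₁ k₂).gen hdeg)).sect z = _
      rw [coxOf_eq hA hdeg rfl]
    rw [hv]
    refine (congrArg (fun w => (A k₁ k₂ / (κ k₁ k₂).const) • w) hs).trans ?_
    generalize (κ k₁ k₂).const = C at hc ⊢
    simp only [smul_eq_mul, Bool.false_eq_true, if_false, κ]
    rw [← mul_assoc, div_mul_cancel₀ _ hc]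
    simp [ix, chart, chartMat]
  refine ⟨f, ⟨G + H, add_mem hG hH⟩, Subtype.ext ?_⟩
  have hm := iota_mem hA f
  obtain ⟨-, n1, n2⟩ := hm
  obtain ⟨n1, n1'⟩ := n1 (by norm_num)
  have n2 := n2 (by norm_num)
  have e : (iota hA f).1 = (F₀, 0, 0, 0) := Prod.ext e0 (Prod.ext n1 (Prod.ext n1' n2))
  change (F₀, F₁, F₂, F₃) = (iota hA f).1 + formD L L' (G + H)
  rw [e, formD_add hG hH, eG, eH]
  simp

end Functor

/-! ### Compatibility with compositions. -/

section Composition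

variable {L1 L2 L3 : ℤ × ℤ}

theorem moMul_isLinearMap_left (g : MoHom L2 L3) : IsLinearMap ℂ fun f => moMul L1 L2 L3 f g := by
  refine ⟨fun f f' => ?_, fun c f => ?_⟩
  · refine Finsupp.sum_add_index' (fun V => ?_) fun V z z' => ?_
    · simp
    · rw [← Finsupp.sum_add]
      simp only [add_mul, add_smul]
  · rw [moMul, Finsupp.sum_smul_index' fun V => by simp, moMul, Finsupp.smul_sum]
    simp only [Finsupp.smul_sum, smul_smul, smul_eq_mul, mul_assoc]

theorem moMul_isLinearMap_right (f : MoHom L1 L2) : IsLinearMap ℂ fun g => moMul L1 L2 L3 f g := by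
  refine ⟨fun g g' => ?_, fun c g => ?_⟩
  · simp only [moMul]
    rw [← Finsupp.sum_add]
    refine Finsupp.sum_congr fun V _ => ?_
    exact Finsupp.sum_add_index' (fun W => by simp) fun W z z' => by rw [mul_add, add_smul]
  · simp only [moMul]
    rw [Finsupp.smul_sum]
    refine Finsupp.sum_congr fun V _ => ?_
    rw [Finsupp.sum_smul_index' fun W => by simp, Finsupp.smul_sum]
    simp only [smul_smul, smul_eq_mul, mul_left_comm]

theorem zero_eq_moMul_zero_add (f : MoHom L1 L2) (g : MoHom L2 L3) (n : ℤ) :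
    0 = moMul L1 L2 L3 0 g + n • moMul L1 L2 L3 f 0 := by
  rw [(moMul_isLinearMap_left g).map_zero, (moMul_isLinearMap_right f).map_zero, smul_zero,
    add_zero]

/-- These are the bounds under which incoming edges are constant or run in a horizontal side. -/
theorem exponents_le {κ : Cox} {D : ℤ × ℤ} (hD : Acyclic D) (hn : D.2 = 0 → D.1 ≤ 1)
    (hκ : κ.deg = D) : κ.k₂ + κ.l₂ ≤ 1 ∧ (κ.k₂ + κ.l₂ = 0 → κ.k₁ + κ.l₁ ≤ 1) := by
  subst hκ
  simp only [Acyclic, Cox.deg] at hD hn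
  omega

/-- Only the generator of the product monomial is the end of a tree, and its coefficient is the
constant by which the product of normalized monomials differs from a normalized monomial. -/
theorem iota_moMulGen (h12 : Acyclic (L2 - L1)) (h23 : Acyclic (L3 - L2))
    (h13 : Acyclic (L3 - L1)) (hn : (L3 - L1).2 = 0 → (L3 - L1).1 ≤ 1)
    (V : Gen L1 L2) (W : Gen L2 L3) :
    iota h13 (moMulGen V W) = vMul L1 L2 L3 (peakForm h12 V) (peakForm h23 W) := by
  set κ := coxOf h12 V with hκ
  set κ' := coxOf h23 W with hκ'
  have d := deg_coxOf h12 V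
  have d' := deg_coxOf h23 W
  have c := eq_cell_coxOf h12 V
  have c' := eq_cell_coxOf h23 W
  have hd : (κ + κ').deg = L3 - L1 := by
    rw [Cox.deg_add, hκ, hκ', d, d']
    abel
  obtain ⟨b1, b2⟩ := exponents_le h13 hn hd
  have hm : moMulGen V W = Finsupp.single ((κ + κ').gen hd)
      ((κ.const * κ'.const / (κ + κ').const : ℝ) : ℂ) := by
    rw [moMulGen, finsum_eq_single _ ((κ + κ').gen hd)]
    · rw [treeCoeff_eq d d' c c' rfl b1 b2]
    · intro U hU
      have : IsEmpty (HGT V W U) := by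
        refine ⟨fun T => ?_⟩
        obtain ⟨T, rfl⟩ := Quot.exists_rep T
        have e := T.eq_add d d' (deg_coxOf h13 U) c c' (eq_cell_coxOf h13 U)
        exact hU (Subtype.ext ((eq_cell_coxOf h13 U).trans (by rw [e]; rfl)))
      have hz : treeCoeff V W U = 0 := by
        rw [treeCoeff]
        split_ifs
        · exact finsum_of_isEmpty _
        · rfl
      rw [hz]
      simp
  rw [hm, iota_single]
  apply Subtype.ext
  have e : coxOf h13 ((κ + κ').gen hd) = κ + κ' := coxOf_eq h13 hd rfl
  change _ • ((coxOf h13 ((κ + κ').gen hd)).sect, (0 : ℂ × ℂ → ℂ), (0 : ℂ × ℂ → ℂ),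
    (0 : ℂ × ℂ → ℂ)) = formMul (κ.sect, 0, 0, 0) (κ'.sect, 0, 0, 0)
  rw [e]
  refine Prod.ext ?_ (Prod.ext ?_ (Prod.ext ?_ ?_))
  · funext z
    exact (κ.section_mul κ' z).symm
  all_goals simp [formMul]

theorem iota_moMul (h12 : Acyclic (L2 - L1)) (h23 : Acyclic (L3 - L2))
    (h13 : Acyclic (L3 - L1)) (hn : (L3 - L1).2 = 0 → (L3 - L1).1 ≤ 1)
    (f : MoHom L1 L2) (g : MoHom L2 L3) :
    iota h13 (moMul L1 L2 L3 f g) = vMul L1 L2 L3 (iota h12 f) (iota h23 g) := by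
  have hl (K : VHom L2 L3) : vMul L1 L2 L3 (iota h12 f) K
      = f.sum fun V z => z • vMul L1 L2 L3 (peakForm h12 V) K := by
    have := map_finsuppSum (IsLinearMap.mk' _ (vMul_isLinearMap_left (L1 := L1) K)) f
      fun V z => z • peakForm h12 V
    simp only [map_smul] at this
    exact this
  have hr (F : VHom L1 L2) : vMul L1 L2 L3 F (iota h23 g)
      = g.sum fun W z => z • vMul L1 L2 L3 F (peakForm h23 W) := by
    have := map_finsuppSum (IsLinearMap.mk' _ (vMul_isLinearMap_right (L3 := L3) F)) g
      fun W z => z • peakForm h23 W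
    simp only [map_smul] at this
    exact this
  rw [hl, moMul, map_finsuppSum]
  refine Finsupp.sum_congr fun V _ => ?_
  rw [hr, map_finsuppSum, Finsupp.smul_sum]
  refine Finsupp.sum_congr fun W _ => ?_
  rw [map_smul, iota_moMulGen h12 h23 h13 hn, smul_smul]

end Composition

/-! ### The equivalence -/

section Category

variable {Ob : Type} {E : Ob → ℤ × ℤ}

theorem moWellDefined (hE : ∀ i j, Acyclic (E j - E i))
    (hn : ∀ i j, (E j - E i).2 = 0 → (E j - E i).1 ≤ 1) : MoWellDefined E := by
  refine ⟨fun i j => finite_gen (hE i j), fun i j k V W U => ?_⟩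
  have d := deg_coxOf (hE i j) V
  have d' := deg_coxOf (hE j k) W
  have c := eq_cell_coxOf (hE i j) V
  have c' := eq_cell_coxOf (hE j k) W
  have hs (T : GTree V W U) :
      U.1 = (coxOf (hE i j) V + coxOf (hE j k) W).cell := by
    rw [eq_cell_coxOf (hE i k) U, T.eq_add d d' (deg_coxOf (hE i k) U) c c'
      (eq_cell_coxOf (hE i k) U)]
  obtain ⟨b1, b2⟩ := exponents_le (hE i k) (hn i k)
    (show (coxOf (hE i j) V + coxOf (hE j k) W).deg = _ by rw [Cox.deg_add, d, d']; abel)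
  refine ⟨?_, fun T => ?_, fun T T' _ => ?_⟩
  · have := subsingleton_HGT fun T T' : GTree V W U => T.homotopic d d' c c' (hs T) b1 T'
    infer_instance
  · rw [T.area_eq d d' c c' (hs T) b1 b2]
    exact ENNReal.ofReal_ne_top
  · rw [T.area_eq d d' c c' (hs T) b1 b2, T'.area_eq d d' c c' (hs T) b1 b2]

theorem moCat_m_eq_zero {i j : Ob} (w : Word (moCat E).Hom i j) (h : w.length ≠ 2) :
    (moCat E).m w = 0 := by
  match w, h with
  | .nil _, _ => rfl
  | .cons _ (.nil _), _ => rfl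
  | .cons _ (.cons _ (.nil _)), h => exact absurd rfl h
  | .cons _ (.cons _ (.cons _ _)), _ => rfl

theorem moMul_mem (hE : ∀ i j, Acyclic (E j - E i)) {i j k : Ob} {n l : ℤ}
    {f : MoHom (E i) (E j)} {g : MoHom (E j) (E k)} (hf : f ∈ moGr (E i) (E j) n)
    (hg : g ∈ moGr (E j) (E k) l) : moMul _ _ _ f g ∈ moGr (E i) (E k) (n + l) := by
  by_cases hn : n = 0
  · by_cases hl : l = 0
    · rw [hn, hl, add_zero, moGr_zero (hE i k)]
      trivial
    · rw [moGr_of_ne (hE j k) hl] at hg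
      rw [(Submodule.mem_bot ℂ).1 hg, (moMul_isLinearMap_right f).map_zero]
      exact zero_mem _
  · rw [moGr_of_ne (hE i j) hn] at hf
    rw [(Submodule.mem_bot ℂ).1 hf, (moMul_isLinearMap_left g).map_zero]
    exact zero_mem _

/-- Associativity is pulled back from the wedge product along the injective multiplicative map
`iota`, without comparing trees. -/
theorem moMul_assoc (hE : ∀ i j, Acyclic (E j - E i))
    (hn : ∀ i j, (E j - E i).2 = 0 → (E j - E i).1 ≤ 1) {i j k l : Ob}
    (f : MoHom (E i) (E j)) (g : MoHom (E j) (E k)) (h : MoHom (E k) (E l)) :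
    moMul _ _ _ (moMul _ _ _ f g) h = moMul _ _ _ f (moMul _ _ _ g h) := by
  apply iota_injective (hE i l)
  rw [iota_moMul (hE i k) (hE k l) (hE i l) (hn i l),
    iota_moMul (hE i j) (hE j k) (hE i k) (hn i k), iota_moMul (hE i j) (hE j l) (hE i l) (hn i l),
    iota_moMul (hE j k) (hE k l) (hE j l) (hn j l)]
  apply Subtype.ext
  change formMul (formMul _ _) _ = formMul _ (formMul _ _)
  refine Prod.ext ?_ (Prod.ext ?_ (Prod.ext ?_ ?_)) <;> simp only [formMul] <;> ring

theorem one_moMul (hE : ∀ i j, Acyclic (E j - E i))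
    (hn : ∀ i j, (E j - E i).2 = 0 → (E j - E i).1 ≤ 1) {i j : Ob} (f : MoHom (E i) (E j)) :
    moMul _ _ _ (Finsupp.single (⟨P, isGen_P (E i)⟩ : Gen (E i) (E i)) 1) f = f := by
  apply iota_injective (hE i j)
  rw [iota_moMul (hE i i) (hE i j) (hE i j) (hn i j)]
  refine (congrArg (fun F => vMul _ _ _ F (iota (hE i j) f)) (iota_one (hE i i))).trans ?_
  exact (isAInf_vCat E).one_m2 (X := i) (Y := j) (iota (hE i j) f)

theorem moMul_one (hE : ∀ i j, Acyclic (E j - E i))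
    (hn : ∀ i j, (E j - E i).2 = 0 → (E j - E i).1 ≤ 1) {i j : Ob} (f : MoHom (E i) (E j)) :
    moMul _ _ _ f (Finsupp.single (⟨P, isGen_P (E j)⟩ : Gen (E j) (E j)) 1) = f := by
  apply iota_injective (hE i j)
  rw [iota_moMul (hE i j) (hE j j) (hE i j) (hn i j)]
  refine (congrArg (fun F => vMul _ _ _ (iota (hE i j) f) F) (iota_one (hE j j))).trans ?_
  exact (isAInf_vCat E).m2_one (X := i) (Y := j) (iota (hE i j) f)

theorem isAInf_moCat (hE : ∀ i j, Acyclic (E j - E i))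
    (hn : ∀ i j, (E j - E i).2 = 0 → (E j - E i).1 ≤ 1) : (moCat E).IsAInf := by
  have h0 (i j : Ob) : (moCat E).gr i j 0 = ⊤ := moGr_zero (hE i j)
  exact AInfData.isAInf_of_dg (moCat E) (fun _ _ _ => 0)
    (fun i j k => moMul (E i) (E j) (E k)) (fun _ => rfl)
    (fun i j => AInfData.isInternal_of_concentrated (h0 i j)
      fun d hd => moGr_of_ne (hE i j) hd)
    (fun i j => ⟨fun _ _ => (add_zero 0).symm, fun _ _ => (smul_zero _).symm⟩)
    (fun i j k g => moMul_isLinearMap_left g) (fun i j k f => moMul_isLinearMap_right f)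
    (fun i j n f _ => zero_mem _) (fun i j k n l f g hf hg => moMul_mem hE hf hg)
    (fun _ _ _ => rfl) (fun i j k n f g _ => zero_eq_moMul_zero_add f g _) (fun i j k l => moMul_assoc hE hn)
    (fun i => (h0 i i).symm ▸ Submodule.mem_top) (fun i j => one_moMul hE hn) (fun i j => moMul_one hE hn) (fun _ => rfl)

theorem isLinearEquivalence_iota (hE : ∀ i j, Acyclic (E j - E i))
    (hn : ∀ i j, (E j - E i).2 = 0 → (E j - E i).1 ≤ 1) :
    (moCat E).IsLinearEquivalence (vCat E) fun i j => iota (hE i j) where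
  degree i j d f hf := iota_mem_of_mem (hE i j) hf
  map_m {i j} w := by
    match w with
    | .nil _ => exact map_zero _
    | .cons f (.nil _) => exact (map_zero _).trans (vD_iota (hE _ _) f).symm
    | .cons f (.cons g (.nil _)) => exact iota_moMul (hE _ _) (hE _ _) (hE _ _) (hn _ _) f g
    | .cons _ (.cons _ (.cons _ _)) => exact map_zero _
  map_one i := iota_one (hE i i)
  coh_injective i j f _ := by
    -- The image of f has degree 0, while an exact form has no component of degree 0. So an exact
    -- image is zero, and injectivity of `iota` applies.
    rintro ⟨g, hg⟩
    refine ⟨0, iota_injective (hE i j) ?_⟩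
    refine Eq.trans ?_ (map_zero _).symm
    have hm := iota_mem (hE i j) f
    obtain ⟨-, n1, n2⟩ := hm
    obtain ⟨n1, n1'⟩ := n1 (by norm_num)
    have n2 := n2 (by norm_num)
    have h0 : (iota (hE i j) f).1.1 = 0 := by
      have : iota (hE i j) f = vD (E i) (E j) g := hg
      rw [this]
      rfl
    exact Subtype.ext (Prod.ext h0 (Prod.ext n1 (Prod.ext n1' n2)))
  coh_surjective i j g hg := by
    obtain ⟨f, g', h⟩ := exists_iota_add (hE i j) (g := g) hg
    exact ⟨f, rfl, g', h⟩

end Category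

/-! ### The given collection of four objects. -/

/-- Within each pair of objects b = 0 and a ∈ {-1, 0, 1}. From the first pair to the second b = 1
and a ∈ {c-1, c, c+1}, which is at least -1 because c ≥ 0; backwards b = -1. -/
theorem acyclic_coll (c : ℕ) (i j : Fin 4) : Acyclic (coll c j - coll c i) := by
  fin_cases i <;> fin_cases j <;> simp [coll, Acyclic] <;> omega

theorem coll_fst_le (c : ℕ) (i j : Fin 4) (h : (coll c j - coll c i).2 = 0) :
    (coll c j - coll c i).1 ≤ 1 := by
  revert h
  fin_cases i <;> fin_cases j <;> simp [coll]

end HMS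

end

theorem theorem3p1 (c : ℕ) :
    HMS.MoWellDefined (HMS.coll c) ∧
    (HMS.moCat (HMS.coll c)).IsAInf ∧
    (HMS.moCat (HMS.coll c)).DeterminedByM2 ∧
    (HMS.vCat (HMS.coll c)).IsAInf ∧
    ∃ ι : ∀ i j : Fin 4,
        (HMS.moCat (HMS.coll c)).Hom i j →ₗ[ℂ] (HMS.vCat (HMS.coll c)).Hom i j,
      (HMS.moCat (HMS.coll c)).IsLinearEquivalence (HMS.vCat (HMS.coll c)) ι ∧
      ∀ (i j : Fin 4) (V : HMS.Gen (HMS.coll c i) (HMS.coll c j)),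
        HMS.PeaksOn (ι i j (Finsupp.single V 1)) V.1 := by
  have hE := HMS.acyclic_coll c
  have hn := HMS.coll_fst_le c
  exact ⟨HMS.moWellDefined hE hn, HMS.isAInf_moCat hE hn,
    HMS.AInfData.determinedByM2_of_concentrated _ (fun i j => HMS.moGr_zero (hE i j))
      (fun i j d hd => HMS.moGr_of_ne (hE i j) hd) HMS.moCat_m_eq_zero,
    HMS.isAInf_vCat _, fun i j => HMS.iota (hE i j), HMS.isLinearEquivalence_iota hE hn,
    fun i j V => HMS.peaksOn_iota (hE i j) V⟩
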